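/- Let $k$ be a field of characteristic zero. All series below are elements of $k\langle\langle x,y\rangle\rangle$, the algebra of formal power series in two non-commuting variables, with the coproduct $\Delta x=x\otimes 1+1\otimes x$, $\Delta y=y\otimes 1+1\otimes y$; a series is group-like if it has constant term $1$ and $\Delta f=f\otimes f$. Write $\mathrm{ch}(a,b)=\ln(e^ae^b)$. Let $\mathrm{GT}(k)$ be the set of pairs $(\lambda,f)$ with $\lambda\in k^*$ and $f$ group-like such that $f(x,y)=f(y,x)^{-1}$, $$f(z,x)e^{mz}f(y,z)e^{my}f(x,y)e^{mx}=1\quad\text{for } e^xe^ye^z=1,\ m=\tfrac{\lambda-1}{2},$$ $$f(x_{1,2},\mathrm{ch}(x_{2,3},x_{2,4}))\,f(\mathrm{ch}(x_{1,3},x_{2,3}),x_{3,4})=f(x_{2,3},x_{3,4})\,f(\mathrm{ch}(x_{1,2},x_{1,3}),\mathrm{ch}(x_{2,4},x_{3,4}))\,f(x_{1,2},x_{2,3}),$$ the last equation in the $k$-prounipotent completion $\mathrm{PB}_4(k)$ of the pure braid group on four strands, with $x_{i,j}=\ln X_{i,j}$ for the standard generators $X_{i,j}=(\sigma_{j-1}\cdots\sigma_{i+1})\sigma_i^2(\sigma_{j-1}\cdots\sigma_{i+1})^{-1}$,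 $i<j$. Let $\mathrm{Assoc}_1(k)$ be the set of group-like $\Phi$ such that $\Phi(x,y)=\Phi(y,x)^{-1}$, $$e^{x/2}\Phi(z,x)e^{z/2}\Phi(y,z)e^{y/2}\Phi(x,y)=1\quad\text{for } x+y+z=0,$$ $$\Phi(t_{1,2},t_{2,3}+t_{2,4})\,\Phi(t_{1,3}+t_{2,3},t_{3,4})=\Phi(t_{2,3},t_{3,4})\,\Phi(t_{1,2}+t_{1,3},t_{2,4}+t_{3,4})\,\Phi(t_{1,2},t_{2,3}),$$ the last equation in $\exp(\mathfrak t_4)$, where $\mathfrak t_4$ is the degree completion of the Lie algebra with generators $t_{i,j}=t_{j,i}$, $1\le i\ne j\le 4$, and relations $[t_{i,j},t_{i,l}+t_{j,l}]=0$ for distinct $i,j,l$ and $[t_{i,j},t_{l,m}]=0$ for distinct $i,j,l,m$. Theorem. Let $(\lambda_0,f)\in\mathrm{GT}(k)$, where $\lambda_0$ is not a root of unity. Then there is a unique $\Phi\in\mathrm{Assoc}_1(k)$ such that $$f(\Phi(x,y)\,x\,\Phi(x,y)^{-1},y)\,\Phi(x,y)=\Phi(\lambda_0x,\lambda_0y).$$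 -/

import Mathlib

open scoped TensorProduct commutatorElement

/-! ### Noncommutative power series and their values in nilpotent algebras -/

/-- A formal power series in `k⟨⟨x, y⟩⟩`, given by its coefficients: a word in the letters
`0` (for `x`) and `1` (for `y`) is a monomial. -/
abbrev NCSeries (k : Type*) : Type _ := List (Fin 2) → k

section Nilpotent

variable {k : Type*} [Field k] {Q : Type*} [Ring Q] [Algebra k Q]

/-- The value `f(a, b)` of a series in an algebra in which all products of `N` of the elements
`a`, `b` vanish; only the words of length `< N` contribute. -/
def NCSeries.eval (N : ℕ) (f : NCSeries k) (a b : Q) : Q :=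
  ∑ n ∈ Finset.range N, ∑ w : Fin n → Fin 2,
    f (List.ofFn w) • (List.ofFn fun i => (![a, b] : Fin 2 → Q) (w i)).prod

variable (k)

/-- The exponential `exp a` of an element with `a ^ N = 0`. -/
def nilExp (N : ℕ) (a : Q) : Q :=
  ∑ n ∈ Finset.range N, ((n.factorial : k)⁻¹) • a ^ n

/-- The logarithm `ln u` of an element with `(u - 1) ^ N = 0`. -/
def nilLog (N : ℕ) (u : Q) : Q :=
  ∑ n ∈ Finset.Ico 1 N, ((-1 : k) ^ (n + 1) * (n : k)⁻¹) • (u - 1) ^ n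

/-- The Campbell-Hausdorff series `ch(a, b) = ln (exp a * exp b)`. -/
def nilCH (N : ℕ) (a b : Q) : Q :=
  nilLog k N (nilExp k N a * nilExp k N b)

end Nilpotent

/-! ### Augmented algebras

The completion of an algebra `A` with augmentation `ε` is `lim A / J ^ N`, where `J = ker ε`.
Elements of the completion are equal if and only if their images in all `A / J ^ N` are. -/

section Augmented

variable {k : Type*} [Field k] {A : Type*} [Ring A] [Algebra k A]

/-- The quotient `A / J ^ N`, where `J` is the augmentation ideal, the kernel of `ε`. -/
abbrev AugTrunc (ε : A →ₐ[k] k) (N : ℕ) : Type _ :=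
  A ⧸ (RingHom.ker ε) ^ N

/-- The image of an element of `A` in `A / J ^ N`. -/
def toTrunc (ε : A →ₐ[k] k) (N : ℕ) (a : A) : AugTrunc ε N :=
  Ideal.Quotient.mk ((RingHom.ker ε) ^ N) a

end Augmented

section Free

variable (k : Type*) [Field k]

/-- The augmentation of `k⟨x, y⟩`, with `x, y ↦ 0`. The completion is `k⟨⟨x, y⟩⟩`. -/
def freeAug : FreeAlgebra k (Fin 2) →ₐ[k] k :=
  FreeAlgebra.lift k fun _ => 0

/-- The variable `x` modulo terms of degree at least `N`. -/
def varX (N : ℕ) : AugTrunc (freeAug k) N :=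
  toTrunc (freeAug k) N (FreeAlgebra.ι k 0)

/-- The variable `y` modulo terms of degree at least `N`. -/
def varY (N : ℕ) : AugTrunc (freeAug k) N :=
  toTrunc (freeAug k) N (FreeAlgebra.ι k 1)

/-- The augmentation of `k⟨x, y⟩ ⊗ k⟨x, y⟩`; the completion is the completed tensor square of
`k⟨⟨x, y⟩⟩`. -/
def tensorAug : FreeAlgebra k (Fin 2) ⊗[k] FreeAlgebra k (Fin 2) →ₐ[k] k :=
  Algebra.TensorProduct.lift (freeAug k) (freeAug k) fun _ _ => Commute.all _ _

variable {k}

/-- Group-like series: the constant term is `1` and `Δ f = f ⊗ f`, where the coproduct `Δ` is the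
continuous algebra homomorphism with `Δ x = x ⊗ 1 + 1 ⊗ x` and `Δ y = y ⊗ 1 + 1 ⊗ y`. These series
form the prounipotent completion `F₂(k)` of the free group on `X = exp x`, `Y = exp y`. -/
def IsGroupLike (f : NCSeries k) : Prop :=
  f [] = 1 ∧ ∀ N : ℕ,
    let x : FreeAlgebra k (Fin 2) := FreeAlgebra.ι k 0
    let y : FreeAlgebra k (Fin 2) := FreeAlgebra.ι k 1
    let π := toTrunc (tensorAug k) N
    f.eval N (π (x ⊗ₜ 1 + 1 ⊗ₜ x)) (π (y ⊗ₜ 1 + 1 ⊗ₜ y)) =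
      f.eval N (π (x ⊗ₜ 1)) (π (y ⊗ₜ 1)) * f.eval N (π (1 ⊗ₜ x)) (π (1 ⊗ₜ y))

end Free

/-! ### The pure braid group -/

/-- Names of the standard generators `X_{i,j}`, `i < j`. -/
abbrev PBIndex (n : ℕ) : Type := {p : Fin n × Fin n // p.1 < p.2}

/-- The free generator `X_{i,j}`. -/
def PBIndex.free {n : ℕ} {i j : Fin n} (h : i < j) : FreeGroup (PBIndex n) :=
  FreeGroup.of ⟨(i, j), h⟩

open PBIndex in
/-- The relators of Artin's presentation of the pure braid group, for the generators
`X_{i,j} = (σ_{j-1} ⋯ σ_{i+1}) σ_i² (σ_{j-1} ⋯ σ_{i+1})⁻¹`. -/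
inductive PBRelator (n : ℕ) : FreeGroup (PBIndex n) → Prop
  /-- `X_{i,j}` commutes with `X_{i,k} X_{j,k}`. -/
  | left {i j k : Fin n} (hij : i < j) (hjk : j < k) :
      PBRelator n ⁅free hij, free (hij.trans hjk) * free hjk⁆
  /-- `X_{j,k}` commutes with `X_{i,j} X_{i,k}`. -/
  | right {i j k : Fin n} (hij : i < j) (hjk : j < k) :
      PBRelator n ⁅free hjk, free hij * free (hij.trans hjk)⁆
  /-- `X_{i,j}` commutes with `X_{k,l}`. -/
  | separate {i j k l : Fin n} (hij : i < j) (_hjk : j < k) (hkl : k < l) :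
      PBRelator n ⁅free hij, free hkl⁆
  /-- `X_{i,l}` commutes with `X_{j,k}`. -/
  | nested {i j k l : Fin n} (hij : i < j) (hjk : j < k) (hkl : k < l) :
      PBRelator n ⁅free (hij.trans (hjk.trans hkl)), free hjk⁆
  /-- `X_{i,k}` commutes with `X_{k,l}⁻¹ X_{j,l} X_{k,l}`. -/
  | crossed {i j k l : Fin n} (hij : i < j) (hjk : j < k) (hkl : k < l) :
      PBRelator n ⁅free (hij.trans hjk), (free hkl)⁻¹ * free (hjk.trans hkl) * free hkl⁆

/-- The pure braid group on `n` strands. -/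
abbrev PureBraidGroup (n : ℕ) : Type := PresentedGroup {r | PBRelator n r}

/-- The standard generator `X_{i,j}` of the pure braid group. -/
def PureBraidGroup.X {n : ℕ} {i j : Fin n} (h : i < j) : PureBraidGroup n :=
  PresentedGroup.of ⟨(i, j), h⟩

section PureBraidCompletion

variable (k : Type*) [Field k]

/-- The augmentation of the group algebra of the pure braid group. The prounipotent completion
`PB_n(k)` is the group of group-like elements of the completed group algebra. -/
noncomputable def pureBraidAug (n : ℕ) : MonoidAlgebra k (PureBraidGroup n) →ₐ[k] k :=
  MonoidAlgebra.lift k k (PureBraidGroup n) 1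

/-- The element `x_{i,j} = ln X_{i,j}` in the `N`-th quotient of the completed group algebra. -/
noncomputable def pbLog {n : ℕ} (N : ℕ) {i j : Fin n} (h : i < j) : AugTrunc (pureBraidAug k n) N :=
  nilLog k N (toTrunc (pureBraidAug k n) N
    (MonoidAlgebra.of k (PureBraidGroup n) (PureBraidGroup.X h)))

end PureBraidCompletion

/-! ### Infinitesimal braids -/

section InfinitesimalBraids

variable (k : Type*) [Field k]

/-- The defining relations of the Lie algebra `𝔱_n` of infinitesimal braids, as relations between
elements of the free associative algebra on symbols `t_{i,j}`. The symbols `t_{i,i}`, which are not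
generators of `𝔱_n`, are set to zero. -/
inductive InfBraidRel (n : ℕ) :
    FreeAlgebra k (Fin n × Fin n) → FreeAlgebra k (Fin n × Fin n) → Prop
  | diag (i : Fin n) : InfBraidRel n (FreeAlgebra.ι k (i, i)) 0
  | symm (i j : Fin n) : InfBraidRel n (FreeAlgebra.ι k (i, j)) (FreeAlgebra.ι k (j, i))
  | triple {i j l : Fin n} (hij : i ≠ j) (hil : i ≠ l) (hjl : j ≠ l) :
      InfBraidRel n ⁅FreeAlgebra.ι k (i, j), FreeAlgebra.ι k (i, l) + FreeAlgebra.ι k (j, l)⁆ 0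
  | disjoint {i j l m : Fin n} (hij : i ≠ j) (hil : i ≠ l) (him : i ≠ m) (hjl : j ≠ l)
      (hjm : j ≠ m) (hlm : l ≠ m) :
      InfBraidRel n ⁅FreeAlgebra.ι k (i, j), FreeAlgebra.ι k (l, m)⁆ 0

/-- The universal enveloping algebra of `𝔱_n`. Its completion contains the group `exp(𝔱_n)`. -/
abbrev InfBraidAlgebra (n : ℕ) : Type _ := RingQuot (InfBraidRel k n)

/-- The augmentation of `U(𝔱_n)`, with `t_{i,j} ↦ 0`. -/
noncomputable def infBraidAug (n : ℕ) : InfBraidAlgebra k n →ₐ[k] k :=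
  RingQuot.liftAlgHom k ⟨FreeAlgebra.lift k fun _ => 0, by
    intro a b h
    cases h <;> simp [Ring.lie_def]⟩

/-- The generator `t_{i,j}` modulo terms of degree at least `N`. -/
noncomputable def infT {n : ℕ} (N : ℕ) (i j : Fin n) : AugTrunc (infBraidAug k n) N :=
  toTrunc (infBraidAug k n) N (RingQuot.mkAlgHom k (InfBraidRel k n) (FreeAlgebra.ι k (i, j)))

end InfinitesimalBraids

/-! ### The Grothendieck-Teichmüller group and Drinfeld associators

The strands `1, 2, 3, 4` are the elements `0, 1, 2, 3` of `Fin 4`. -/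

section Main

variable {k : Type*} [Field k]

/-- `f(x, y) = f(y, x)⁻¹` in `k⟨⟨x, y⟩⟩`. -/
def Antisymmetry (f : NCSeries k) : Prop :=
  ∀ N : ℕ, f.eval N (varX k N) (varY k N) * f.eval N (varY k N) (varX k N) = 1

/-- `f(z, x) e^{mz} f(y, z) e^{my} f(x, y) e^{mx} = 1` in `k⟨⟨x, y⟩⟩`, where `e^x e^y e^z = 1`,
that is `z = -ch(x, y)`, and `m = (c - 1) / 2`. -/
def GTHexagon (c : k) (f : NCSeries k) : Prop :=
  ∀ N : ℕ,
    let x := varX k N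
    let y := varY k N
    let z := -nilCH k N x y
    let m : k := (c - 1) / 2
    f.eval N z x * nilExp k N (m • z) * f.eval N y z * nilExp k N (m • y) *
      f.eval N x y * nilExp k N (m • x) = 1

/-- The pentagon equation
`f(x₁₂, ch(x₂₃, x₂₄)) f(ch(x₁₃, x₂₃), x₃₄)
  = f(x₂₃, x₃₄) f(ch(x₁₂, x₁₃), ch(x₂₄, x₃₄)) f(x₁₂, x₂₃)` in `PB₄(k)`. -/
def GTPentagon (f : NCSeries k) : Prop :=
  ∀ N : ℕ,
    let x12 := pbLog k N (show (0 : Fin 4) < 1 by decide)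
    let x13 := pbLog k N (show (0 : Fin 4) < 2 by decide)
    let x23 := pbLog k N (show (1 : Fin 4) < 2 by decide)
    let x24 := pbLog k N (show (1 : Fin 4) < 3 by decide)
    let x34 := pbLog k N (show (2 : Fin 4) < 3 by decide)
    f.eval N x12 (nilCH k N x23 x24) * f.eval N (nilCH k N x13 x23) x34 =
      f.eval N x23 x34 * f.eval N (nilCH k N x12 x13) (nilCH k N x24 x34) * f.eval N x12 x23

/-- `e^{μx/2} Φ(z, x) e^{μz/2} Φ(y, z) e^{μy/2} Φ(x, y) = 1` in `k⟨⟨x, y⟩⟩`, where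
`x + y + z = 0`. -/
def AssocHexagon (μ : k) (Φ : NCSeries k) : Prop :=
  ∀ N : ℕ,
    let x := varX k N
    let y := varY k N
    let z := -(x + y)
    nilExp k N ((μ / 2) • x) * Φ.eval N z x * nilExp k N ((μ / 2) • z) * Φ.eval N y z *
      nilExp k N ((μ / 2) • y) * Φ.eval N x y = 1

/-- The pentagon equation
`Φ(t₁₂, t₂₃ + t₂₄) Φ(t₁₃ + t₂₃, t₃₄) = Φ(t₂₃, t₃₄) Φ(t₁₂ + t₁₃, t₂₄ + t₃₄) Φ(t₁₂, t₂₃)` in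
`exp(𝔱₄)`. -/
def AssocPentagon (Φ : NCSeries k) : Prop :=
  ∀ N : ℕ,
    let t12 := infT k N (0 : Fin 4) 1
    let t13 := infT k N (0 : Fin 4) 2
    let t23 := infT k N (1 : Fin 4) 2
    let t24 := infT k N (1 : Fin 4) 3
    let t34 := infT k N (2 : Fin 4) 3
    Φ.eval N t12 (t23 + t24) * Φ.eval N (t13 + t23) t34 =
      Φ.eval N t23 t34 * Φ.eval N (t12 + t13) (t24 + t34) * Φ.eval N t12 t23

variable (k) in
/-- The (underlying set of the) Grothendieck-Teichmüller group `GT(k)`. -/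
def GT : Set (kˣ × NCSeries k) :=
  {p | IsGroupLike p.2 ∧ Antisymmetry p.2 ∧ GTHexagon (p.1 : k) p.2 ∧ GTPentagon p.2}

/-- The set `Assoc_μ(k)` of Drinfeld associators. -/
def Assoc (μ : k) : Set (NCSeries k) :=
  {Φ | IsGroupLike Φ ∧ Antisymmetry Φ ∧ AssocHexagon μ Φ ∧ AssocPentagon Φ}

/-- `f(Φ(x, y) x Φ(x, y)⁻¹, y) Φ(x, y) = Φ(c x, c y)` in `k⟨⟨x, y⟩⟩`. -/
def FixedUpToRescaling (c : k) (f Φ : NCSeries k) : Prop :=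
  ∀ N : ℕ,
    let x := varX k N
    let y := varY k N
    let φ := Φ.eval N x y
    f.eval N (φ * x * Ring.inverse φ) y * φ = Φ.eval N (c • x) (c • y)

end Main

/-! ### Calculus in algebras with a nilpotent ideal -/

section NilpotentCalculus

variable {k : Type*} [Field k] {Q : Type*} [Ring Q] [Algebra k Q]
  {R : Type*} [Ring R] [Algebra k R]

/-! Identities between series are tested in the quotients `A / J ^ (N + 1)` by powers of an
augmentation ideal. The image of `J ^ N` there is the top degree: it is annihilated by the image of
`J`, so it is central, and the endomorphism multiplying the generators by `c` acts on it as `c ^ N`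
(`ScalesBy.exists_trunc`). As `c` is not a root of unity, a top-degree `e` with `c ^ N • e = e` and
`N > 0` vanishes. The proof applies this observation to successive error terms.

The equation for `Φ`. Adding to `Φ` a term `E` of degree `N` changes the left side by `E` up to
higher degrees, since conjugates of `x` do not notice `E` and `f` has constant term `1`; it changes
the right side by `c ^ N • E`. As `c ^ N - 1` is invertible, the equation has exactly one solution
with constant term `1`, found degree by degree (`FixedAt.exists_succ`, `FixedUpToRescaling.unique`).
It remains to see that this solution is an associator.

The axioms. Let an axiom hold for `Φ` below the top degree, with error `e` there. Rescaling the
variables turns the error into `c ^ N • e`. But the equation replaces each rescaled value of `Φ` by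
a value of `f` times a value of `Φ`, and the matching axiom of `f` removes the values of `f`,
leaving `e` again; so `e = 0`. Group-likeness and antisymmetry follow directly.

The hexagon. The pentagon and antisymmetry force `f`, and then `Φ`, to have no linear terms. Let
`e`, `e'` be the errors of the hexagon at `(x, y)` and `(y, x)`. Together the two hexagons compute
the Campbell-Hausdorff series of `Φ x Φ⁻¹` and `y` up to the central term `e + e'`, and the factor
`e^{mz}` in the hexagon of `f` turns this term into a correction: `c ^ n • e = e + ((c - 1) / 2) •
(e + e')`, and likewise for `e'` (`hexagonValue_smul`). Adding gives `c ^ n • (e + e') = c • (e +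
e')`, so `e + e' = 0` for `n ≥ 2`, and then `e = 0`.

The pentagon. The group-like, antisymmetric `Φ` satisfying the hexagon should define a
representation of the pure braid group by Drinfeld's formulas, but those need the pentagon. They use
it only through conjugation, so a pentagon with a central error is enough
(`BraidCalculus.lift_X_eq_one`). Transporting the pentagon of `f` along this representation yields
one element `F` that carries both sides of the pentagon of `Φ` to their rescalings
(`exists_mul_eq_rescaled_pentagon`). Hence `c ^ n • e = e * F = e`, as `F` is `1` modulo the ideal.
-/

lemma Ideal.list_prod_mem_pow (I : Ideal Q) [I.IsTwoSided] :
    ∀ l : List Q, (∀ a ∈ l, a ∈ I) → l.prod ∈ I ^ l.length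
  | [], _ => by simp [Submodule.pow_zero, Ideal.one_eq_top]
  | a :: l, h => by
    rw [List.prod_cons, List.length_cons, Ideal.IsTwoSided.pow_succ]
    exact Ideal.mul_mem_mul (h a (by simp)) (Ideal.list_prod_mem_pow I l fun b hb => h b (by simp [hb]))

lemma Ideal.prod_ofFn_mem_pow {I : Ideal Q} [I.IsTwoSided] {a b : Q} (ha : a ∈ I) (hb : b ∈ I) {n : ℕ}
    (w : Fin n → Fin 2) :
    (List.ofFn fun i => (![a, b] : Fin 2 → Q) (w i)).prod ∈ I ^ n := by
  have h := Ideal.list_prod_mem_pow I (List.ofFn fun i => (![a, b] : Fin 2 → Q) (w i)) (by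
    intro c hc
    obtain ⟨i, rfl⟩ := (List.mem_ofFn' _ _).1 hc
    obtain h | h : w i = 0 ∨ w i = 1 := by omega
    all_goals simp [h, ha, hb])
  simpa using h

lemma Ideal.smul_mem_of_algebra (I : Ideal Q) (c : k) {a : Q} (ha : a ∈ I) : c • a ∈ I := by
  rw [Algebra.smul_def]; exact I.mul_mem_left _ ha

namespace NCSeries

lemma eval_map (g : Q →ₐ[k] R) (N : ℕ) (f : NCSeries k) (a b : Q) :
    g (f.eval N a b) = f.eval N (g a) (g b) := by
  simp only [eval, map_sum, map_smul, map_list_prod, List.map_ofFn]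
  refine Finset.sum_congr rfl fun n _ => Finset.sum_congr rfl fun w _ => ?_
  congr 3
  funext i
  obtain h | h : w i = 0 ∨ w i = 1 := by omega
  all_goals simp [h]

lemma prod_ofFn_semiconj {u a b a' b' : Q} (ha : SemiconjBy u a a') (hb : SemiconjBy u b b') :
    ∀ {n : ℕ} (w : Fin n → Fin 2), SemiconjBy u
      (List.ofFn fun i => (![a, b] : Fin 2 → Q) (w i)).prod
      (List.ofFn fun i => (![a', b'] : Fin 2 → Q) (w i)).prod
  | 0, _ => by simp
  | n + 1, w => by
    rw [List.ofFn_succ, List.ofFn_succ, List.prod_cons, List.prod_cons]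
    refine SemiconjBy.mul_right ?_ (prod_ofFn_semiconj ha hb fun i => w i.succ)
    obtain h | h : w 0 = 0 ∨ w 0 = 1 := by omega
    all_goals simpa [h]

/-- Conjugation passes through each monomial; this moves units past values of `f` and `Φ`
throughout. -/
lemma eval_semiconj (N : ℕ) (f : NCSeries k) {u a b a' b' : Q} (ha : SemiconjBy u a a')
    (hb : SemiconjBy u b b') : SemiconjBy u (f.eval N a b) (f.eval N a' b') := by
  unfold eval SemiconjBy
  simp only [Finset.mul_sum, Finset.sum_mul]
  refine Finset.sum_congr rfl fun n _ => Finset.sum_congr rfl fun w _ => ?_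
  rw [mul_smul_comm, smul_mul_assoc, (prod_ofFn_semiconj ha hb w).eq]

lemma commute_eval (N : ℕ) (f : NCSeries k) {u a b : Q} (ha : Commute u a) (hb : Commute u b) :
    Commute u (f.eval N a b) :=
  eval_semiconj N f ha hb

lemma eval_succ (N : ℕ) (f : NCSeries k) (a b : Q) :
    f.eval (N + 1) a b = f.eval N a b + ∑ w : Fin N → Fin 2,
      f (List.ofFn w) • (List.ofFn fun i => (![a, b] : Fin 2 → Q) (w i)).prod :=
  Finset.sum_range_succ _ _

lemma eval_one (f : NCSeries k) (a b : Q) : f.eval 1 a b = f [] • 1 := by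
  simp [eval]

lemma eval_two (f : NCSeries k) (a b : Q) :
    f.eval 2 a b = f [] • 1 + f [0] • a + f [1] • b := by
  rw [eval_succ, eval_one, add_assoc]
  congr 1
  rw [← (Equiv.funUnique (Fin 1) (Fin 2)).symm.sum_comp]
  simp

variable {I : Ideal Q} [I.IsTwoSided] {N M : ℕ}

/-- Words of length at least `N` vanish on `I`, so the cut-off is immaterial beyond `N`. -/
lemma eval_eq_of_le (hI : I ^ N = ⊥) (h : N ≤ M) (f : NCSeries k) {a b : Q} (ha : a ∈ I)
    (hb : b ∈ I) : f.eval M a b = f.eval N a b := by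
  induction M, h using Nat.le_induction with
  | base => rfl
  | succ M h ih =>
    rw [eval_succ, ih, Finset.sum_eq_zero, add_zero]
    intro w _
    have := Ideal.pow_le_pow_right h (Ideal.prod_ofFn_mem_pow ha hb w)
    rw [hI, Ideal.mem_bot] at this
    rw [this, smul_zero]

lemma eval_sub_mem (f : NCSeries k) {a b : Q} (ha : a ∈ I) (hb : b ∈ I) :
    f.eval (N + 1) a b - f [] • 1 ∈ I := by
  induction N with
  | zero => simp [eval_one]
  | succ N ih =>
    rw [eval_succ, add_sub_right_comm]
    refine I.add_mem ih (I.sum_mem fun w _ => I.smul_mem_of_algebra _ ?_)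
    exact Ideal.pow_le_self (Nat.succ_ne_zero N) (Ideal.prod_ofFn_mem_pow ha hb w)

end NCSeries

lemma IsUnit.of_sub_one_mem {I : Ideal Q} {N : ℕ} (hI : I ^ N = ⊥) {q : Q} (hq : q - 1 ∈ I) :
    IsUnit q := by
  have : (q - 1) ^ N = 0 := by
    have := Ideal.pow_mem_pow hq N
    rwa [hI, Ideal.mem_bot] at this
  have h := IsNilpotent.isUnit_add_one ⟨N, this⟩
  rwa [sub_add_cancel] at h

lemma Ideal.pow_eq_zero_of_pow_eq_bot {I : Ideal Q} {N : ℕ} (hI : I ^ N = ⊥) {a : Q}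
    (ha : a ∈ I) : a ^ N = 0 := by
  have := Ideal.pow_mem_pow ha N
  rwa [hI, Ideal.mem_bot] at this

section Exp

variable (k)

lemma nilExp_map (g : Q →ₐ[k] R) (N : ℕ) (a : Q) : g (nilExp k N a) = nilExp k N (g a) := by
  simp [nilExp]

lemma nilLog_map (g : Q →ₐ[k] R) (N : ℕ) (a : Q) : g (nilLog k N a) = nilLog k N (g a) := by
  simp [nilLog]

lemma nilCH_map (g : Q →ₐ[k] R) (N : ℕ) (a b : Q) :
    g (nilCH k N a b) = nilCH k N (g a) (g b) := by
  simp [nilCH, nilLog_map, nilExp_map]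

lemma nilExp_semiconj (N : ℕ) {u a b : Q} (h : SemiconjBy u a b) :
    SemiconjBy u (nilExp k N a) (nilExp k N b) := by
  unfold nilExp SemiconjBy
  simp only [Finset.mul_sum, Finset.sum_mul]
  refine Finset.sum_congr rfl fun n _ => ?_
  rw [mul_smul_comm, smul_mul_assoc, (h.pow_right n).eq]

lemma commute_nilExp (N : ℕ) {u a : Q} (h : Commute u a) : Commute u (nilExp k N a) :=
  nilExp_semiconj k N h

lemma nilExp_succ (N : ℕ) (a : Q) :
    nilExp k (N + 1) a = nilExp k N a + ((N.factorial : k)⁻¹) • a ^ N :=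
  Finset.sum_range_succ _ _

lemma nilExp_zero_right (N : ℕ) : nilExp k (N + 1) (0 : Q) = 1 := by
  rw [nilExp, Finset.sum_eq_single 0] <;> simp +contextual

variable {I : Ideal Q} {N M : ℕ}

lemma nilExp_sub_one_mem {a : Q} (ha : a ∈ I) : nilExp k (N + 1) a - 1 ∈ I := by
  induction N with
  | zero => simp [nilExp]
  | succ N ih =>
    rw [nilExp_succ, add_sub_right_comm]
    exact I.add_mem ih (I.smul_mem_of_algebra _
      (Ideal.pow_le_self (Nat.succ_ne_zero N) (Ideal.pow_mem_pow ha _)))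

lemma nilExp_eq_of_le {a : Q} (ha : a ^ N = 0) (h : N ≤ M) : nilExp k M a = nilExp k N a := by
  induction M, h using Nat.le_induction with
  | base => rfl
  | succ M h ih => rw [nilExp_succ, ih, pow_eq_zero_of_le h ha, smul_zero, add_zero]

lemma nilExp_add [CharZero k] {a b : Q} (h : Commute a b) (hI : I ^ N = ⊥) (ha : a ∈ I)
    (hb : b ∈ I) : nilExp k N (a + b) = nilExp k N a * nilExp k N b := by
  -- Characteristic zero makes `Q` a rational vector space, where the truncated exponential is the
  -- usual exponential of a nilpotent element.
  let _ : Module ℚ Q := Module.compHom Q (algebraMap ℚ k)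
  have key : ∀ c ∈ I, nilExp k N c = IsNilpotent.exp c := by
    intro c hc
    rw [IsNilpotent.exp_eq_sum (Ideal.pow_eq_zero_of_pow_eq_bot hI hc), nilExp]
    refine Finset.sum_congr rfl fun n _ => ?_
    change _ = algebraMap ℚ k ((n.factorial : ℚ)⁻¹) • c ^ n
    simp
  rw [key _ ha, key _ hb, key _ (I.add_mem ha hb)]
  exact IsNilpotent.exp_add_of_commute h ⟨N, Ideal.pow_eq_zero_of_pow_eq_bot hI ha⟩
    ⟨N, Ideal.pow_eq_zero_of_pow_eq_bot hI hb⟩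

open Polynomial in
lemma X_pow_succ_dvd_of_derivative [CharZero k] {p : k[X]} {n : ℕ} (h0 : p.coeff 0 = 0)
    (h : X ^ n ∣ derivative p) : X ^ (n + 1) ∣ p := by
  rw [X_pow_dvd_iff] at h ⊢
  rintro (_ | d) hd
  · exact h0
  · have := h d (by omega)
    rw [coeff_derivative] at this
    exact (mul_eq_zero.1 this).resolve_right (by exact_mod_cast Nat.succ_ne_zero d)

-- With `E` the truncated exponential, the derivative of the truncated logarithm of `E` is a
-- geometric sum in `1 - E` times `E'`. Since `E' = E - X ^ N / N!`, it equals `1` up to multiples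
-- of `(1 - E) ^ N` and `X ^ N`, both divisible by `X ^ N`.
open Polynomial in
lemma X_pow_dvd_nilLog_nilExp_sub_X [CharZero k] (N : ℕ) :
    (X : k[X]) ^ (N + 1) ∣ nilLog k (N + 1) (nilExp k (N + 1) X) - X := by
  set E : k[X] := nilExp k (N + 1) X with hE
  have hE0 : E.coeff 0 = 1 := by
    rw [hE, nilExp, finsetSum_coeff, Finset.sum_eq_single 0] <;>
      simp +contextual [coeff_X_pow, eq_comm]
  have hXE : (X : k[X]) ∣ 1 - E := by
    rw [X_dvd_iff]; simp [hE0]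
  have hdE : derivative E = E - C ((N.factorial : k)⁻¹) * X ^ N := by
    rw [hE, nilExp_succ, smul_eq_C_mul, add_sub_cancel_right, ← smul_eq_C_mul, ← nilExp_succ,
      nilExp, Finset.sum_range_succ', nilExp]
    simp only [derivative_add, derivative_sum, derivative_smul, derivative_X_pow, pow_zero,
      derivative_one, smul_zero, add_zero]
    refine Finset.sum_congr rfl fun n _ => ?_
    rw [smul_eq_C_mul, smul_eq_C_mul, ← mul_assoc, ← C_mul, Nat.factorial_succ]
    congr 2
    have h1 : (n : k) + 1 ≠ 0 := by exact_mod_cast Nat.succ_ne_zero n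
    have h2 : (n.factorial : k) ≠ 0 := by exact_mod_cast n.factorial_ne_zero
    push_cast
    rw [mul_inv, mul_right_comm, inv_mul_cancel₀ h1, one_mul]
  refine X_pow_succ_dvd_of_derivative k ?_ ?_
  · rw [coeff_sub, coeff_X_zero, sub_zero, nilLog, finsetSum_coeff]
    refine Finset.sum_eq_zero fun n hn => ?_
    have hn' : n ≠ 0 := by have := Finset.mem_Ico.1 hn; omega
    rw [coeff_smul, coeff_zero_eq_eval_zero, eval_pow, ← coeff_zero_eq_eval_zero]
    simp [hE0, hn']
  · have hG : derivative (nilLog k (N + 1) E - X) =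
        (∑ j ∈ Finset.range N, (1 - E) ^ j) * derivative E - 1 := by
      rw [derivative_sub, derivative_X, nilLog, Finset.sum_Ico_eq_sum_range, derivative_sum,
        Finset.sum_mul]
      simp only [add_tsub_cancel_right]
      congr 1
      refine Finset.sum_congr rfl fun j _ => ?_
      have h1 : ((1 + j : ℕ) : k) ≠ 0 := by
        exact_mod_cast (by omega : 1 + j ≠ 0)
      rw [derivative_smul, derivative_pow, add_tsub_cancel_left, derivative_sub, derivative_one,
        sub_zero, smul_eq_C_mul, ← mul_assoc, ← mul_assoc, ← C_mul, mul_assoc _ _ ((1 + j : ℕ) : k),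
        inv_mul_cancel₀ h1, mul_one, show 1 + j + 1 = j + 2 by ring, pow_add, neg_one_sq, mul_one,
        ← neg_sub E 1, neg_pow (E - 1) j]
      simp
    have hgeom := geom_sum_mul (1 - E) N
    have : (∑ j ∈ Finset.range N, (1 - E) ^ j) * derivative E - 1 =
        -(1 - E) ^ N - (∑ j ∈ Finset.range N, (1 - E) ^ j) * (C ((N.factorial : k)⁻¹) * X ^ N) := by
      rw [hdE]
      linear_combination -hgeom
    rw [hG, this]
    exact dvd_sub (dvd_neg.2 (pow_dvd_pow_of_dvd hXE N))
      (dvd_mul_of_dvd_right (dvd_mul_left _ _) _)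

/-- The polynomial congruence in `k[X]` is evaluated at `a`. -/
lemma nilLog_nilExp [CharZero k] {a : Q} (ha : a ^ (N + 1) = 0) :
    nilLog k (N + 1) (nilExp k (N + 1) a) = a := by
  obtain ⟨p, hp⟩ := X_pow_dvd_nilLog_nilExp_sub_X k N
  have := congrArg (Polynomial.aeval a) hp
  rw [map_sub, nilLog_map, nilExp_map, Polynomial.aeval_X, map_mul, map_pow, Polynomial.aeval_X, ha,
    zero_mul] at this
  exact sub_eq_zero.1 this

end Exp

end NilpotentCalculus

/-! ### Truncations of augmented algebras -/

section Truncations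

lemma Ideal.exists_of_mem_map_pow {A B : Type*} [Ring A] [Ring B] (f : A →+* B)
    (hf : Function.Surjective f) (J : Ideal A) [J.IsTwoSided] (n : ℕ) {e : B}
    (he : e ∈ (J.map f) ^ n) : ∃ a ∈ J ^ n, f a = e := by
  induction n generalizing e with
  | zero =>
    obtain ⟨a, rfl⟩ := hf e
    exact ⟨a, by simp [Submodule.pow_zero, Ideal.one_eq_top], rfl⟩
  | succ n ih =>
    rw [Submodule.pow_succ] at he
    refine Submodule.mul_induction_on he ?_ ?_
    · intro x hx y hy
      obtain ⟨a, ha, rfl⟩ := ih hx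
      obtain ⟨b, hb, rfl⟩ := (Ideal.mem_map_iff_of_surjective f hf).1 hy
      exact ⟨a * b, by rw [Submodule.pow_succ]; exact Ideal.mul_mem_mul ha hb, map_mul _ _ _⟩
    · rintro x y ⟨a, ha, rfl⟩ ⟨b, hb, rfl⟩
      exact ⟨a + b, Ideal.add_mem _ ha hb, map_add _ _ _⟩

instance Ideal.isTwoSided_map_mk {A : Type*} [Ring A] (J K : Ideal A) [J.IsTwoSided]
    [K.IsTwoSided] : (J.map (Ideal.Quotient.mk K)).IsTwoSided :=
  ⟨fun b ha => by
    obtain ⟨a, ha', rfl⟩ :=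
      (Ideal.mem_map_iff_of_surjective _ Ideal.Quotient.mk_surjective).1 ha
    obtain ⟨b, rfl⟩ := Ideal.Quotient.mk_surjective b
    rw [← map_mul]
    exact Ideal.mem_map_of_mem _ (J.mul_mem_right _ ha')⟩

lemma Ideal.map_mk_pow_eq_bot {A : Type*} [Ring A] {J K : Ideal A} [J.IsTwoSided]
    [K.IsTwoSided] {N : ℕ} (h : J ^ N ≤ K) : (J.map (Ideal.Quotient.mk K)) ^ N = ⊥ := by
  rw [eq_bot_iff]
  intro e he
  obtain ⟨a, ha, rfl⟩ :=
    Ideal.exists_of_mem_map_pow _ Ideal.Quotient.mk_surjective J N he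
  exact (Ideal.mem_bot).2 (Ideal.Quotient.eq_zero_iff_mem.2 (h ha))

lemma Ideal.mul_eq_zero_of_mem_pow {Q : Type*} [Ring Q] {I : Ideal Q} {N : ℕ}
    (hI : I ^ (N + 1) = ⊥) {e i : Q} (he : e ∈ I ^ N) (hi : i ∈ I) : e * i = 0 := by
  have : e * i ∈ I ^ (N + 1) := Ideal.mul_mem_mul he hi
  rwa [hI, Ideal.mem_bot] at this

lemma Ideal.mul_eq_zero_of_mem_pow' {Q : Type*} [Ring Q] {I : Ideal Q} [I.IsTwoSided] {N : ℕ}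
    (hI : I ^ (N + 1) = ⊥) {e i : Q} (he : e ∈ I ^ N) (hi : i ∈ I) : i * e = 0 := by
  have : i * e ∈ I ^ (N + 1) := by
    rw [Ideal.IsTwoSided.pow_succ]; exact Ideal.mul_mem_mul hi he
  rwa [hI, Ideal.mem_bot] at this

variable {k : Type*} [Field k] {A : Type*} [Ring A] [Algebra k A] (ε : A →ₐ[k] k)
  {Q : Type*} [Ring Q] [Algebra k Q]

/-- The quotient map `A → A / J ^ N` as a homomorphism of algebras. -/
def truncHom (N : ℕ) : A →ₐ[k] AugTrunc ε N :=
  Ideal.Quotient.mkₐ k _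

lemma truncHom_apply (N : ℕ) (a : A) : truncHom ε N a = toTrunc ε N a := rfl

lemma toTrunc_surjective (N : ℕ) : Function.Surjective (toTrunc ε N) :=
  Ideal.Quotient.mk_surjective

/-- The image `J / J ^ N` of the augmentation ideal. -/
def truncIdeal (N : ℕ) : Ideal (AugTrunc ε N) :=
  (RingHom.ker ε).map (Ideal.Quotient.mk _)

instance (N : ℕ) : (truncIdeal ε N).IsTwoSided :=
  Ideal.isTwoSided_map_mk _ _

lemma truncIdeal_pow (N : ℕ) : truncIdeal ε N ^ N = ⊥ :=
  Ideal.map_mk_pow_eq_bot le_rfl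

variable {ε}

lemma toTrunc_mem {N : ℕ} {a : A} (ha : ε a = 0) : toTrunc ε N a ∈ truncIdeal ε N :=
  Ideal.mem_map_of_mem _ ((RingHom.mem_ker).2 ha)

lemma exists_of_mem_truncIdeal_pow {N n : ℕ} {e : AugTrunc ε N} (he : e ∈ truncIdeal ε N ^ n) :
    ∃ a ∈ RingHom.ker ε ^ n, toTrunc ε N a = e :=
  Ideal.exists_of_mem_map_pow _ Ideal.Quotient.mk_surjective _ n he

lemma toTrunc_eq_zero {N : ℕ} {a : A} (ha : a ∈ RingHom.ker ε ^ N) : toTrunc ε N a = 0 :=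
  Ideal.Quotient.eq_zero_iff_mem.2 ha

lemma sub_algebraMap_mem_ker (a : A) : a - algebraMap k A (ε a) ∈ RingHom.ker ε := by
  rw [RingHom.mem_ker, map_sub, AlgHom.commutes]; exact sub_self _

lemma exists_sub_mem_truncIdeal {N : ℕ} (q : AugTrunc ε N) :
    ∃ c : k, q - algebraMap k _ c ∈ truncIdeal ε N := by
  obtain ⟨a, rfl⟩ := toTrunc_surjective ε N q
  refine ⟨ε a, ?_⟩
  have := toTrunc_mem (N := N) ((RingHom.mem_ker).1 (sub_algebraMap_mem_ker (ε := ε) a))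
  rwa [← truncHom_apply, map_sub, AlgHom.commutes] at this

lemma map_mem_pow_of_sub_mem {I : Ideal Q} [I.IsTwoSided] {g : A →ₐ[k] Q}
    (hg : ∀ a, g a - algebraMap k Q (ε a) ∈ I) (n : ℕ) {a : A} (ha : a ∈ RingHom.ker ε ^ n) :
    g a ∈ I ^ n := by
  induction n generalizing a with
  | zero => simp [Submodule.pow_zero, Ideal.one_eq_top]
  | succ n ih =>
    rw [Submodule.pow_succ] at ha ⊢
    refine Submodule.mul_induction_on ha ?_ ?_
    · intro x hx y hy
      rw [map_mul]
      refine Ideal.mul_mem_mul (ih hx) ?_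
      simpa [(RingHom.mem_ker).1 hy] using hg y
    · intro x y hx hy
      rw [map_add]; exact Ideal.add_mem _ hx hy

lemma exists_trunc_lift {I : Ideal Q} [I.IsTwoSided] {N : ℕ} (hI : I ^ N = ⊥) (g : A →ₐ[k] Q)
    (hg : ∀ a, g a - algebraMap k Q (ε a) ∈ I) :
    ∃ G : AugTrunc ε N →ₐ[k] Q, ∀ a, G (toTrunc ε N a) = g a :=
  ⟨Ideal.Quotient.liftₐ _ g fun a ha => by
    have := map_mem_pow_of_sub_mem hg N ha
    rwa [hI, Ideal.mem_bot] at this, fun a => rfl⟩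

lemma sub_mem_of_comp_mk_eq {I : Ideal Q} [I.IsTwoSided] (g : A →ₐ[k] Q)
    (h : (Ideal.Quotient.mkₐ k I).comp g = (Algebra.ofId k (Q ⧸ I)).comp ε) (a : A) :
    g a - algebraMap k Q (ε a) ∈ I := by
  have := AlgHom.congr_fun h a
  rw [AlgHom.comp_apply, AlgHom.comp_apply, Algebra.ofId_apply,
    ← AlgHom.commutes (Ideal.Quotient.mkₐ k I)] at this
  exact Ideal.Quotient.eq.1 this

/-- The endomorphism `S` of `A` multiplies `J / J ^ 2` by `c`. -/
def ScalesBy (ε : A →ₐ[k] k) (c : k) (S : A →ₐ[k] A) : Prop :=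
  ∀ a, S a - (c • a + ((1 - c) * ε a) • (1 : A)) ∈ RingHom.ker ε ^ 2

/-- Writing elements as constant plus augmentation part, only terms linear in the augmentation parts
survive in a product modulo `J ^ 2`, so the condition passes to products and can be checked on
generators. -/
lemma ScalesBy.of_adjoin {c : k} {S : A →ₐ[k] A} {s : Set A} (hs : Algebra.adjoin k s = ⊤)
    (hε : ∀ a ∈ s, ε a = 0) (hS : ∀ a ∈ s, S a = c • a) : ScalesBy ε c S := by
  intro a
  have ha : a ∈ Algebra.adjoin k s := hs ▸ Algebra.mem_top
  induction ha using Algebra.adjoin_induction with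
  | mem x hx => simp [hε x hx, hS x hx]
  | algebraMap r =>
    have : S (algebraMap k A r) - (c • algebraMap k A r +
        ((1 - c) * ε (algebraMap k A r)) • (1 : A)) = 0 := by
      rw [AlgHom.commutes, AlgHom.commutes, Algebra.algebraMap_self, RingHom.id_apply,
        Algebra.algebraMap_eq_smul_one, smul_smul, ← add_smul, ← sub_smul]
      convert zero_smul k (1 : A)
      ring
    rw [this]; exact Ideal.zero_mem _
  | add x y _ _ hx hy =>
    convert Ideal.add_mem _ hx hy using 1
    simp only [map_add, smul_add, mul_add, add_smul]; abel
  | mul x y _ _ hx hy =>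
    obtain ⟨x', hx', hxx⟩ : ∃ x' ∈ RingHom.ker ε, x = ε x • 1 + x' :=
      ⟨_, sub_algebraMap_mem_ker x, by rw [Algebra.algebraMap_eq_smul_one]; abel⟩
    obtain ⟨y', hy', hyy⟩ : ∃ y' ∈ RingHom.ker ε, y = ε y • 1 + y' :=
      ⟨_, sub_algebraMap_mem_ker y, by rw [Algebra.algebraMap_eq_smul_one]; abel⟩
    obtain ⟨u, hu, hxu⟩ : ∃ u ∈ RingHom.ker ε ^ 2, S x = ε x • 1 + c • x' + u := by
      refine ⟨_, hx, ?_⟩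
      nth_rewrite 4 [hxx]
      simp only [smul_add, smul_smul, sub_mul, sub_smul, one_mul]; abel
    obtain ⟨v, hv, hyv⟩ : ∃ v ∈ RingHom.ker ε ^ 2, S y = ε y • 1 + c • y' + v := by
      refine ⟨_, hy, ?_⟩
      nth_rewrite 4 [hyy]
      simp only [smul_add, smul_smul, sub_mul, sub_smul, one_mul]; abel
    have hxy : x' * y' ∈ RingHom.ker ε ^ 2 := by
      rw [Submodule.pow_succ, Submodule.pow_one]; exact Ideal.mul_mem_mul hx' hy'
    have : S (x * y) - (c • (x * y) + ((1 - c) * ε (x * y)) • (1 : A)) =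
        (c * c - c) • (x' * y') + S x * v + u * (ε y • 1 + c • y') := by
      have hp : x * y = (ε x * ε y) • 1 + ε x • y' + ε y • x' + x' * y' := by
        have : x * y = (ε x • 1 + x') * (ε y • 1 + y') := by rw [← hxx, ← hyy]
        rw [this]
        simp only [mul_add, add_mul, mul_one, smul_mul_assoc, one_mul, mul_smul_comm]
        module
      rw [map_mul, map_mul, hyv, mul_add (S x), hxu, hp]
      simp only [mul_add, add_mul, mul_one, one_mul, smul_add, smul_mul_assoc, mul_smul_comm]
      module
    rw [this]
    exact Ideal.add_mem _ (Ideal.add_mem _ (Ideal.smul_mem_of_algebra _ _ hxy)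
      (Ideal.mul_mem_left _ _ hv)) (Ideal.mul_mem_right _ _ hu)

/-- `J ^ n` is generated additively by `n`-fold products of elements of `J`, and each factor is
multiplied by `c` modulo `J ^ 2`. -/
lemma ScalesBy.sub_mem {c : k} {S : A →ₐ[k] A} (hS : ScalesBy ε c S) (n : ℕ) {a : A}
    (ha : a ∈ RingHom.ker ε ^ n) : S a - c ^ n • a ∈ RingHom.ker ε ^ (n + 1) := by
  have h1 : ∀ a ∈ RingHom.ker ε, S a - c • a ∈ RingHom.ker ε ^ 2 := by
    intro a ha
    simpa [(RingHom.mem_ker).1 ha] using hS a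
  induction n generalizing a with
  | zero =>
    have h0 := Ideal.pow_le_self two_ne_zero (hS a)
    have h2 := Ideal.smul_mem_of_algebra _ (c - 1) (sub_algebraMap_mem_ker (ε := ε) a)
    rw [Submodule.pow_one]
    convert Ideal.add_mem _ h0 h2 using 1
    rw [Algebra.algebraMap_eq_smul_one]
    simp only [smul_sub, sub_smul, smul_smul, pow_zero, one_smul, sub_mul, one_mul]
    abel
  | succ n ih =>
    rw [Submodule.pow_succ] at ha
    refine Submodule.mul_induction_on ha ?_ ?_
    · intro x hx y hy
      have e : S (x * y) - c ^ (n + 1) • (x * y) =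
          (S x - c ^ n • x) * S y + (c ^ n • x) * (S y - c • y) := by
        rw [map_mul, sub_mul, mul_sub, smul_mul_smul_comm, pow_succ]; abel
      have hSy : S y ∈ RingHom.ker ε := by
        have := Ideal.add_mem _ (Ideal.pow_le_self two_ne_zero (h1 y hy))
          (Ideal.smul_mem_of_algebra _ c hy)
        rwa [sub_add_cancel] at this
      rw [e]
      refine Ideal.add_mem _ ?_ ?_
      · rw [Submodule.pow_succ]
        exact Ideal.mul_mem_mul (ih hx) hSy
      · rw [show n + 1 + 1 = n + 2 by ring, Ideal.IsTwoSided.pow_add]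
        exact Ideal.mul_mem_mul (Ideal.smul_mem_of_algebra _ _ hx) (h1 y hy)
    · intro x y hx hy
      convert Ideal.add_mem _ hx hy using 1
      simp only [map_add, smul_add]; abel

/-- The eigenvalue statement behind every induction on degree: in the quotient by `J ^ (N + 1)` the
error terms lie in the `N`-th power, where rescaling is the scalar `c ^ N`. -/
lemma ScalesBy.exists_trunc {c : k} {S : A →ₐ[k] A} (hS : ScalesBy ε c S) (N : ℕ) :
    ∃ G : AugTrunc ε (N + 1) →ₐ[k] AugTrunc ε (N + 1),
      (∀ a, G (toTrunc ε _ a) = toTrunc ε _ (S a)) ∧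
      ∀ e ∈ truncIdeal ε (N + 1) ^ N, G e = c ^ N • e := by
  obtain ⟨G, hG⟩ := exists_trunc_lift (truncIdeal_pow ε (N + 1))
    ((truncHom ε (N + 1)).comp S) (ε := ε) (by
      intro a
      have h := hS.sub_mem 0 (a := a) (by simp [Submodule.pow_zero, Ideal.one_eq_top])
      rw [Submodule.pow_one, pow_zero, one_smul] at h
      have := toTrunc_mem (N := N + 1) ((RingHom.mem_ker).1
        (Ideal.add_mem _ h (sub_algebraMap_mem_ker (ε := ε) a)))
      rwa [sub_add_sub_cancel, ← truncHom_apply, map_sub, AlgHom.commutes] at this)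
  refine ⟨G, hG, fun e he => ?_⟩
  obtain ⟨a, ha, rfl⟩ := exists_of_mem_truncIdeal_pow he
  rw [hG, AlgHom.comp_apply, truncHom_apply]
  have := toTrunc_eq_zero (hS.sub_mem N ha)
  rw [← truncHom_apply, map_sub, map_smul, sub_eq_zero] at this
  exact this

end Truncations

/-! ### Universal properties of the truncated algebras -/

section UniversalProperties

variable {k : Type*} [Field k] {Q : Type*} [Ring Q] [Algebra k Q]

lemma freeAug_scalesBy (c : k) :
    ScalesBy (freeAug k) c (FreeAlgebra.lift k fun i => c • FreeAlgebra.ι k i) := by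
  refine ScalesBy.of_adjoin (FreeAlgebra.adjoin_range_ι k (Fin 2)) ?_ ?_
  · rintro _ ⟨i, rfl⟩; simp [freeAug]
  · rintro _ ⟨i, rfl⟩; simp

lemma varX_mem (N : ℕ) : varX k N ∈ truncIdeal (freeAug k) N :=
  toTrunc_mem (by simp [freeAug])

lemma varY_mem (N : ℕ) : varY k N ∈ truncIdeal (freeAug k) N :=
  toTrunc_mem (by simp [freeAug])

lemma exists_free_scale (c : k) (N : ℕ) :
    ∃ G : AugTrunc (freeAug k) (N + 1) →ₐ[k] AugTrunc (freeAug k) (N + 1),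
      G (varX k (N + 1)) = c • varX k (N + 1) ∧ G (varY k (N + 1)) = c • varY k (N + 1) ∧
      ∀ e ∈ truncIdeal (freeAug k) (N + 1) ^ N, G e = c ^ N • e := by
  obtain ⟨G, hG, hG'⟩ := (freeAug_scalesBy c).exists_trunc N
  refine ⟨G, ?_, ?_, hG'⟩
  · rw [varX, hG, FreeAlgebra.lift_ι_apply, ← truncHom_apply, map_smul]; rfl
  · rw [varY, hG, FreeAlgebra.lift_ι_apply, ← truncHom_apply, map_smul]; rfl

lemma exists_free_lift {I : Ideal Q} [I.IsTwoSided] {N : ℕ} (hI : I ^ N = ⊥) {a b : Q}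
    (ha : a ∈ I) (hb : b ∈ I) :
    ∃ G : AugTrunc (freeAug k) N →ₐ[k] Q, G (varX k N) = a ∧ G (varY k N) = b := by
  obtain ⟨G, hG⟩ := exists_trunc_lift (ε := freeAug k) hI (FreeAlgebra.lift k ![a, b])
    (sub_mem_of_comp_mk_eq _ (by
      ext i
      obtain rfl | rfl : i = 0 ∨ i = 1 := by omega
      · simpa [freeAug, Ideal.Quotient.eq_zero_iff_mem] using ha
      · simpa [freeAug, Ideal.Quotient.eq_zero_iff_mem] using hb))
  exact ⟨G, by simp [varX, hG], by simp [varY, hG]⟩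

lemma tensor_adjoin :
    Algebra.adjoin k ({x : FreeAlgebra k (Fin 2) ⊗[k] FreeAlgebra k (Fin 2) |
      ∃ i, x = FreeAlgebra.ι k i ⊗ₜ 1 ∨ x = 1 ⊗ₜ FreeAlgebra.ι k i}) = ⊤ := by
  set s := {x : FreeAlgebra k (Fin 2) ⊗[k] FreeAlgebra k (Fin 2) |
      ∃ i, x = FreeAlgebra.ι k i ⊗ₜ 1 ∨ x = 1 ⊗ₜ FreeAlgebra.ι k i}
  have hl : ∀ a : FreeAlgebra k (Fin 2), (a ⊗ₜ[k] (1 : FreeAlgebra k (Fin 2))) ∈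
      Algebra.adjoin k s := by
    intro a
    have ha : a ∈ Algebra.adjoin k (Set.range (FreeAlgebra.ι k)) := by
      rw [FreeAlgebra.adjoin_range_ι]; exact Algebra.mem_top
    have : Algebra.TensorProduct.includeLeft a ∈ (Algebra.adjoin k _).map
        (Algebra.TensorProduct.includeLeft :
          FreeAlgebra k (Fin 2) →ₐ[k] FreeAlgebra k (Fin 2) ⊗[k] FreeAlgebra k (Fin 2)) :=
      Subalgebra.mem_map.2 ⟨a, ha, rfl⟩
    rw [AlgHom.map_adjoin] at this
    refine Algebra.adjoin_mono ?_ this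
    rintro _ ⟨_, ⟨i, rfl⟩, rfl⟩
    exact ⟨i, Or.inl rfl⟩
  have hr : ∀ a : FreeAlgebra k (Fin 2), ((1 : FreeAlgebra k (Fin 2)) ⊗ₜ[k] a) ∈
      Algebra.adjoin k s := by
    intro a
    have ha : a ∈ Algebra.adjoin k (Set.range (FreeAlgebra.ι k)) := by
      rw [FreeAlgebra.adjoin_range_ι]; exact Algebra.mem_top
    have : Algebra.TensorProduct.includeRight a ∈ (Algebra.adjoin k _).map
        (Algebra.TensorProduct.includeRight :
          FreeAlgebra k (Fin 2) →ₐ[k] FreeAlgebra k (Fin 2) ⊗[k] FreeAlgebra k (Fin 2)) :=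
      Subalgebra.mem_map.2 ⟨a, ha, rfl⟩
    rw [AlgHom.map_adjoin] at this
    refine Algebra.adjoin_mono ?_ this
    rintro _ ⟨_, ⟨i, rfl⟩, rfl⟩
    exact ⟨i, Or.inr rfl⟩
  rw [eq_top_iff]
  rintro t -
  induction t using TensorProduct.induction_on with
  | zero => exact Subalgebra.zero_mem _
  | tmul a b =>
    have := Subalgebra.mul_mem _ (hl a) (hr b)
    rwa [Algebra.TensorProduct.tmul_mul_tmul, mul_one, one_mul] at this
  | add x y hx hy => exact Subalgebra.add_mem _ hx hy

lemma tensorAug_scalesBy (c : k) :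
    ScalesBy (tensorAug k) c (Algebra.TensorProduct.map
      (FreeAlgebra.lift k fun i => c • FreeAlgebra.ι k i)
      (FreeAlgebra.lift k fun i => c • FreeAlgebra.ι k i)) := by
  refine ScalesBy.of_adjoin tensor_adjoin ?_ ?_
  · rintro _ ⟨i, rfl | rfl⟩ <;> simp [tensorAug, freeAug]
  · rintro _ ⟨i, rfl | rfl⟩ <;> simp [TensorProduct.smul_tmul']

lemma exists_tensor_lift {I : Ideal Q} [I.IsTwoSided] {N : ℕ} (hI : I ^ N = ⊥)
    {a b a' b' : Q} (ha : a ∈ I) (hb : b ∈ I) (ha' : a' ∈ I) (hb' : b' ∈ I)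
    (haa : Commute a a') (hab : Commute a b') (hba : Commute b a') (hbb : Commute b b') :
    ∃ G : AugTrunc (tensorAug k) N →ₐ[k] Q,
      G (toTrunc _ N (FreeAlgebra.ι k 0 ⊗ₜ 1)) = a ∧
      G (toTrunc _ N (FreeAlgebra.ι k 1 ⊗ₜ 1)) = b ∧
      G (toTrunc _ N (1 ⊗ₜ FreeAlgebra.ι k 0)) = a' ∧
      G (toTrunc _ N (1 ⊗ₜ FreeAlgebra.ι k 1)) = b' := by
  have hcomm : ∀ u v : FreeAlgebra k (Fin 2), Commute (FreeAlgebra.lift k ![a, b] u)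
      (FreeAlgebra.lift k ![a', b'] v) := by
    intro u v
    induction u using FreeAlgebra.induction with
    | grade0 r => rw [AlgHom.commutes]; exact Algebra.commutes _ _
    | grade1 i =>
      induction v using FreeAlgebra.induction with
      | grade0 r => rw [AlgHom.commutes]; exact (Algebra.commutes _ _).symm
      | grade1 j =>
        obtain rfl | rfl : i = 0 ∨ i = 1 := by omega
        all_goals obtain rfl | rfl : j = 0 ∨ j = 1 := by omega
        all_goals simpa
      | mul x y hx hy => rw [map_mul]; exact hx.mul_right hy
      | add x y hx hy => rw [map_add]; exact hx.add_right hy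
    | mul x y hx hy => rw [map_mul]; exact hx.mul_left hy
    | add x y hx hy => rw [map_add]; exact hx.add_left hy
  obtain ⟨G, hG⟩ := exists_trunc_lift (ε := tensorAug k) hI
    (Algebra.TensorProduct.lift (FreeAlgebra.lift k ![a, b]) (FreeAlgebra.lift k ![a', b']) hcomm)
    (sub_mem_of_comp_mk_eq _ (by
      ext i
      · obtain rfl | rfl : i = 0 ∨ i = 1 := by omega
        · simpa [tensorAug, freeAug, Ideal.Quotient.eq_zero_iff_mem] using ha
        · simpa [tensorAug, freeAug, Ideal.Quotient.eq_zero_iff_mem] using hb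
      · obtain rfl | rfl : i = 0 ∨ i = 1 := by omega
        · simpa [tensorAug, freeAug, Ideal.Quotient.eq_zero_iff_mem] using ha'
        · simpa [tensorAug, freeAug, Ideal.Quotient.eq_zero_iff_mem] using hb'))
  exact ⟨G, by simp [hG], by simp [hG], by simp [hG], by simp [hG]⟩

/-- A family satisfying the relations of infinitesimal braids. -/
structure InfBraidFamily {n : ℕ} (t : Fin n → Fin n → Q) : Prop where
  diag : ∀ i, t i i = 0
  symm : ∀ i j, t i j = t j i
  triple : ∀ i j l, i ≠ j → i ≠ l → j ≠ l → Commute (t i j) (t i l + t j l)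
  disjoint : ∀ i j l m, i ≠ j → i ≠ l → i ≠ m → j ≠ l → j ≠ m → l ≠ m →
    Commute (t i j) (t l m)

lemma InfBraidFamily.map {R : Type*} [Ring R] [Algebra k R] (g : Q →ₐ[k] R) {n : ℕ}
    {t : Fin n → Fin n → Q} (h : InfBraidFamily t) : InfBraidFamily fun i j => g (t i j) where
  diag i := by rw [h.diag, map_zero]
  symm i j := by rw [h.symm]
  triple i j l hij hil hjl := by
    rw [← map_add]; exact (h.triple i j l hij hil hjl).map g
  disjoint i j l m hij hil him hjl hjm hlm := (h.disjoint i j l m hij hil him hjl hjm hlm).map g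

/-- Permuting strands makes the pentagon available for the other orders of the strands that the
braid relations require. -/
lemma InfBraidFamily.perm {n : ℕ} {t : Fin n → Fin n → Q} (h : InfBraidFamily t)
    (σ : Equiv.Perm (Fin n)) : InfBraidFamily fun i j => t (σ i) (σ j) where
  diag i := h.diag _
  symm i j := h.symm _ _
  triple i j l hij hil hjl := h.triple _ _ _ (by simpa) (by simpa) (by simpa)
  disjoint i j l m hij hil him hjl hjm hlm :=
    h.disjoint _ _ _ _ (by simpa) (by simpa) (by simpa) (by simpa) (by simpa) (by simpa)

lemma infBraidFamily_mk (n : ℕ) : InfBraidFamily fun i j : Fin n =>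
    RingQuot.mkAlgHom k (InfBraidRel k n) (FreeAlgebra.ι k (i, j)) where
  diag i := by rw [RingQuot.mkAlgHom_rel k (InfBraidRel.diag i), map_zero]
  symm i j := RingQuot.mkAlgHom_rel k (InfBraidRel.symm i j)
  triple i j l hij hil hjl := by
    have := RingQuot.mkAlgHom_rel k (InfBraidRel.triple (k := k) hij hil hjl)
    rw [Ring.lie_def, map_zero, map_sub, map_mul, map_mul, map_add, sub_eq_zero] at this
    exact this
  disjoint i j l m hij hil him hjl hjm hlm := by
    have := RingQuot.mkAlgHom_rel k (InfBraidRel.disjoint (k := k) hij hil him hjl hjm hlm)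
    rw [Ring.lie_def, map_zero, map_sub, map_mul, map_mul, sub_eq_zero] at this
    exact this

lemma infBraidFamily_infT (n N : ℕ) : InfBraidFamily fun i j : Fin n => infT k N i j :=
  (infBraidFamily_mk n).map (truncHom (infBraidAug k n) N)

lemma infT_mem {n : ℕ} (N : ℕ) (i j : Fin n) : infT k N i j ∈ truncIdeal (infBraidAug k n) N :=
  toTrunc_mem (by simp [infBraidAug])

lemma InfBraidFamily.exists_lift {n : ℕ} {t : Fin n → Fin n → Q} (h : InfBraidFamily t) :
    ∃ g : InfBraidAlgebra k n →ₐ[k] Q, ∀ i j,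
      g (RingQuot.mkAlgHom k (InfBraidRel k n) (FreeAlgebra.ι k (i, j))) = t i j := by
  refine ⟨RingQuot.liftAlgHom k ⟨FreeAlgebra.lift k fun p => t p.1 p.2, ?_⟩, ?_⟩
  · rintro _ _ (⟨i⟩ | ⟨i, j⟩ | ⟨hij, hil, hjl⟩ | ⟨hij, hil, him, hjl, hjm, hlm⟩)
    · simp [h.diag]
    · simp [h.symm i j]
    · simpa [Ring.lie_def, sub_eq_zero] using (h.triple _ _ _ hij hil hjl).eq
    · simpa [Ring.lie_def, sub_eq_zero] using (h.disjoint _ _ _ _ hij hil him hjl hjm hlm).eq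
  · intro i j; simp

lemma InfBraidFamily.exists_trunc_lift {n : ℕ} {t : Fin n → Fin n → Q} (h : InfBraidFamily t)
    {I : Ideal Q} [I.IsTwoSided] {N : ℕ} (hI : I ^ N = ⊥) (ht : ∀ i j, t i j ∈ I) :
    ∃ G : AugTrunc (infBraidAug k n) N →ₐ[k] Q, ∀ i j, G (infT k N i j) = t i j := by
  obtain ⟨g, hg⟩ := h.exists_lift (k := k)
  obtain ⟨G, hG⟩ := _root_.exists_trunc_lift (ε := infBraidAug k n) hI g
    (sub_mem_of_comp_mk_eq _ (by
      ext ⟨i, j⟩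
      simpa [hg, infBraidAug, Ideal.Quotient.eq_zero_iff_mem] using ht i j))
  exact ⟨G, fun i j => by rw [infT, hG, hg]⟩

lemma infBraid_adjoin (n : ℕ) : Algebra.adjoin k (Set.range fun p : Fin n × Fin n =>
    RingQuot.mkAlgHom k (InfBraidRel k n) (FreeAlgebra.ι k p)) = ⊤ := by
  have := congrArg (Subalgebra.map (RingQuot.mkAlgHom k (InfBraidRel k n)))
    (FreeAlgebra.adjoin_range_ι k (Fin n × Fin n))
  rw [AlgHom.map_adjoin, Algebra.map_top, (AlgHom.range_eq_top _).2
    (RingQuot.mkAlgHom_surjective k _), ← Set.range_comp] at this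
  exact this

set_option synthInstance.maxHeartbeats 200000 in
lemma exists_infBraid_scale (n : ℕ) (c : k) (N : ℕ) :
    ∃ G : AugTrunc (infBraidAug k n) (N + 1) →ₐ[k] AugTrunc (infBraidAug k n) (N + 1),
      (∀ i j, G (infT k (N + 1) i j) = c • infT k (N + 1) i j) ∧
      ∀ e ∈ truncIdeal (infBraidAug k n) (N + 1) ^ N, G e = c ^ N • e := by
  have hfam : InfBraidFamily fun i j : Fin n =>
      c • RingQuot.mkAlgHom k (InfBraidRel k n) (FreeAlgebra.ι k (i, j)) := by
    have h := infBraidFamily_mk (k := k) n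
    exact
    { diag := fun i => by rw [h.diag, smul_zero]
      symm := fun i j => by rw [h.symm]
      triple := fun i j l hij hil hjl => by
        rw [← smul_add]; exact ((h.triple i j l hij hil hjl).smul_left c).smul_right c
      disjoint := fun i j l m hij hil him hjl hjm hlm =>
        ((h.disjoint i j l m hij hil him hjl hjm hlm).smul_left c).smul_right c }
  obtain ⟨S, hS⟩ := hfam.exists_lift (k := k)
  have hsc : ScalesBy (infBraidAug k n) c S := by
    refine ScalesBy.of_adjoin (infBraid_adjoin n) ?_ ?_
    · rintro _ ⟨⟨i, j⟩, rfl⟩; simp [infBraidAug]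
    · rintro _ ⟨⟨i, j⟩, rfl⟩; exact hS i j
  obtain ⟨G, hG, hG'⟩ := hsc.exists_trunc N
  refine ⟨G, fun i j => ?_, hG'⟩
  rw [infT, hG, hS, ← truncHom_apply, map_smul]; rfl

lemma exists_pureBraid_lift {n : ℕ} {I : Ideal Q} [I.IsTwoSided] {N : ℕ} (hI : I ^ N = ⊥)
    (ρ : PureBraidGroup n →* Qˣ)
    (hρ : ∀ (i j : Fin n) (h : i < j), (ρ (PureBraidGroup.X h) : Q) - 1 ∈ I) :
    ∃ G : AugTrunc (pureBraidAug k n) N →ₐ[k] Q, ∀ (i j : Fin n) (h : i < j),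
      G (pbLog k N h) = nilLog k N (ρ (PureBraidGroup.X h) : Q) := by
  -- Triviality modulo `I` is known on generators only; it extends to all braids because reduction
  -- modulo `I` is a homomorphism.
  have hρ' : (Units.map (Ideal.Quotient.mk I : Q →* Q ⧸ I)).comp ρ = 1 := by
    refine PresentedGroup.ext ?_
    rintro ⟨⟨i, j⟩, h⟩
    refine Units.ext ?_
    have := Ideal.Quotient.eq.2 (hρ i j h)
    simpa [PureBraidGroup.X] using this
  obtain ⟨G, hG⟩ := exists_trunc_lift (ε := pureBraidAug k n) hI
    (MonoidAlgebra.lift k Q (PureBraidGroup n) ((Units.coeHom Q).comp ρ))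
    (sub_mem_of_comp_mk_eq _ (by
      refine MonoidAlgebra.algHom_ext (fun g => ?_) (Subsingleton.elim _ _)
      have := congrArg Units.val (DFunLike.congr_fun hρ' g)
      simpa [pureBraidAug] using this))
  refine ⟨G, fun i j h => ?_⟩
  rw [pbLog, nilLog_map, hG]
  simp

end UniversalProperties

/-! ### The defining equations in algebras with a nilpotent ideal -/

section Equations

variable {k : Type*} [Field k] {Q : Type*} [Ring Q] [Algebra k Q] {I : Ideal Q} [I.IsTwoSided]
  {N : ℕ}

/-- Reduction modulo `I ^ N` lowers the cut-off by one. This is how an equation known at level `N`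
bounds the error at level `N + 1`. -/
lemma NCSeries.mk_eval (f : NCSeries k) {a b : Q} (ha : a ∈ I) (hb : b ∈ I) :
    Ideal.Quotient.mkₐ k (I ^ N) (f.eval (N + 1) a b) =
      f.eval N (Ideal.Quotient.mkₐ k (I ^ N) a) (Ideal.Quotient.mkₐ k (I ^ N) b) := by
  rw [NCSeries.eval_map]
  exact NCSeries.eval_eq_of_le (I := I.map (Ideal.Quotient.mk (I ^ N)))
    (Ideal.map_mk_pow_eq_bot le_rfl) N.le_succ f
    (Ideal.mem_map_of_mem _ ha) (Ideal.mem_map_of_mem _ hb)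

lemma mk_nilExp {a : Q} (ha : a ∈ I) :
    Ideal.Quotient.mkₐ k (I ^ N) (nilExp k (N + 1) a) =
      nilExp k N (Ideal.Quotient.mkₐ k (I ^ N) a) := by
  rw [nilExp_map]
  exact nilExp_eq_of_le k (Ideal.pow_eq_zero_of_pow_eq_bot (I := I.map (Ideal.Quotient.mk (I ^ N)))
    (Ideal.map_mk_pow_eq_bot le_rfl) (Ideal.mem_map_of_mem _ ha)) N.le_succ

lemma sub_mem_of_mk_eq {K : Ideal Q} [K.IsTwoSided] {a b : Q}
    (h : Ideal.Quotient.mkₐ k K a = Ideal.Quotient.mkₐ k K b) : a - b ∈ K :=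
  Ideal.Quotient.eq.1 h

lemma NCSeries.isUnit_eval (hI : I ^ (N + 1) = ⊥) {f : NCSeries k} (hf : f [] = 1) {a b : Q}
    (ha : a ∈ I) (hb : b ∈ I) : IsUnit (f.eval (N + 1) a b) := by
  refine IsUnit.of_sub_one_mem hI ?_
  simpa [hf] using f.eval_sub_mem (N := N) ha hb

lemma isUnit_nilExp {I : Ideal Q} (hI : I ^ (N + 1) = ⊥) {a : Q} (ha : a ∈ I) :
    IsUnit (nilExp k (N + 1) a) :=
  IsUnit.of_sub_one_mem hI (nilExp_sub_one_mem k ha)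

lemma mul_eq_of_sub_one_mem (hI : I ^ (N + 1) = ⊥) {u e : Q} (hu : u - 1 ∈ I)
    (he : e ∈ I ^ N) : u * e = e ∧ e * u = e := by
  have h1 := Ideal.mul_eq_zero_of_mem_pow hI he hu
  have h2 := Ideal.mul_eq_zero_of_mem_pow' hI he hu
  rw [mul_sub, mul_one, sub_eq_zero] at h1
  rw [sub_mul, one_mul, sub_eq_zero] at h2
  exact ⟨h2, h1⟩

/-- A top-degree change of the conjugating unit is killed by multiplication with elements of `I`,
hence invisible. -/
lemma conj_eq_of_sub_mem (hI : I ^ (N + 1) = ⊥) {u v : Qˣ} (h : (u : Q) - v ∈ I ^ N) {x : Q}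
    (hx : x ∈ I) : (u : Q) * x * (u⁻¹ : Qˣ) = v * x * (v⁻¹ : Qˣ) := by
  have h1 := Ideal.mul_eq_zero_of_mem_pow hI h hx
  have h2 := Ideal.mul_eq_zero_of_mem_pow' hI h (I.mul_mem_left (v : Q)
    (I.mul_mem_right ((v⁻¹ : Qˣ) : Q) hx))
  rw [sub_mul, sub_eq_zero] at h1
  rw [mul_sub, sub_eq_zero] at h2
  rw [Units.mul_inv_eq_iff_eq_mul, h1, mul_assoc (v : Q) x, h2]
  simp [mul_assoc]

lemma conj_mem (I : Ideal Q) [I.IsTwoSided] (u : Qˣ) {x : Q} (hx : x ∈ I) :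
    (u : Q) * x * (u⁻¹ : Qˣ) ∈ I :=
  I.mul_mem_right _ (I.mul_mem_left _ hx)

lemma semiconj_conj (u : Qˣ) (x : Q) : SemiconjBy (u : Q) x (u * x * (u⁻¹ : Qˣ)) := by
  simp [SemiconjBy, mul_assoc]

/-! #### Group-like series -/

lemma eval_add_of_eq {f : NCSeries k} (hI : I ^ N = ⊥)
    (h : f.eval N
        (toTrunc (tensorAug k) N (FreeAlgebra.ι k 0 ⊗ₜ 1 + 1 ⊗ₜ FreeAlgebra.ι k 0))
        (toTrunc (tensorAug k) N (FreeAlgebra.ι k 1 ⊗ₜ 1 + 1 ⊗ₜ FreeAlgebra.ι k 1)) =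
      f.eval N (toTrunc (tensorAug k) N (FreeAlgebra.ι k 0 ⊗ₜ 1))
          (toTrunc (tensorAug k) N (FreeAlgebra.ι k 1 ⊗ₜ 1)) *
        f.eval N (toTrunc (tensorAug k) N (1 ⊗ₜ FreeAlgebra.ι k 0))
          (toTrunc (tensorAug k) N (1 ⊗ₜ FreeAlgebra.ι k 1)))
    {a b a' b' : Q} (ha : a ∈ I) (hb : b ∈ I) (ha' : a' ∈ I) (hb' : b' ∈ I)
    (haa : Commute a a') (hab : Commute a b') (hba : Commute b a') (hbb : Commute b b') :
    f.eval N (a + a') (b + b') = f.eval N a b * f.eval N a' b' := by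
  obtain ⟨G, h1, h2, h3, h4⟩ := exists_tensor_lift (k := k) hI ha hb ha' hb' haa hab hba hbb
  have := congrArg G h
  simp only [← truncHom_apply, map_add] at this h1 h2 h3 h4
  rwa [map_mul, NCSeries.eval_map, NCSeries.eval_map, NCSeries.eval_map, map_add, map_add, h1, h2,
    h3, h4] at this

lemma IsGroupLike.eval_add {f : NCSeries k} (hf : IsGroupLike f) (hI : I ^ N = ⊥)
    {a b a' b' : Q} (ha : a ∈ I) (hb : b ∈ I) (ha' : a' ∈ I) (hb' : b' ∈ I)
    (haa : Commute a a') (hab : Commute a b') (hba : Commute b a') (hbb : Commute b b') :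
    f.eval N (a + a') (b + b') = f.eval N a b * f.eval N a' b' :=
  eval_add_of_eq hI (hf.2 N) ha hb ha' hb' haa hab hba hbb

/-! #### Antisymmetry -/

lemma eval_mul_eval_swap_of_eq {f : NCSeries k} (hI : I ^ N = ⊥)
    (h : f.eval N (varX k N) (varY k N) * f.eval N (varY k N) (varX k N) = 1)
    {a b : Q} (ha : a ∈ I) (hb : b ∈ I) : f.eval N a b * f.eval N b a = 1 := by
  obtain ⟨G, h1, h2⟩ := exists_free_lift (k := k) hI ha hb
  have := congrArg G h
  rwa [map_mul, NCSeries.eval_map, NCSeries.eval_map, map_one, h1, h2] at this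

lemma Antisymmetry.eval_mul {f : NCSeries k} (hf : Antisymmetry f) (hI : I ^ N = ⊥)
    {a b : Q} (ha : a ∈ I) (hb : b ∈ I) : f.eval N a b * f.eval N b a = 1 :=
  eval_mul_eval_swap_of_eq hI (hf N) ha hb

/-! #### Hexagons -/

lemma GTHexagon.eval_eq {c : k} {f : NCSeries k} (hf : GTHexagon c f) (hI : I ^ N = ⊥)
    {x y : Q} (hx : x ∈ I) (hy : y ∈ I) :
    let z := -nilCH k N x y
    let m : k := (c - 1) / 2
    f.eval N z x * nilExp k N (m • z) * f.eval N y z * nilExp k N (m • y) *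
      f.eval N x y * nilExp k N (m • x) = 1 := by
  obtain ⟨G, h1, h2⟩ := exists_free_lift (k := k) hI hx hy
  have := congrArg G (hf N)
  simpa only [map_mul, NCSeries.eval_map, nilExp_map, map_smul, map_neg, nilCH_map, map_one, h1, h2]
    using this

lemma assocHexagon_of_eq {μ : k} {Φ : NCSeries k} (hI : I ^ N = ⊥)
    (h : nilExp k N ((μ / 2) • varX k N) * Φ.eval N (-(varX k N + varY k N)) (varX k N) *
      nilExp k N ((μ / 2) • -(varX k N + varY k N)) * Φ.eval N (varY k N) (-(varX k N + varY k N)) *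
      nilExp k N ((μ / 2) • varY k N) * Φ.eval N (varX k N) (varY k N) = 1)
    {x y : Q} (hx : x ∈ I) (hy : y ∈ I) :
    nilExp k N ((μ / 2) • x) * Φ.eval N (-(x + y)) x * nilExp k N ((μ / 2) • -(x + y)) *
      Φ.eval N y (-(x + y)) * nilExp k N ((μ / 2) • y) * Φ.eval N x y = 1 := by
  obtain ⟨G, h1, h2⟩ := exists_free_lift (k := k) hI hx hy
  have := congrArg G h
  simpa only [map_mul, NCSeries.eval_map, nilExp_map, map_smul, map_neg, map_add, map_one, h1, h2]
    using this

lemma AssocHexagon.eval_eq {μ : k} {Φ : NCSeries k} (hΦ : AssocHexagon μ Φ) (hI : I ^ N = ⊥)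
    {x y : Q} (hx : x ∈ I) (hy : y ∈ I) :
    nilExp k N ((μ / 2) • x) * Φ.eval N (-(x + y)) x * nilExp k N ((μ / 2) • -(x + y)) *
      Φ.eval N y (-(x + y)) * nilExp k N ((μ / 2) • y) * Φ.eval N x y = 1 :=
  assocHexagon_of_eq hI (hΦ N) hx hy

/-! #### The equation relating `f` and `Φ` -/

/-- The universal equation is pushed to any pair `a`, `b` in a nilpotent ideal; a named unit `u`
replaces `Ring.inverse`, which algebra maps do not handle in general. -/
lemma eval_conj_mul_of_eq {c : k} {f Φ : NCSeries k} (hΦ : Φ [] = 1) (hI : I ^ (N + 1) = ⊥)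
    (h : f.eval (N + 1) (Φ.eval (N + 1) (varX k (N + 1)) (varY k (N + 1)) * varX k (N + 1) *
        Ring.inverse (Φ.eval (N + 1) (varX k (N + 1)) (varY k (N + 1)))) (varY k (N + 1)) *
        Φ.eval (N + 1) (varX k (N + 1)) (varY k (N + 1)) =
      Φ.eval (N + 1) (c • varX k (N + 1)) (c • varY k (N + 1)))
    {a b : Q} (ha : a ∈ I) (hb : b ∈ I) {u : Qˣ} (hu : (u : Q) = Φ.eval (N + 1) a b) :
    f.eval (N + 1) (u * a * (u⁻¹ : Qˣ)) b * u = Φ.eval (N + 1) (c • a) (c • b) := by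
  obtain ⟨G, h1, h2⟩ := exists_free_lift (k := k) hI ha hb
  obtain ⟨v, hv⟩ := NCSeries.isUnit_eval (truncIdeal_pow (freeAug k) (N + 1)) hΦ
    (varX_mem (k := k) (N + 1)) (varY_mem (N + 1))
  have hG : Units.map (G : _ →* Q) v = u := by
    refine Units.ext ?_
    rw [Units.coe_map, hv, hu]
    exact (NCSeries.eval_map G _ _ _ _).trans (by rw [h1, h2])
  have hG' : G v = u := by rw [← hG]; rfl
  have hG'' : G (v⁻¹ : Units _) = (u⁻¹ : Qˣ) := by rw [← hG]; rfl
  rw [← hv, Ring.inverse_unit] at h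
  have := congrArg G h
  simpa only [map_mul, NCSeries.eval_map, map_smul, h1, h2, hG', hG''] using this

lemma FixedUpToRescaling.eval_conj_mul {c : k} {f Φ : NCSeries k} (h : FixedUpToRescaling c f Φ)
    (hΦ : Φ [] = 1) (hI : I ^ (N + 1) = ⊥) {a b : Q} (ha : a ∈ I) (hb : b ∈ I) {u : Qˣ}
    (hu : (u : Q) = Φ.eval (N + 1) a b) :
    f.eval (N + 1) (u * a * (u⁻¹ : Qˣ)) b * u = Φ.eval (N + 1) (c • a) (c • b) :=
  eval_conj_mul_of_eq hΦ hI (h (N + 1)) ha hb hu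

/-- Moving `u` across `f` conjugates both arguments back by `u⁻¹`, so that the second variable is
the conjugated one; the pentagon uses this form. -/
lemma FixedUpToRescaling.mul_eval_conj {c : k} {f Φ : NCSeries k} (h : FixedUpToRescaling c f Φ)
    (hΦ : Φ [] = 1) (hI : I ^ (N + 1) = ⊥) {a b : Q} (ha : a ∈ I) (hb : b ∈ I) {u : Qˣ}
    (hu : (u : Q) = Φ.eval (N + 1) a b) :
    u * f.eval (N + 1) a ((u⁻¹ : Qˣ) * b * u) = Φ.eval (N + 1) (c • a) (c • b) := by
  rw [← h.eval_conj_mul hΦ hI ha hb hu]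
  refine NCSeries.eval_semiconj _ f (semiconj_conj u a) ?_
  simp [SemiconjBy, ← mul_assoc]

/-! #### The pentagon -/

lemma assocPentagon_of_eq {Φ : NCSeries k} (hI : I ^ N = ⊥)
    (h : Φ.eval N (infT k N (0 : Fin 4) 1) (infT k N 1 2 + infT k N 1 3) *
        Φ.eval N (infT k N 0 2 + infT k N 1 2) (infT k N 2 3) =
      Φ.eval N (infT k N (1 : Fin 4) 2) (infT k N 2 3) *
        Φ.eval N (infT k N 0 1 + infT k N 0 2) (infT k N 1 3 + infT k N 2 3) *
        Φ.eval N (infT k N 0 1) (infT k N 1 2))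
    {t : Fin 4 → Fin 4 → Q} (ht : InfBraidFamily t) (hm : ∀ i j, t i j ∈ I) :
    Φ.eval N (t 0 1) (t 1 2 + t 1 3) * Φ.eval N (t 0 2 + t 1 2) (t 2 3) =
      Φ.eval N (t 1 2) (t 2 3) * Φ.eval N (t 0 1 + t 0 2) (t 1 3 + t 2 3) *
        Φ.eval N (t 0 1) (t 1 2) := by
  obtain ⟨G, hG⟩ := ht.exists_trunc_lift (k := k) hI hm
  have := congrArg G h
  simpa only [map_mul, NCSeries.eval_map, map_add, hG] using this

lemma assocPentagon_sub_mem {Φ : NCSeries k}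
    (h : Φ.eval N (infT k N (0 : Fin 4) 1) (infT k N 1 2 + infT k N 1 3) *
        Φ.eval N (infT k N 0 2 + infT k N 1 2) (infT k N 2 3) =
      Φ.eval N (infT k N (1 : Fin 4) 2) (infT k N 2 3) *
        Φ.eval N (infT k N 0 1 + infT k N 0 2) (infT k N 1 3 + infT k N 2 3) *
        Φ.eval N (infT k N 0 1) (infT k N 1 2))
    {t : Fin 4 → Fin 4 → Q} (ht : InfBraidFamily t) (hm : ∀ i j, t i j ∈ I) :
    Φ.eval (N + 1) (t 0 1) (t 1 2 + t 1 3) * Φ.eval (N + 1) (t 0 2 + t 1 2) (t 2 3) -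
      Φ.eval (N + 1) (t 1 2) (t 2 3) * Φ.eval (N + 1) (t 0 1 + t 0 2) (t 1 3 + t 2 3) *
        Φ.eval (N + 1) (t 0 1) (t 1 2) ∈ I ^ N := by
  refine sub_mem_of_mk_eq (k := k) ?_
  have := assocPentagon_of_eq (I := I.map (Ideal.Quotient.mk (I ^ N)))
    (Ideal.map_mk_pow_eq_bot le_rfl) h
    (ht.map (Ideal.Quotient.mkₐ k (I ^ N))) fun i j => Ideal.mem_map_of_mem _ (hm i j)
  simp only [← map_add] at this
  rw [map_mul, map_mul, map_mul]
  have hm' : ∀ i j i' j', t i j + t i' j' ∈ I := fun i j i' j' => I.add_mem (hm _ _) (hm _ _)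
  rwa [NCSeries.mk_eval Φ (hm _ _) (hm' _ _ _ _), NCSeries.mk_eval Φ (hm' _ _ _ _) (hm _ _),
    NCSeries.mk_eval Φ (hm _ _) (hm _ _), NCSeries.mk_eval Φ (hm' _ _ _ _) (hm' _ _ _ _),
    NCSeries.mk_eval Φ (hm _ _) (hm _ _)]

end Equations

/-! ### Linear terms of `f` -/

section LinearTerms

variable {k : Type*} [Field k] {Q : Type*} [Ring Q] [Algebra k Q]

lemma nilLog_two (u : Q) : nilLog k 2 u = u - 1 := by
  simp [nilLog]

lemma nilExp_two (a : Q) : nilExp k 2 a = 1 + a := by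
  simp [nilExp, Finset.sum_range_succ]

lemma nilCH_two_zero (a : Q) : nilCH k 2 a 0 = a := by
  simp [nilCH, nilExp_two, nilLog_two]

open DualNumber in
lemma DualNumber.ker_fst_sq : RingHom.ker (TrivSqZeroExt.fstHom k k k) ^ 2 = ⊥ := by
  rw [eq_bot_iff, Submodule.pow_succ, Submodule.pow_one, Ideal.mul_le]
  intro a ha b hb
  rw [RingHom.mem_ker] at ha hb
  rw [Ideal.mem_bot]
  refine TrivSqZeroExt.ext ?_ ?_
  · simpa using Or.inl ha
  · have ha' : a.fst = 0 := ha
    have hb' : b.fst = 0 := hb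
    simp [ha', hb']

-- Send `X₁₂` to `1 + ε` and the other generators to `1` in the commutative group of units of
-- `k[ε]`, where all commutator relators hold. The pentagon becomes `1 + f₀ ε = (1 + f₀ ε) (1 + f₀
-- ε)`, with `f₀` the coefficient of `x`.
open DualNumber in
lemma GTPentagon.apply_zero {f : NCSeries k} (h1 : f [] = 1) (hf : GTPentagon f) : f [0] = 0 := by
  let I : Ideal (k[ε]) := RingHom.ker (TrivSqZeroExt.fstHom k k k)
  have hI : I ^ 2 = ⊥ := DualNumber.ker_fst_sq
  have hε : (ε : k[ε]) * ε = 0 := DualNumber.eps_mul_eps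
  let e : (k[ε])ˣ := ⟨1 + ε, 1 - ε, by ring_nf; rw [pow_two, hε, sub_zero],
    by ring_nf; rw [pow_two, hε, sub_zero]⟩
  have hrel : ∀ r ∈ {r | PBRelator 4 r}, FreeGroup.lift
      (fun p : PBIndex 4 => if p.1 = (0, 1) then e else 1) r = 1 := by
    rintro _ (_ | _ | _ | _ | _) <;>
    exact (map_commutatorElement _ _ _).trans
      (commutatorElement_eq_one_iff_mul_comm.2 (mul_comm (G := (k[ε])ˣ) _ _))
  let ρ : PureBraidGroup 4 →* (k[ε])ˣ := PresentedGroup.toGroup hrel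
  have hX : ∀ (i j : Fin 4) (h : i < j), ρ (PureBraidGroup.X h) =
      if (i, j) = (0, 1) then e else 1 := fun i j h => PresentedGroup.toGroup.of hrel
  obtain ⟨G, hG⟩ := exists_pureBraid_lift (k := k) hI ρ (by
    intro i j h
    rw [hX]
    split_ifs
    · simp [e, I, RingHom.mem_ker]
    · simp)
  have := congrArg G (hf 2)
  simp only [map_mul, NCSeries.eval_map, nilCH_map, hG, hX, nilLog_two] at this
  simp [nilCH_two_zero, NCSeries.eval_two, h1, e] at this
  have h2 := congrArg TrivSqZeroExt.snd this
  simpa using h2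

-- Antisymmetry at `(ε, 0)` says that the two linear coefficients sum to zero.
open DualNumber in
lemma Antisymmetry.apply_one {f : NCSeries k} (h1 : f [] = 1) (h0 : f [0] = 0)
    (hf : Antisymmetry f) : f [1] = 0 := by
  have hε : (ε : k[ε]) ∈ RingHom.ker (TrivSqZeroExt.fstHom k k k) := by simp [RingHom.mem_ker]
  have := hf.eval_mul (k := k) DualNumber.ker_fst_sq hε (Ideal.zero_mem _)
  simp only [NCSeries.eval_two, h1, h0] at this
  have h2 := congrArg TrivSqZeroExt.snd this
  simpa using h2

end LinearTerms

/-! ### Existence and uniqueness of the solution -/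

section Solution

variable {k : Type*} [Field k] {Q : Type*} [Ring Q] [Algebra k Q]

namespace NCSeries

lemma eval_add_series (N : ℕ) (f g : NCSeries k) (a b : Q) :
    (f + g).eval N a b = f.eval N a b + g.eval N a b := by
  simp [eval, add_smul, Finset.sum_add_distrib]

lemma eval_smul_series (N : ℕ) (r : k) (f : NCSeries k) (a b : Q) :
    (r • f).eval N a b = r • f.eval N a b := by
  simp [eval, mul_smul, Finset.smul_sum]

lemma eval_congr {N : ℕ} {f g : NCSeries k} (h : ∀ w, w.length < N → f w = g w) (a b : Q) :
    f.eval N a b = g.eval N a b := by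
  refine Finset.sum_congr rfl fun n hn => Finset.sum_congr rfl fun w _ => ?_
  rw [h _ (by simpa using hn)]

lemma eval_single {M : ℕ} (l : List (Fin 2)) (hl : l.length < M) (a b : Q) :
    eval M (Pi.single l (1 : k)) a b = (l.map ![a, b]).prod := by
  rw [eval, Finset.sum_eq_single l.length, Finset.sum_eq_single l.get]
  · rw [List.ofFn_get, Pi.single_eq_same, one_smul]
    congr 1
    refine List.ext_get (by simp) fun n h1 h2 => by simp
  · intro w _ hw
    rw [Pi.single_eq_of_ne, zero_smul]
    exact fun h => hw (List.ofFn_injective (h.trans (List.ofFn_get l).symm))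
  · simp
  · intro n _ hn
    refine Finset.sum_eq_zero fun w _ => ?_
    rw [Pi.single_eq_of_ne, zero_smul]
    rintro rfl
    simp at hn
  · intro h; simp at h; omega

end NCSeries

lemma freeAug_decomp (a : FreeAlgebra k (Fin 2)) :
    ∃ r s : k, a - (algebraMap k _ (freeAug k a) + r • FreeAlgebra.ι k 0 + s • FreeAlgebra.ι k 1) ∈
      RingHom.ker (freeAug k) ^ 2 := by
  induction a using FreeAlgebra.induction with
  | grade0 c => exact ⟨0, 0, by simp⟩
  | grade1 i =>
    obtain rfl | rfl : i = 0 ∨ i = 1 := by omega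
    · exact ⟨1, 0, by simp [freeAug]⟩
    · exact ⟨0, 1, by simp [freeAug]⟩
  | add x y hx hy =>
    obtain ⟨r, s, h⟩ := hx
    obtain ⟨r', s', h'⟩ := hy
    refine ⟨r + r', s + s', ?_⟩
    convert Ideal.add_mem _ h h' using 1
    simp only [map_add]
    module
  | mul x y hx hy =>
    obtain ⟨r, s, h⟩ := hx
    obtain ⟨r', s', h'⟩ := hy
    refine ⟨r * freeAug k y + freeAug k x * r', s * freeAug k y + freeAug k x * s', ?_⟩
    have hx1 := sub_algebraMap_mem_ker (ε := freeAug k) x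
    have hy1 := sub_algebraMap_mem_ker (ε := freeAug k) y
    have hxy := Ideal.mul_mem_mul hx1 hy1
    have h2 : RingHom.ker (freeAug k) * RingHom.ker (freeAug k) = RingHom.ker (freeAug k) ^ 2 := by
      rw [Submodule.pow_succ, Submodule.pow_one]
    rw [h2] at hxy
    convert Ideal.add_mem _ hxy (Ideal.add_mem _ (Ideal.smul_mem_of_algebra _ (freeAug k y) h)
      (Ideal.smul_mem_of_algebra _ (freeAug k x) h')) using 1
    simp only [map_mul, Algebra.algebraMap_eq_smul_one, sub_mul, mul_sub, mul_smul_comm,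
      smul_mul_assoc, mul_one, one_mul]
    module

/-- The span of the words of length `n`. -/
def wordSpan (k : Type*) [Field k] (n : ℕ) : Submodule k (FreeAlgebra k (Fin 2)) :=
  Submodule.span k {a | ∃ l : List (Fin 2), l.length = n ∧ a = (l.map (FreeAlgebra.ι k)).prod}

/-- By induction from `freeAug_decomp`: the last factor of a product may be replaced by its linear
part, so `J ^ n / J ^ (n + 1)` is spanned by words of length `n`. -/
lemma ker_freeAug_pow_le (n : ℕ) {a : FreeAlgebra k (Fin 2)} (ha : a ∈ RingHom.ker (freeAug k) ^ n) :
    ∃ w ∈ wordSpan k n, a - w ∈ RingHom.ker (freeAug k) ^ (n + 1) := by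
  induction n generalizing a with
  | zero =>
    refine ⟨algebraMap k _ (freeAug k a), ?_, ?_⟩
    · rw [Algebra.algebraMap_eq_smul_one]
      exact Submodule.smul_mem _ _ (Submodule.subset_span ⟨[], rfl, by simp⟩)
    · rw [Submodule.pow_one]; exact sub_algebraMap_mem_ker a
  | succ n ih =>
    rw [Submodule.pow_succ] at ha
    refine Submodule.mul_induction_on ha ?_ ?_
    · intro x hx y hy
      obtain ⟨w, hw, hxw⟩ := ih hx
      obtain ⟨r, s, h⟩ := freeAug_decomp y
      rw [(RingHom.mem_ker).1 hy, map_zero, zero_add] at h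
      refine ⟨w * (r • FreeAlgebra.ι k 0 + s • FreeAlgebra.ι k 1), ?_, ?_⟩
      · have hι : ∀ i, w * FreeAlgebra.ι k i ∈ wordSpan k (n + 1) := by
          intro i
          clear hxw
          induction hw using Submodule.span_induction with
          | mem x hx =>
            obtain ⟨l, hl, rfl⟩ := hx
            exact Submodule.subset_span ⟨l ++ [i], by simp [hl], by simp⟩
          | zero => rw [zero_mul]; exact Submodule.zero_mem _
          | add x y _ _ hx hy => rw [add_mul]; exact Submodule.add_mem _ hx hy
          | smul c x _ hx => rw [smul_mul_assoc]; exact Submodule.smul_mem _ _ hx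
        rw [mul_add, mul_smul_comm, mul_smul_comm]
        exact Submodule.add_mem _ (Submodule.smul_mem _ _ (hι 0)) (Submodule.smul_mem _ _ (hι 1))
      · rw [show x * y - w * (r • FreeAlgebra.ι k 0 + s • FreeAlgebra.ι k 1) =
          (x - w) * y + w * (y - (r • FreeAlgebra.ι k 0 + s • FreeAlgebra.ι k 1)) by
            rw [sub_mul, mul_sub]; abel]
        refine Ideal.add_mem _ ?_ ?_
        · rw [Submodule.pow_succ]; exact Ideal.mul_mem_mul hxw hy
        · rw [show n + 1 + 1 = n + 2 by ring, Ideal.IsTwoSided.pow_add]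
          refine Ideal.mul_mem_mul ?_ h
          have := Ideal.sub_mem _ hx (Ideal.pow_le_pow_right n.le_succ hxw)
          rwa [sub_sub_cancel] at this
    · rintro x y ⟨w, hw, hx⟩ ⟨v, hv, hy⟩
      refine ⟨w + v, Submodule.add_mem _ hw hv, ?_⟩
      rw [add_sub_add_comm]; exact Ideal.add_mem _ hx hy

/-- Supplies the correction term: an error in top degree is itself the value of a homogeneous
series. -/
lemma exists_series_of_mem (N : ℕ) {e : AugTrunc (freeAug k) (N + 1)}
    (he : e ∈ truncIdeal (freeAug k) (N + 1) ^ N) :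
    ∃ E : NCSeries k, (∀ w, w.length ≠ N → E w = 0) ∧
      E.eval (N + 1) (varX k (N + 1)) (varY k (N + 1)) = e := by
  obtain ⟨a, ha, rfl⟩ := exists_of_mem_truncIdeal_pow he
  obtain ⟨w, hw, haw⟩ := ker_freeAug_pow_le N ha
  have h0 := toTrunc_eq_zero haw
  rw [← truncHom_apply, map_sub, sub_eq_zero] at h0
  rw [← truncHom_apply, h0]
  clear h0 haw ha he a
  induction hw using Submodule.span_induction with
  | mem x hx =>
    obtain ⟨l, hl, rfl⟩ := hx
    refine ⟨Pi.single l 1, fun w hw => Pi.single_eq_of_ne (by rintro rfl; exact hw hl) _, ?_⟩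
    rw [NCSeries.eval_single l (by omega), map_list_prod, List.map_map]
    congr 2
    funext i
    fin_cases i <;> rfl
  | zero => exact ⟨0, fun _ _ => rfl, by simp [NCSeries.eval]⟩
  | add x y _ _ hx hy =>
    obtain ⟨E, hE, hE'⟩ := hx
    obtain ⟨F, hF, hF'⟩ := hy
    exact ⟨E + F, fun w hw => by simp [hE w hw, hF w hw], by
      rw [NCSeries.eval_add_series, hE', hF', map_add]⟩
  | smul c x _ hx =>
    obtain ⟨E, hE, h⟩ := hx
    exact ⟨c • E, fun w hw => by simp [hE w hw], by
      rw [NCSeries.eval_smul_series, h, map_smul]⟩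

/-- Left multiplication of series by a letter. -/
def mulLetter (k : Type*) [Field k] (i : Fin 2) : Module.End k (NCSeries k) where
  toFun F w := match w with
    | [] => 0
    | j :: v => if j = i then F v else 0
  map_add' F G := by
    funext w
    rcases w with _ | ⟨j, v⟩
    · simp
    · by_cases h : j = i <;> simp [h]
  map_smul' c F := by
    funext w
    rcases w with _ | ⟨j, v⟩
    · simp
    · by_cases h : j = i <;> simp [h]

/-- Acting on the series `1`, the regular representation of `k⟨x, y⟩` returns the word itself, so
coefficients can be read off. -/
lemma mulLetter_prod (l : List (Fin 2)) :
    (l.map (mulLetter k)).prod (Pi.single [] 1) = Pi.single l 1 := by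
  induction l with
  | nil => simp
  | cons i l ih =>
    rw [List.map_cons, List.prod_cons, Module.End.mul_apply, ih]
    funext w
    rcases w with _ | ⟨j, v⟩
    · simp [mulLetter]
    · by_cases h : j = i
      · subst h
        by_cases h' : v = l
        · subst h'; simp [mulLetter]
        · simp [mulLetter, h']
      · simp [mulLetter, h]

/-- Series without terms of degree less than `n`. -/
def VanishBelow (n : ℕ) (F : NCSeries k) : Prop := ∀ w, w.length < n → F w = 0

/-- Each letter raises the order by one, so in the lowest degree `a` acts through its constant term.
Consequently `J ^ m` raises the order by `m`. -/
lemma vanishBelow_lift (a : FreeAlgebra k (Fin 2)) {n : ℕ} {F : NCSeries k} (hF : VanishBelow n F) :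
    VanishBelow (n + 1) (FreeAlgebra.lift k (mulLetter k) a F - freeAug k a • F) := by
  induction a using FreeAlgebra.induction generalizing F with
  | grade0 c =>
    intro w _
    simp [Algebra.algebraMap_eq_smul_one]
  | grade1 i =>
    rintro (_ | ⟨j, v⟩) hw
    · simp [freeAug, mulLetter]
    · have := hF v (by simpa using hw)
      by_cases h : j = i <;> simp [freeAug, mulLetter, h, this]
  | add x y hx hy =>
    intro w hw
    have h1 := hx hF w hw
    have h2 := hy hF w hw
    simp only [Pi.sub_apply, sub_eq_zero] at h1 h2
    simp [h1, h2, add_smul]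
  | mul x y hx hy =>
    have hy' : VanishBelow n (FreeAlgebra.lift k (mulLetter k) y F) := by
      intro w hw
      have := hy hF w (by omega)
      simp only [Pi.sub_apply, Pi.smul_apply, hF w hw, smul_zero, sub_zero] at this
      exact this
    intro w hw
    have h1 := hx hy' w hw
    have h2 := hy hF w hw
    simp only [Pi.sub_apply, Pi.smul_apply, sub_eq_zero] at h1 h2
    simp only [map_mul, Module.End.mul_apply, Pi.sub_apply, Pi.smul_apply, h1, h2, smul_smul,
      sub_self]

lemma vanishBelow_lift_pow (m : ℕ) {a : FreeAlgebra k (Fin 2)}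
    (ha : a ∈ RingHom.ker (freeAug k) ^ m) {n : ℕ} {F : NCSeries k} (hF : VanishBelow n F) :
    VanishBelow (n + m) (FreeAlgebra.lift k (mulLetter k) a F) := by
  induction m generalizing a n F with
  | zero =>
    intro w hw
    have := vanishBelow_lift a hF w (by omega)
    simpa [hF w hw] using this
  | succ m ih =>
    rw [Submodule.pow_succ] at ha
    refine Submodule.mul_induction_on ha ?_ ?_
    · intro x hx y hy
      have h1 := vanishBelow_lift y hF
      rw [(RingHom.mem_ker).1 hy, zero_smul, sub_zero] at h1
      have := ih hx h1
      rw [map_mul, Module.End.mul_apply, show n + (m + 1) = n + 1 + m by ring]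
      exact this
    · intro x y hx hy w hw
      rw [map_add, LinearMap.add_apply, Pi.add_apply, hx w hw, hy w hw, add_zero]

/-- The difference of the two truncated values lies in `J ^ N`, so it sends the series `1` to a
series with no terms of degree below `N`; these terms are exactly the differences of coefficients.
-/
lemma NCSeries.eq_of_eval_eq {N : ℕ} {F G : NCSeries k}
    (h : F.eval N (varX k N) (varY k N) = G.eval N (varX k N) (varY k N)) (l : List (Fin 2))
    (hl : l.length < N) : F l = G l := by
  have h0 : F.eval N (FreeAlgebra.ι k 0) (FreeAlgebra.ι k 1) -
      G.eval N (FreeAlgebra.ι k 0) (FreeAlgebra.ι k 1) ∈ RingHom.ker (freeAug k) ^ N := by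
    rw [← Ideal.Quotient.eq]
    have e : ∀ H : NCSeries k, Ideal.Quotient.mk (RingHom.ker (freeAug k) ^ N)
      (H.eval N (FreeAlgebra.ι k 0) (FreeAlgebra.ι k 1)) = H.eval N (varX k N) (varY k N) :=
      fun H => NCSeries.eval_map (truncHom (freeAug k) N) N H _ _
    rw [e, e, h]
  have h1 := vanishBelow_lift_pow N h0 (n := 0) (F := Pi.single [] 1)
    (fun w hw => absurd hw (Nat.not_lt_zero _)) l (by omega)
  rw [map_sub, LinearMap.sub_apply, Pi.sub_apply, sub_eq_zero] at h1
  have key : ∀ H : NCSeries k, FreeAlgebra.lift k (mulLetter k)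
      (H.eval N (FreeAlgebra.ι k 0) (FreeAlgebra.ι k 1)) (Pi.single [] 1) l = H l := by
    intro H
    rw [NCSeries.eval_map, FreeAlgebra.lift_ι_apply, FreeAlgebra.lift_ι_apply, NCSeries.eval,
      LinearMap.sum_apply, Finset.sum_apply]
    have hp : ∀ (n : ℕ) (w : Fin n → Fin 2), (List.ofFn fun i =>
        (![mulLetter k 0, mulLetter k 1] : Fin 2 → Module.End k (NCSeries k)) (w i)).prod
          (Pi.single [] 1) = Pi.single (List.ofFn w) 1 := by
      intro n w
      rw [← mulLetter_prod (List.ofFn w), List.map_ofFn]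
      congr 3
      funext i
      obtain h | h : w i = 0 ∨ w i = 1 := by omega
      all_goals simp [h]
    simp only [LinearMap.sum_apply, Finset.sum_apply, LinearMap.smul_apply, hp, Pi.smul_apply]
    rw [Finset.sum_eq_single l.length, Finset.sum_eq_single l.get]
    · simp
    · intro w _ hw
      rw [Pi.single_eq_of_ne, smul_zero]
      exact fun h => hw (List.ofFn_injective (h.symm.trans (List.ofFn_get l).symm))
    · simp
    · intro n _ hn
      refine Finset.sum_eq_zero fun w _ => ?_
      rw [Pi.single_eq_of_ne, smul_zero]
      rintro rfl
      simp at hn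
    · intro h; simp at h; omega
  rwa [key, key] at h1

end Solution

/-! ### Solving the equation for `Φ` degree by degree. -/

section FixedSeries

variable {k : Type*} [Field k]

lemma eq_zero_of_smul_eq {V : Type*} [AddCommGroup V] [Module k V] {r : k} (hr : r ≠ 1) {e : V}
    (h : r • e = e) : e = 0 := by
  have : (r - 1) • e = 0 := by rw [sub_smul, one_smul, h, sub_self]
  exact (smul_eq_zero.1 this).resolve_left (sub_ne_zero.2 hr)

lemma subsingleton_augTrunc_zero {A : Type*} [Ring A] [Algebra k A] (ε : A →ₐ[k] k) :
    Subsingleton (AugTrunc ε 0) :=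
  Ideal.Quotient.subsingleton_iff.2 (by rw [Submodule.pow_zero, Ideal.one_eq_top])

set_option synthInstance.maxHeartbeats 200000 in
lemma exists_tensor_scale (c : k) (N : ℕ) :
    ∃ G : AugTrunc (tensorAug k) (N + 1) →ₐ[k] AugTrunc (tensorAug k) (N + 1),
      (∀ i, G (toTrunc _ _ (FreeAlgebra.ι k i ⊗ₜ 1)) = c • toTrunc _ _ (FreeAlgebra.ι k i ⊗ₜ 1)) ∧
      (∀ i, G (toTrunc _ _ (1 ⊗ₜ FreeAlgebra.ι k i)) = c • toTrunc _ _ (1 ⊗ₜ FreeAlgebra.ι k i)) ∧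
      ∀ e ∈ truncIdeal (tensorAug k) (N + 1) ^ N, G e = c ^ N • e := by
  obtain ⟨G, hG, hG'⟩ := (tensorAug_scalesBy c).exists_trunc N
  refine ⟨G, fun i => ?_, fun i => ?_, hG'⟩
  · rw [hG, Algebra.TensorProduct.map_tmul, FreeAlgebra.lift_ι_apply, map_one,
      ← TensorProduct.smul_tmul', ← truncHom_apply, map_smul, truncHom_apply]
  · rw [hG, Algebra.TensorProduct.map_tmul, FreeAlgebra.lift_ι_apply, map_one,
      TensorProduct.tmul_smul, ← truncHom_apply, map_smul, truncHom_apply]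

/-- The equation `FixedUpToRescaling` modulo terms of degree at least `N`. -/
def FixedAt (c : k) (f Φ : NCSeries k) (N : ℕ) : Prop :=
  f.eval N (Φ.eval N (varX k N) (varY k N) * varX k N *
    Ring.inverse (Φ.eval N (varX k N) (varY k N))) (varY k N) * Φ.eval N (varX k N) (varY k N) =
  Φ.eval N (c • varX k N) (c • varY k N)

lemma FixedAt.congr {c : k} {f Φ Ψ : NCSeries k} {N : ℕ} (h : ∀ w, w.length < N → Φ w = Ψ w)
    (hΦ : FixedAt c f Φ N) : FixedAt c f Ψ N := by
  unfold FixedAt at hΦ ⊢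
  rwa [NCSeries.eval_congr h, NCSeries.eval_congr h] at hΦ

lemma FixedAt.one {c : k} {f Φ : NCSeries k} (hf : f [] = 1) (hΦ : Φ [] = 1) :
    FixedAt c f Φ 1 := by
  simp [FixedAt, NCSeries.eval_one, hf, hΦ]

section Trunc

variable {Q : Type*} [Ring Q] [Algebra k Q] {I : Ideal Q} [I.IsTwoSided] {N : ℕ}

/-- The left side of the equation varies by exactly the top-degree variation of `Φ`: the conjugate
of `a` is unchanged, and the value of `f`, being `1` modulo `I`, acts trivially on top degree. -/
lemma NCSeries.eval_conj_mul_of_sub_mem {f : NCSeries k} (hf : f [] = 1) (hI : I ^ (N + 1) = ⊥)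
    {u v : Qˣ} (huv : (u : Q) - v ∈ I ^ N) {a b : Q} (ha : a ∈ I) (hb : b ∈ I) :
    f.eval (N + 1) (u * a * (u⁻¹ : Qˣ)) b * u - f.eval (N + 1) (v * a * (v⁻¹ : Qˣ)) b * v =
      u - v := by
  rw [conj_eq_of_sub_mem hI huv ha, ← mul_sub]
  refine (mul_eq_of_sub_one_mem hI ?_ huv).1
  simpa [hf] using f.eval_sub_mem (N := N) (conj_mem I v ha) hb

end Trunc

lemma FixedAt.exists_succ {c : k} {f Φ : NCSeries k} {N : ℕ} (hc : c ^ (N + 1) ≠ 1)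
    (hf : f [] = 1) (hΦ : Φ [] = 1) (h : FixedAt c f Φ (N + 1)) :
    ∃ Ψ : NCSeries k, Ψ [] = 1 ∧ FixedAt c f Ψ (N + 1 + 1) ∧
      ∀ w, w.length < N + 1 → Ψ w = Φ w := by
  set x := varX k (N + 1 + 1)
  set y := varY k (N + 1 + 1)
  set I := truncIdeal (freeAug k) (N + 1 + 1) with hIdef
  have hI : I ^ (N + 1 + 1) = ⊥ := truncIdeal_pow _ _
  have hx : x ∈ I := varX_mem _
  have hy : y ∈ I := varY_mem _
  obtain ⟨G, hGx, hGy, hG⟩ := exists_free_scale c (N + 1)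
  obtain ⟨u, hu⟩ := NCSeries.isUnit_eval hI hΦ hx hy
  have he : f.eval (N + 1 + 1) (u * x * (u⁻¹ : Units _)) y * u -
      Φ.eval (N + 1 + 1) (c • x) (c • y) ∈ I ^ (N + 1) := by
    refine sub_mem_of_mk_eq (k := k) ?_
    have := eval_conj_mul_of_eq (I := I.map (Ideal.Quotient.mk (I ^ (N + 1)))) hΦ
      (Ideal.map_mk_pow_eq_bot le_rfl) h (Ideal.mem_map_of_mem _ hx) (Ideal.mem_map_of_mem _ hy)
      (u := Units.map (Ideal.Quotient.mk (I ^ (N + 1)) : _ →* _) u)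
      (by rw [Units.coe_map, hu]; exact NCSeries.mk_eval Φ hx hy)
    rw [map_mul, NCSeries.mk_eval f (conj_mem I u hx) hy,
      NCSeries.mk_eval Φ (I.smul_mem_of_algebra c hx) (I.smul_mem_of_algebra c hy)]
    exact this
  obtain ⟨E, hE, hEe⟩ := exists_series_of_mem (N + 1) he
  -- Replacing `Φ` by `Φ + r • E` changes the error `e` to `(1 + r - c ^ (N + 1) * r) • e`; this `r`
  -- makes it zero.
  set r : k := (c ^ (N + 1) - 1)⁻¹
  have hr : c ^ (N + 1) * r = r + 1 := by
    have := mul_inv_cancel₀ (sub_ne_zero.2 hc)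
    linear_combination this
  set Ψ : NCSeries k := Φ + r • E
  have hlow : ∀ w, w.length < N + 1 → Ψ w = Φ w := by
    intro w hw
    simp [Ψ, hE w (by omega)]
  have hΨ : Ψ [] = 1 := by rw [hlow _ (by simp), hΦ]
  refine ⟨Ψ, hΨ, ?_, hlow⟩
  obtain ⟨v, hv⟩ := NCSeries.isUnit_eval hI hΨ hx hy
  set e := f.eval (N + 1 + 1) (u * x * (u⁻¹ : Units _)) y * u -
      Φ.eval (N + 1 + 1) (c • x) (c • y) with hedef
  have hvu : (v : AugTrunc (freeAug k) (N + 1 + 1)) - u = r • e := by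
    rw [hv, hu, NCSeries.eval_add_series, NCSeries.eval_smul_series, hEe, add_sub_cancel_left]
  have h1 := NCSeries.eval_conj_mul_of_sub_mem hf hI (u := v) (v := u)
    (hvu ▸ Ideal.smul_mem_of_algebra _ _ he) hx hy
  have h2 : Ψ.eval (N + 1 + 1) (c • x) (c • y) =
      Φ.eval (N + 1 + 1) (c • x) (c • y) + r • c ^ (N + 1) • e := by
    rw [NCSeries.eval_add_series, NCSeries.eval_smul_series, ← hG e he, ← hEe, NCSeries.eval_map,
      hGx, hGy]
  unfold FixedAt
  rw [← hv, Ring.inverse_unit, h2, sub_eq_iff_eq_add.1 h1, hvu, smul_smul, mul_comm, hr, hedef]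
  module

lemma exists_fixedUpToRescaling {c : k} (hc : ∀ n : ℕ, 0 < n → c ^ n ≠ 1) {f : NCSeries k}
    (hf : f [] = 1) : ∃ Φ : NCSeries k, Φ [] = 1 ∧ FixedUpToRescaling c f Φ := by
  have step : ∀ (N : ℕ) (Φ : {Φ : NCSeries k // Φ [] = 1 ∧ FixedAt c f Φ (N + 1)}),
      ∃ Ψ : {Ψ : NCSeries k // Ψ [] = 1 ∧ FixedAt c f Ψ (N + 1 + 1)},
        ∀ w, w.length < N + 1 → Ψ.1 w = Φ.1 w := by
    rintro N ⟨Φ, h1, h2⟩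
    obtain ⟨Ψ, h3, h4, h5⟩ := h2.exists_succ (hc _ N.succ_pos) hf h1
    exact ⟨⟨Ψ, h3, h4⟩, h5⟩
  choose next hnext using step
  -- Stage `n` solves the equation modulo degree `n + 1` and no longer changes coefficients of
  -- length at most `n`. The limit therefore takes the coefficient of `w` from stage `w.length`.
  let s : ∀ n : ℕ, {Φ : NCSeries k // Φ [] = 1 ∧ FixedAt c f Φ (n + 1)} := fun n =>
    Nat.rec ⟨Pi.single [] 1, by simp, FixedAt.one hf (by simp)⟩ (fun n p => next n p) n
  have hs : ∀ n w, w.length < n + 1 → (s (n + 1)).1 w = (s n).1 w := fun n => hnext n (s n)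
  have hs' : ∀ (w : List (Fin 2)) n, w.length ≤ n → (s n).1 w = (s w.length).1 w := by
    intro w n hn
    induction n, hn using Nat.le_induction with
    | base => rfl
    | succ n hn ih => rw [hs n w (by omega), ih]
  refine ⟨fun w => (s w.length).1 w, (s 0).2.1, fun N => ?_⟩
  rcases N with _ | N
  · exact (subsingleton_augTrunc_zero _).elim _ _
  · exact (s N).2.2.congr fun w hw => hs' w N (by omega)

/-- The lowest-degree difference of two solutions is unchanged by the left side and multiplied by a
power of `c` by the right side. -/
lemma FixedUpToRescaling.unique {c : k} (hc : ∀ n : ℕ, 0 < n → c ^ n ≠ 1) {f Φ Ψ : NCSeries k}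
    (hf : f [] = 1) (hΦ : Φ [] = 1) (hΨ : Ψ [] = 1) (h : FixedUpToRescaling c f Φ)
    (h' : FixedUpToRescaling c f Ψ) : Φ = Ψ := by
  have key : ∀ N, Φ.eval (N + 1) (varX k (N + 1)) (varY k (N + 1)) =
      Ψ.eval (N + 1) (varX k (N + 1)) (varY k (N + 1)) := by
    intro N
    induction N with
    | zero => simp [NCSeries.eval_one, hΦ, hΨ]
    | succ N ih =>
      set x := varX k (N + 1 + 1)
      set y := varY k (N + 1 + 1)
      set I := truncIdeal (freeAug k) (N + 1 + 1) with hIdef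
      have hI : I ^ (N + 1 + 1) = ⊥ := truncIdeal_pow _ _
      have hx : x ∈ I := varX_mem _
      have hy : y ∈ I := varY_mem _
      obtain ⟨G, hGx, hGy, hG⟩ := exists_free_scale c (N + 1)
      obtain ⟨u, hu⟩ := NCSeries.isUnit_eval hI hΦ hx hy
      obtain ⟨v, hv⟩ := NCSeries.isUnit_eval hI hΨ hx hy
      have he : (u : AugTrunc (freeAug k) (N + 1 + 1)) - v ∈ I ^ (N + 1) := by
        refine sub_mem_of_mk_eq (k := k) ?_
        obtain ⟨T, hTx, hTy⟩ := exists_free_lift (k := k)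
          (I := I.map (Ideal.Quotient.mk (I ^ (N + 1)))) (Ideal.map_mk_pow_eq_bot le_rfl)
          (Ideal.mem_map_of_mem _ hx) (Ideal.mem_map_of_mem _ hy)
        have := congrArg T ih
        rw [NCSeries.eval_map, NCSeries.eval_map, hTx, hTy] at this
        rw [hu, hv, NCSeries.mk_eval Φ hx hy, NCSeries.mk_eval Ψ hx hy]
        exact this
      have h1 := NCSeries.eval_conj_mul_of_sub_mem hf hI he hx hy
      rw [h.eval_conj_mul hΦ hI hx hy hu, h'.eval_conj_mul hΨ hI hx hy hv] at h1
      have h2 := hG _ he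
      rw [map_sub, hu, hv, NCSeries.eval_map, NCSeries.eval_map, hGx, hGy, h1, hu, hv] at h2
      exact sub_eq_zero.1 (eq_zero_of_smul_eq (hc _ N.succ_pos) h2.symm)
  funext w
  exact NCSeries.eq_of_eval_eq (key w.length) w (Nat.lt_succ_self _)

/-! ### Transfer of group-likeness and antisymmetry from `f` to `Φ`. -/

section Properties

variable {c : k} (hc : ∀ n : ℕ, 0 < n → c ^ n ≠ 1) {f Φ : NCSeries k} (hΦ : Φ [] = 1)
  (h : FixedUpToRescaling c f Φ)
include hc hΦ h

/-- With `u`, `v`, `w` the values of `Φ` at the two commuting pairs and at their sum, the error is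
`w - u * v`. Group-likeness of `f` splits its value at the conjugated sum, and the equation for `Φ`
identifies this error with its own rescaling. -/
lemma FixedUpToRescaling.eval_add_of_scale (hf : IsGroupLike f) {Q : Type*} [Ring Q] [Algebra k Q]
    {I : Ideal Q} [I.IsTwoSided] {N : ℕ}
    (ih : Φ.eval (N + 1)
        (toTrunc (tensorAug k) (N + 1) (FreeAlgebra.ι k 0 ⊗ₜ 1 + 1 ⊗ₜ FreeAlgebra.ι k 0))
        (toTrunc (tensorAug k) (N + 1) (FreeAlgebra.ι k 1 ⊗ₜ 1 + 1 ⊗ₜ FreeAlgebra.ι k 1)) =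
      Φ.eval (N + 1) (toTrunc (tensorAug k) (N + 1) (FreeAlgebra.ι k 0 ⊗ₜ 1))
          (toTrunc (tensorAug k) (N + 1) (FreeAlgebra.ι k 1 ⊗ₜ 1)) *
        Φ.eval (N + 1) (toTrunc (tensorAug k) (N + 1) (1 ⊗ₜ FreeAlgebra.ι k 0))
          (toTrunc (tensorAug k) (N + 1) (1 ⊗ₜ FreeAlgebra.ι k 1)))
    (hI : I ^ (N + 1 + 1) = ⊥) (G : Q →ₐ[k] Q) (hG' : ∀ e ∈ I ^ (N + 1), G e = c ^ (N + 1) • e)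
    {x1 y1 x2 y2 : Q} (hx1 : x1 ∈ I) (hy1 : y1 ∈ I) (hx2 : x2 ∈ I) (hy2 : y2 ∈ I)
    (hxx : Commute x1 x2) (hxy : Commute x1 y2) (hyx : Commute y1 x2) (hyy : Commute y1 y2)
    (hGx1 : G x1 = c • x1) (hGy1 : G y1 = c • y1) (hGx2 : G x2 = c • x2) (hGy2 : G y2 = c • y2) :
    Φ.eval (N + 1 + 1) (x1 + x2) (y1 + y2) =
      Φ.eval (N + 1 + 1) x1 y1 * Φ.eval (N + 1 + 1) x2 y2 := by
  obtain ⟨u, hu⟩ := NCSeries.isUnit_eval hI hΦ hx1 hy1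
  obtain ⟨v, hv⟩ := NCSeries.isUnit_eval hI hΦ hx2 hy2
  obtain ⟨w, hw⟩ := NCSeries.isUnit_eval hI hΦ (I.add_mem hx1 hx2) (I.add_mem hy1 hy2)
  have he : (w : Q) - (u * v : Qˣ) ∈ I ^ (N + 1) := by
    refine sub_mem_of_mk_eq (k := k) ?_
    have := eval_add_of_eq (I := I.map (Ideal.Quotient.mk (I ^ (N + 1))))
      (Ideal.map_mk_pow_eq_bot le_rfl) ih
      (Ideal.mem_map_of_mem _ hx1) (Ideal.mem_map_of_mem _ hy1)
      (Ideal.mem_map_of_mem _ hx2) (Ideal.mem_map_of_mem _ hy2)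
      (hxx.map (Ideal.Quotient.mk _)) (hxy.map (Ideal.Quotient.mk _))
      (hyx.map (Ideal.Quotient.mk _)) (hyy.map (Ideal.Quotient.mk _))
    rw [Units.val_mul, map_mul, hu, hv, hw, NCSeries.mk_eval Φ hx1 hy1,
      NCSeries.mk_eval Φ hx2 hy2, NCSeries.mk_eval Φ (I.add_mem hx1 hx2) (I.add_mem hy1 hy2)]
    exact this
  have hux2 : Commute (u : Q) x2 := by
    rw [hu]; exact (NCSeries.commute_eval _ _ hxx.symm hyx.symm).symm
  have huy2 : Commute (u : Q) y2 := by
    rw [hu]; exact (NCSeries.commute_eval _ _ hxy.symm hyy.symm).symm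
  have hvx1 : Commute (v : Q) x1 := by
    rw [hv]; exact (NCSeries.commute_eval _ _ hxx hxy).symm
  have hvy1 : Commute (v : Q) y1 := by
    rw [hv]; exact (NCSeries.commute_eval _ _ hyx hyy).symm
  have huv : Commute (u : Q) v := by
    rw [hv]; exact NCSeries.commute_eval _ _ hux2 huy2
  -- Since `v` commutes with `x1` and `u` with `x2` and `v`, conjugation by `u * v` acts on each
  -- summand through one factor.
  have hX : ((u * v : Qˣ) : Q) * (x1 + x2) * ((u * v)⁻¹ : Qˣ) =
      u * x1 * (u⁻¹ : Qˣ) + v * x2 * (v⁻¹ : Qˣ) := by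
    rw [Units.mul_inv_eq_iff_eq_mul, Units.val_mul]
    have e1 : (u : Q) * v * x1 = u * x1 * (u⁻¹ : Qˣ) * (u * v) := by
      simp only [mul_assoc, Units.inv_mul_cancel_left, hvx1.eq]
    have e2 : (u : Q) * v * x2 = v * x2 * (v⁻¹ : Qˣ) * (u * v) := by
      rw [huv.eq]
      simp only [mul_assoc, Units.inv_mul_cancel_left, hux2.eq]
    rw [mul_add, add_mul, e1, e2]
  have hvi : ∀ q : Q, Commute (v : Q) q → Commute ((v⁻¹ : Qˣ) : Q) q := fun q hq =>
    Commute.units_inv_left hq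
  have hui : ∀ q : Q, Commute (u : Q) q → Commute ((u⁻¹ : Qˣ) : Q) q := fun q hq =>
    Commute.units_inv_left hq
  have hA : ∀ q : Q, Commute (u : Q) q → Commute x1 q → Commute ((u : Q) * x1 * (u⁻¹ : Qˣ)) q :=
    fun q h1 h2 => (h1.mul_left h2).mul_left (hui q h1)
  have hB : ∀ q : Q, Commute q (v : Q) → Commute q x2 → Commute q ((v : Q) * x2 * (v⁻¹ : Qˣ)) :=
    fun q h1 h2 => (h1.mul_right h2).mul_right (hvi q h1.symm).symm
  have h1 := NCSeries.eval_conj_mul_of_sub_mem hf.1 hI he (I.add_mem hx1 hx2) (I.add_mem hy1 hy2)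
  rw [h.eval_conj_mul hΦ hI (I.add_mem hx1 hx2) (I.add_mem hy1 hy2) hw, hX,
    hf.eval_add hI (conj_mem I u hx1) hy1 (conj_mem I v hx2) hy2
      (hA _ (hB _ huv hux2) (hB _ hvx1.symm hxx)) (hA _ huy2 hxy) (hB _ hvy1.symm hyx) hyy,
    Units.val_mul, (NCSeries.commute_eval _ f (hB _ huv hux2) huy2).symm.mul_mul_mul_comm,
    h.eval_conj_mul hΦ hI hx1 hy1 hu, h.eval_conj_mul hΦ hI hx2 hy2 hv] at h1
  have h2 := hG' _ he
  rw [map_sub, Units.val_mul, map_mul, hw, hu, hv, NCSeries.eval_map, NCSeries.eval_map,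
    NCSeries.eval_map, map_add, map_add, hGx1, hGx2, hGy1, hGy2, ← smul_add, ← smul_add, h1,
    hw, hu, hv] at h2
  exact sub_eq_zero.1 (eq_zero_of_smul_eq (hc _ N.succ_pos) h2.symm)

lemma FixedUpToRescaling.isGroupLike (hf : IsGroupLike f) : IsGroupLike Φ := by
  refine ⟨hΦ, fun N => ?_⟩
  induction N with
  | zero => simp [NCSeries.eval]
  | succ N ih =>
    rcases N with _ | N
    · simp [NCSeries.eval_one, hΦ]
    obtain ⟨G, h1, h2, hG⟩ := exists_tensor_scale c (N + 1)
    have hcomm : ∀ i j : Fin 2, Commute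
        (toTrunc (tensorAug k) (N + 1 + 1) (FreeAlgebra.ι k i ⊗ₜ 1))
        (toTrunc (tensorAug k) (N + 1 + 1) (1 ⊗ₜ FreeAlgebra.ι k j)) := fun i j =>
      Commute.map (f := truncHom (tensorAug k) (N + 1 + 1)) (by simp [Commute, SemiconjBy])
    have hadd : ∀ a b, toTrunc (tensorAug k) (N + 1 + 1) (a + b) =
        toTrunc (tensorAug k) (N + 1 + 1) a + toTrunc (tensorAug k) (N + 1 + 1) b :=
      map_add (truncHom (tensorAug k) (N + 1 + 1))
    simp only [hadd]
    exact h.eval_add_of_scale hc hΦ hf ih (truncIdeal_pow _ _) G hG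
      (toTrunc_mem (by simp [tensorAug, freeAug])) (toTrunc_mem (by simp [tensorAug, freeAug]))
      (toTrunc_mem (by simp [tensorAug, freeAug])) (toTrunc_mem (by simp [tensorAug, freeAug]))
      (hcomm _ _) (hcomm _ _) (hcomm _ _) (hcomm _ _) (h1 0) (h1 1) (h2 0) (h2 1)

lemma FixedUpToRescaling.antisymmetry (hf : Antisymmetry f) : Antisymmetry Φ := by
  intro N
  induction N with
  | zero => exact (subsingleton_augTrunc_zero _).elim _ _
  | succ N ih =>
    rcases N with _ | N
    · simp [NCSeries.eval_one, hΦ]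
    let Q := AugTrunc (freeAug k) (N + 1 + 1)
    set x : Q := varX k (N + 1 + 1)
    set y : Q := varY k (N + 1 + 1)
    let I : Ideal Q := truncIdeal (freeAug k) (N + 1 + 1)
    have hI : I ^ (N + 1 + 1) = ⊥ := truncIdeal_pow _ _
    have hx : x ∈ I := varX_mem _
    have hy : y ∈ I := varY_mem _
    obtain ⟨G, hGx, hGy, hG⟩ := exists_free_scale c (N + 1)
    obtain ⟨u, hu⟩ := NCSeries.isUnit_eval hI hΦ hx hy
    obtain ⟨v, hv⟩ := NCSeries.isUnit_eval hI hΦ hy hx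
    have he : ((u * v : Qˣ) : Q) - (1 : Qˣ) ∈ I ^ (N + 1) := by
      refine sub_mem_of_mk_eq (k := k) ?_
      have := eval_mul_eval_swap_of_eq (I := I.map (Ideal.Quotient.mk (I ^ (N + 1))))
        (Ideal.map_mk_pow_eq_bot le_rfl) ih
        (Ideal.mem_map_of_mem _ hx) (Ideal.mem_map_of_mem _ hy)
      rw [Units.val_mul, Units.val_one, map_mul, map_one, hu, hv, NCSeries.mk_eval Φ hx hy,
        NCSeries.mk_eval Φ hy hx]
      exact this
    -- By induction `u * v` is `1` up to top degree, so it conjugates `y` trivially. Moving `u` past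
    -- the second value of `f` then makes the two values of `f` inverse to each other.
    have hconj := conj_eq_of_sub_mem hI he hy
    rw [Units.val_one, inv_one, Units.val_one, one_mul, mul_one] at hconj
    have h3 : (u : Q) * f.eval (N + 1 + 1) (v * y * (v⁻¹ : Qˣ)) x =
        f.eval (N + 1 + 1) y (u * x * (u⁻¹ : Qˣ)) * u := by
      refine NCSeries.eval_semiconj _ f ?_ (semiconj_conj u x)
      have := semiconj_conj u ((v : Q) * y * (v⁻¹ : Qˣ))
      rwa [show (u : Q) * (v * y * (v⁻¹ : Qˣ)) * (u⁻¹ : Qˣ) =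
        ((u * v : Qˣ) : Q) * y * ((u * v)⁻¹ : Qˣ) by simp [mul_assoc], hconj] at this
    have h1 : G ((u * v : Qˣ) : Q) = (u * v : Qˣ) := by
      rw [Units.val_mul, map_mul, hu, hv, NCSeries.eval_map, NCSeries.eval_map, hGx, hGy,
        ← h.eval_conj_mul hΦ hI hx hy hu, ← h.eval_conj_mul hΦ hI hy hx hv, ← hu, ← hv,
        mul_assoc, ← mul_assoc (u : Q), h3, mul_assoc (NCSeries.eval _ _ _ _), ← mul_assoc,
        hf.eval_mul hI (conj_mem I u hx) hy, one_mul]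
    have h2 := hG _ he
    rw [map_sub, h1, Units.val_one, map_one] at h2
    have := eq_zero_of_smul_eq (hc _ N.succ_pos) h2.symm
    rw [Units.val_mul, sub_eq_zero, hu, hv] at this
    exact this

end Properties

end FixedSeries

/-! ### Normalization and the hexagon -/

section Normalization

variable {k : Type*} [Field k] {c : k} {f Φ : NCSeries k}

variable {Q : Type*} [Ring Q] [Algebra k Q] {I : Ideal Q} [I.IsTwoSided] {N : ℕ}

lemma FixedUpToRescaling.eval_two_eq (hΦ : Φ [] = 1)
    (h : FixedUpToRescaling c f Φ) (hf : f [] = 1) (hf0 : f [0] = 0) (hf1 : f [1] = 0)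
    (hI : I ^ 2 = ⊥) {a b : Q} (ha : a ∈ I) (hb : b ∈ I) :
    Φ.eval 2 a b = Φ.eval 2 (c • a) (c • b) := by
  obtain ⟨u, hu⟩ := NCSeries.isUnit_eval (N := 1) hI hΦ ha hb
  have := h.eval_conj_mul (N := 1) hΦ hI ha hb hu
  rwa [NCSeries.eval_two f, hf, hf0, hf1, zero_smul, zero_smul, add_zero, add_zero, one_smul,
    one_mul, hu] at this

lemma FixedUpToRescaling.linear_eq_zero (hc : ∀ n : ℕ, 0 < n → c ^ n ≠ 1) (hΦ : Φ [] = 1)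
    (h : FixedUpToRescaling c f Φ) (hf : f [] = 1) (hf0 : f [0] = 0) (hf1 : f [1] = 0) :
    Φ [0] = 0 ∧ Φ [1] = 0 := by
  have hc1 : c ≠ 1 := by simpa using hc 1 one_pos
  have h1 := h.eval_two_eq hΦ hf hf0 hf1 (truncIdeal_pow (freeAug k) 2) (varX_mem 2) (varY_mem 2)
  -- The scalars are absorbed into the coefficients, so that coefficients can be compared at the
  -- same point.
  have h2 : Φ.eval 2 (c • varX k 2) (c • varY k 2) =
      NCSeries.eval 2 (fun w => Φ w * c ^ w.length) (varX k 2) (varY k 2) := by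
    simp [NCSeries.eval_two, smul_smul]
  have key : ∀ r : k, r = r * c → r = 0 := fun r hr => by
    have : r * (c - 1) = 0 := by linear_combination -hr
    exact (mul_eq_zero.1 this).resolve_right (sub_ne_zero.2 hc1)
  have h3 := NCSeries.eq_of_eval_eq (h1.trans h2)
  exact ⟨key _ (by simpa using h3 [0] (by simp)), key _ (by simpa using h3 [1] (by simp))⟩

/-- Group-likeness gives `Φ(2x, 0) = Φ(x, 0) ^ 2`. An error `e` in degree `n ≥ 2` then satisfies `2
^ n • e = 2 • e`, so it vanishes; the missing linear term starts the induction. -/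
lemma IsGroupLike.eval_varX_zero [CharZero k] (hΦ : IsGroupLike Φ) (h0 : Φ [0] = 0) (N : ℕ) :
    Φ.eval (N + 1) (varX k (N + 1)) 0 = 1 := by
  induction N with
  | zero => simp [NCSeries.eval_one, hΦ.1]
  | succ N ih =>
    rcases N with _ | N
    · simp [NCSeries.eval_two, hΦ.1, h0]
    set x := varX k (N + 1 + 1 + 1)
    set I := truncIdeal (freeAug k) (N + 1 + 1 + 1) with hIdef
    have hI : I ^ (N + 1 + 1 + 1) = ⊥ := truncIdeal_pow _ _
    have hx : x ∈ I := varX_mem _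
    obtain ⟨G, hGx, -, hG⟩ := exists_free_scale (2 : k) (N + 1 + 1)
    have he : Φ.eval (N + 1 + 1 + 1) x 0 - 1 ∈ I ^ (N + 1 + 1) := by
      refine sub_mem_of_mk_eq (k := k) ?_
      obtain ⟨T, hTx, -⟩ := exists_free_lift (k := k)
        (I := I.map (Ideal.Quotient.mk (I ^ (N + 1 + 1)))) (Ideal.map_mk_pow_eq_bot le_rfl)
        (Ideal.mem_map_of_mem _ hx) (Ideal.zero_mem _)
      have := congrArg T ih
      rw [NCSeries.eval_map, hTx, map_zero, map_one] at this
      rw [NCSeries.mk_eval Φ hx (Ideal.zero_mem _), map_zero, map_one]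
      exact this
    set e := Φ.eval (N + 1 + 1 + 1) x 0 - 1 with hedef
    have hee : e * e = 0 := Ideal.mul_eq_zero_of_mem_pow hI he (Ideal.pow_le_self (by omega) he)
    have h2 := hG e he
    have hadd := hΦ.eval_add hI hx (Ideal.zero_mem _) hx (Ideal.zero_mem _) (Commute.refl x)
      (Commute.zero_right _) (Commute.zero_left _) (Commute.zero_left _)
    rw [add_zero, ← two_smul k x, ← sub_add_cancel (Φ.eval _ x 0) 1, ← hedef] at hadd
    rw [hedef, map_sub, map_one, NCSeries.eval_map, hGx, map_zero, hadd, ← hedef] at h2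
    have h3 : ((2 : k) ^ (N + 1 + 1) - 2) • e = 0 := by
      rw [sub_smul, ← h2, add_mul, mul_add, hee, two_smul]
      simp only [mul_one, one_mul, zero_add]; abel
    have h4 : (2 : k) ^ (N + 1 + 1) - 2 ≠ 0 := by
      have : ((2 ^ (N + 1 + 1) : ℕ) : k) ≠ ((2 : ℕ) : k) := by
        rw [Ne, Nat.cast_inj]
        have := Nat.one_lt_two_pow (n := N + 1) (by omega)
        omega
      push_cast at this
      exact sub_ne_zero.2 this
    exact sub_eq_zero.1 ((smul_eq_zero.1 h3).resolve_left h4)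

lemma IsGroupLike.eval_zero_right [CharZero k] (hΦ : IsGroupLike Φ) (h0 : Φ [0] = 0)
    (hI : I ^ (N + 1) = ⊥) {a : Q} (ha : a ∈ I) : Φ.eval (N + 1) a 0 = 1 := by
  obtain ⟨T, hTx, -⟩ := exists_free_lift (k := k) hI ha (Ideal.zero_mem I)
  have := congrArg T (hΦ.eval_varX_zero h0 N)
  rwa [NCSeries.eval_map, hTx, map_zero, map_one] at this

/-- Group-likeness splits off the factor `Φ(w, 0)`, which is `1`. Thus commuting shifts of the
arguments are harmless. -/
lemma IsGroupLike.eval_add_left [CharZero k] (hΦ : IsGroupLike Φ) (h0 : Φ [0] = 0)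
    (hI : I ^ (N + 1) = ⊥) {a b w : Q} (ha : a ∈ I) (hb : b ∈ I) (hw : w ∈ I)
    (hwa : Commute w a) (hwb : Commute w b) : Φ.eval (N + 1) (a + w) b = Φ.eval (N + 1) a b := by
  have := hΦ.eval_add hI ha hb hw (Ideal.zero_mem _) hwa.symm (Commute.zero_right _) hwb.symm
    (Commute.zero_right _)
  rwa [add_zero, hΦ.eval_zero_right h0 hI hw, mul_one] at this

lemma IsGroupLike.eval_add_right [CharZero k] (hΦ : IsGroupLike Φ) (h0 : Φ [0] = 0)
    (hanti : Antisymmetry Φ)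
    (hI : I ^ (N + 1) = ⊥) {a b w : Q} (ha : a ∈ I) (hb : b ∈ I) (hw : w ∈ I)
    (hwa : Commute w a) (hwb : Commute w b) : Φ.eval (N + 1) a (b + w) = Φ.eval (N + 1) a b := by
  have h1 := hΦ.eval_add_left h0 hI hb ha hw hwb hwa
  have h2 := hanti.eval_mul hI ha (I.add_mem hb hw)
  have h3 := hanti.eval_mul hI hb ha
  rw [h1] at h2
  rw [← mul_one (Φ.eval (N + 1) a (b + w)), ← h3, ← mul_assoc, h2, one_mul]

lemma NCSeries.prod_ofFn_add (hI : I ^ (N + 1) = ⊥) {a b d : Q} (ha : a ∈ I) (hb : b ∈ I)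
    (hd : d ∈ I ^ N) (hd' : d ∈ I) {n : ℕ} (w : Fin (n + 2) → Fin 2) :
    (List.ofFn fun i => (![a + d, b] : Fin 2 → Q) (w i)).prod =
      (List.ofFn fun i => (![a, b] : Fin 2 → Q) (w i)).prod := by
  have hzero : ∀ i ∈ I, d * i = 0 ∧ i * d = 0 := fun i hi =>
    ⟨Ideal.mul_eq_zero_of_mem_pow hI hd hi, Ideal.mul_eq_zero_of_mem_pow' hI hd hi⟩
  have hmem : ∀ i : Fin 2, (![a, b] : Fin 2 → Q) i ∈ I := by
    intro i; fin_cases i <;> simpa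
  have hmem' : ∀ i : Fin 2, (![a + d, b] : Fin 2 → Q) i ∈ I := by
    intro i; fin_cases i
    · simpa using I.add_mem ha hd'
    · simpa
  have hmul : ∀ i : Fin 2, ∀ q ∈ I, (![a + d, b] : Fin 2 → Q) i * q = (![a, b] : Fin 2 → Q) i * q := by
    intro i q hq; fin_cases i
    · simp [add_mul, (hzero q hq).1]
    · simp
  have hmul' : ∀ i : Fin 2, ∀ q ∈ I, q * (![a + d, b] : Fin 2 → Q) i = q * (![a, b] : Fin 2 → Q) i := by
    intro i q hq; fin_cases i
    · simp [mul_add, (hzero q hq).2]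
    · simp
  induction n with
  | zero =>
    simp only [List.ofFn_succ, List.ofFn_zero, List.prod_cons, List.prod_nil, mul_one]
    rw [hmul _ _ (hmem' _), hmul' _ _ (hmem _)]
  | succ n ih =>
    rw [List.ofFn_succ, List.ofFn_succ (f := fun i => (![a, b] : Fin 2 → Q) (w i)), List.prod_cons,
      List.prod_cons, ih fun i => w i.succ, hmul]
    exact Ideal.pow_le_self (by omega) (Ideal.prod_ofFn_mem_pow ha hb fun i => w i.succ)

/-- Words of length at least two multiply `d` by an element of `I`, giving zero; only the linear
term of `f` could see `d`. -/
lemma NCSeries.eval_add_left_of_linear_eq_zero (hf0 : f [0] = 0)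
    (hI : I ^ (N + 1) = ⊥) {a b d : Q} (ha : a ∈ I) (hb : b ∈ I) (hd : d ∈ I ^ N) (hd' : d ∈ I)
    (M : ℕ) : f.eval M (a + d) b = f.eval M a b := by
  induction M with
  | zero => simp [NCSeries.eval]
  | succ M ih =>
    rw [NCSeries.eval_succ, NCSeries.eval_succ, ih]
    congr 1
    refine Finset.sum_congr rfl fun w _ => ?_
    rcases M with _ | _ | M
    · simp
    · obtain h | h : w 0 = 0 ∨ w 0 = 1 := by omega
      · simp [h, hf0]
      · simp [h]
    · rw [NCSeries.prod_ofFn_add hI ha hb hd hd']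

lemma NCSeries.eval_swap_series (f : NCSeries k) (M : ℕ) (a b : Q) :
    NCSeries.eval M (fun w => f (w.map (Equiv.swap 0 1))) a b = f.eval M b a := by
  unfold NCSeries.eval
  refine Finset.sum_congr rfl fun n _ => ?_
  refine Fintype.sum_equiv (Equiv.piCongrRight fun _ => Equiv.swap 0 1) _ _ fun w => ?_
  change f ((List.ofFn w).map (Equiv.swap 0 1)) • _ = _
  rw [List.map_ofFn]
  congr 3
  funext i
  obtain h | h : w i = 0 ∨ w i = 1 := by omega
  all_goals simp [h]

lemma NCSeries.eval_add_right_of_linear_eq_zero (hf1 : f [1] = 0)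
    (hI : I ^ (N + 1) = ⊥) {a b d : Q} (ha : a ∈ I) (hb : b ∈ I) (hd : d ∈ I ^ N) (hd' : d ∈ I)
    (M : ℕ) : f.eval M a (b + d) = f.eval M a b := by
  rw [← NCSeries.eval_swap_series, ← NCSeries.eval_swap_series f]
  exact NCSeries.eval_add_left_of_linear_eq_zero (by simpa using hf1) hI hb ha hd hd' M

/-- `Q` is `k + I`, and top-degree elements are annihilated by `I` on both sides. -/
lemma commute_of_mem_pow (hI : I ^ (N + 1) = ⊥)
    (hQ : ∀ q : Q, ∃ r : k, q - algebraMap k Q r ∈ I) {e : Q} (he : e ∈ I ^ N) (q : Q) :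
    Commute e q := by
  obtain ⟨r, hr⟩ := hQ q
  have h1 := Ideal.mul_eq_zero_of_mem_pow hI he hr
  have h2 := Ideal.mul_eq_zero_of_mem_pow' hI he hr
  rw [mul_sub, sub_eq_zero] at h1
  rw [sub_mul, sub_eq_zero] at h2
  rw [Commute, SemiconjBy, h1, h2, Algebra.commutes]

end Normalization

/-! ### The hexagon with central errors. -/

section Hexagon

variable {k : Type*} [Field k] {Q : Type*} [Ring Q] [Algebra k Q]

/-- The left-hand side of the hexagon equation for associators. -/
def hexagonValue (Φ : NCSeries k) (N : ℕ) (x y : Q) : Q :=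
  nilExp k N (((1 : k) / 2) • x) * Φ.eval N (-(x + y)) x * nilExp k N (((1 : k) / 2) • -(x + y)) *
    Φ.eval N y (-(x + y)) * nilExp k N (((1 : k) / 2) • y) * Φ.eval N x y

lemma hexagonValue_map {R : Type*} [Ring R] [Algebra k R] (g : Q →ₐ[k] R) (Φ : NCSeries k) (N : ℕ)
    (x y : Q) : g (hexagonValue Φ N x y) = hexagonValue Φ N (g x) (g y) := by
  simp only [hexagonValue, map_mul, NCSeries.eval_map, nilExp_map, map_smul, map_neg, map_add]

/-- Solving the hexagons at `(x, y)` and `(y, x)` for `a * ex` and `ex * a⁻¹` and multiplying gives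
the product of `Φ e^x Φ⁻¹` and `e^y`: a conjugate of `e^{-z}` times the product of the two central
defects. -/
lemma hexagon_group_identity {G : Type*} [Group G] {a b c ex ey ez H H' : G}
    (hH : ex * c * ez * b * ey * a = H) (hH' : ey * b⁻¹ * ez * c⁻¹ * ex * a⁻¹ = H')
    (cH : ∀ g, Commute H g) (cH' : ∀ g, Commute H' g) :
    a * (ex * ex) * a⁻¹ * (ey * ey) = (b * ey)⁻¹ * (ez * ez)⁻¹ * (b * ey) * (H * H') := by
  have h1 : a * ex = ey⁻¹ * b⁻¹ * ez⁻¹ * c⁻¹ * H := by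
    have : a = (ex * c * ez * b * ey)⁻¹ * H := by rw [← hH]; group
    rw [this, mul_assoc, (cH ex).eq]; group
  have h2 : ex * a⁻¹ = c * ez⁻¹ * b * ey⁻¹ * H' := by rw [← hH']; group
  calc a * (ex * ex) * a⁻¹ * (ey * ey) = (a * ex) * (ex * a⁻¹) * (ey * ey) := by group
    _ = ey⁻¹ * b⁻¹ * ez⁻¹ * c⁻¹ * (H * (c * ez⁻¹ * b * ey⁻¹)) * (H' * (ey * ey)) := by
      rw [h1, h2]; group
    _ = ey⁻¹ * b⁻¹ * ez⁻¹ * ez⁻¹ * b * ey⁻¹ * (H * (ey * ey)) * H' := by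
      rw [(cH (c * ez⁻¹ * b * ey⁻¹)).eq, (cH' (ey * ey)).eq]; group
    _ = (b * ey)⁻¹ * (ez * ez)⁻¹ * (b * ey) * (H * H') := by
      rw [(cH (ey * ey)).eq]; group

end Hexagon

section HexagonScale

variable {k : Type*} [Field k] {Q : Type*} [Ring Q] [Algebra k Q]

lemma nilExp_conj (N : ℕ) (u : Qˣ) (q : Q) :
    nilExp k N (u * q * (u⁻¹ : Qˣ)) = u * nilExp k N q * (u⁻¹ : Qˣ) := by
  rw [Units.eq_mul_inv_iff_mul_eq]
  exact (nilExp_semiconj k N (semiconj_conj u q)).eq.symm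

lemma nilExp_two_mul [CharZero k] {I : Ideal Q} {N : ℕ} (hI : I ^ N = ⊥) {x : Q} (hx : x ∈ I) :
    nilExp k N x = nilExp k N (((1 : k) / 2) • x) * nilExp k N (((1 : k) / 2) • x) := by
  have h := I.smul_mem_of_algebra ((1 : k) / 2) hx
  rw [← nilExp_add k (Commute.refl _) hI h h, ← add_smul, add_halves, one_smul]

lemma nilExp_mul_nilExp_neg [CharZero k] {I : Ideal Q} {N : ℕ} (hI : I ^ (N + 1) = ⊥) {x : Q} (hx : x ∈ I) :
    nilExp k (N + 1) x * nilExp k (N + 1) (-x) = 1 := by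
  rw [← nilExp_add k ((Commute.refl x).neg_right) hI hx (I.neg_mem hx), add_neg_cancel,
    nilExp_zero_right]

lemma nilExp_of_mem_pow {I : Ideal Q} {N : ℕ} (hI : I ^ (N + 1 + 1) = ⊥) {d : Q} (hd : d ∈ I ^ (N + 1)) :
    nilExp k (N + 1 + 1) d = 1 + d := by
  have hdd : d ^ 2 = 0 := by
    rw [pow_two]
    exact Ideal.mul_eq_zero_of_mem_pow hI hd (Ideal.pow_le_self (by omega) hd)
  rw [nilExp_eq_of_le k hdd (by omega : 2 ≤ N + 1 + 1), nilExp_two]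

variable {I : Ideal Q} [I.IsTwoSided] {N : ℕ}

/-- The hexagon of `f` is applied to `X = Φ x Φ⁻¹` and `y`. Its third variable is a conjugate `Z` of
`z = -(x + y)`, shifted by the sum `d` of the two errors, and the resulting factor `exp (m • d)` is
the only discrepancy between the hexagon value and its rescaling. -/
lemma hexagonValue_smul [CharZero k] {c : k} {f Φ : NCSeries k} (hf : GTHexagon c f)
    (hf0 : f [0] = 0) (hf1 : f [1] = 0) (hΦ : Φ [] = 1) (hanti : Antisymmetry Φ)
    (hfix : FixedUpToRescaling c f Φ) (hI : I ^ (N + 1 + 1) = ⊥)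
    (hQ : ∀ q : Q, ∃ r : k, q - algebraMap k Q r ∈ I) {x y : Q} (hx : x ∈ I) (hy : y ∈ I)
    (he : hexagonValue Φ (N + 1 + 1) x y - 1 ∈ I ^ (N + 1))
    (he' : hexagonValue Φ (N + 1 + 1) y x - 1 ∈ I ^ (N + 1)) :
    hexagonValue Φ (N + 1 + 1) (c • x) (c • y) = hexagonValue Φ (N + 1 + 1) x y +
      ((c - 1) / 2) • ((hexagonValue Φ (N + 1 + 1) x y - 1) +
        (hexagonValue Φ (N + 1 + 1) y x - 1)) := by
  obtain ⟨z, hzdef⟩ : ∃ z, z = -(x + y) := ⟨_, rfl⟩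
  have hz : z ∈ I := hzdef ▸ I.neg_mem (I.add_mem hx hy)
  have hsm : ∀ (r : k) {q : Q}, q ∈ I → r • q ∈ I := fun r q hq => I.smul_mem_of_algebra r hq
  obtain ⟨a, ha⟩ := NCSeries.isUnit_eval hI hΦ hx hy
  obtain ⟨b, hb⟩ := NCSeries.isUnit_eval hI hΦ hy hz
  obtain ⟨g, hg⟩ := NCSeries.isUnit_eval hI hΦ hz hx
  obtain ⟨ex, hex⟩ := isUnit_nilExp (k := k) hI (hsm (1 / 2) hx)
  obtain ⟨ey, hey⟩ := isUnit_nilExp (k := k) hI (hsm (1 / 2) hy)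
  obtain ⟨ez, hez⟩ := isUnit_nilExp (k := k) hI (hsm (1 / 2) hz)
  have ha' : Φ.eval (N + 1 + 1) y x = (a⁻¹ : Qˣ) :=
    Units.eq_inv_of_mul_eq_one_left (by rw [ha]; exact hanti.eval_mul hI hx hy)
  have hb' : Φ.eval (N + 1 + 1) z y = (b⁻¹ : Qˣ) :=
    Units.eq_inv_of_mul_eq_one_left (by rw [hb]; exact hanti.eval_mul hI hy hz)
  have hg' : Φ.eval (N + 1 + 1) x z = (g⁻¹ : Qˣ) :=
    Units.eq_inv_of_mul_eq_one_left (by rw [hg]; exact hanti.eval_mul hI hz hx)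
  obtain ⟨H, hH⟩ : ∃ H, ex * g * ez * b * ey * a = H := ⟨_, rfl⟩
  obtain ⟨H', hH'⟩ : ∃ H', ey * b⁻¹ * ez * g⁻¹ * ex * a⁻¹ = H' := ⟨_, rfl⟩
  have hHv : hexagonValue Φ (N + 1 + 1) x y = H := by
    rw [hexagonValue, ← hzdef, ← hH]
    simp only [Units.val_mul, ha, hb, hg, hex, hey, hez]
  have hHv' : hexagonValue Φ (N + 1 + 1) y x = H' := by
    rw [hexagonValue, add_comm y x, ← hzdef, ← hH']
    simp only [Units.val_mul, ha', hb', hg', hex, hey, hez]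
  rw [hHv] at he
  rw [hHv'] at he'
  rw [hHv, hHv']
  set e : Q := (H : Q) - 1 with hedef
  set e' : Q := (H' : Q) - 1 with hedef'
  have hHe : (H : Q) = 1 + e := by rw [hedef]; abel
  have hHe' : (H' : Q) = 1 + e' := by rw [hedef']; abel
  have cH : ∀ q : Qˣ, Commute H q := fun q => Units.ext <| by
    have := (Commute.one_left (q : Q)).add_left (commute_of_mem_pow hI hQ he (q : Q))
    rw [← hHe] at this
    exact this.eq
  have cH' : ∀ q : Qˣ, Commute H' q := fun q => Units.ext <| by
    have := (Commute.one_left (q : Q)).add_left (commute_of_mem_pow hI hQ he' (q : Q))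
    rw [← hHe'] at this
    exact this.eq
  have hgrp := congrArg Units.val (hexagon_group_identity hH hH' cH cH')
  obtain ⟨d, hd⟩ : ∃ d, d = e + e' := ⟨_, rfl⟩
  have hdm : d ∈ I ^ (N + 1) := hd ▸ Ideal.add_mem _ he he'
  have hdI : d ∈ I := Ideal.pow_le_self (by omega) hdm
  have heI : e ∈ I := Ideal.pow_le_self (by omega) he
  have heI' : e' ∈ I := Ideal.pow_le_self (by omega) he'
  have hHH : (H : Q) * H' = nilExp k (N + 1 + 1) d := by
    rw [nilExp_of_mem_pow hI hdm, hHe, hHe', hd, mul_add, add_mul, add_mul,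
      Ideal.mul_eq_zero_of_mem_pow hI he heI']
    simp only [mul_one, one_mul, add_zero]; abel
  obtain ⟨X, hX⟩ : ∃ X, X = (a : Q) * x * (a⁻¹ : Qˣ) := ⟨_, rfl⟩
  obtain ⟨Z, hZ⟩ : ∃ Z, Z = ((b * ey)⁻¹ : Qˣ) * z * ((b * ey)⁻¹⁻¹ : Qˣ) := ⟨_, rfl⟩
  have hXI : X ∈ I := hX ▸ conj_mem I a hx
  have hZI : Z ∈ I := hZ ▸ conj_mem I _ hz
  have hexX : nilExp k (N + 1 + 1) X = a * (ex * ex) * (a⁻¹ : Qˣ) := by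
    rw [hX, nilExp_conj, nilExp_two_mul hI hx, hex]
  have heyy : nilExp k (N + 1 + 1) y = ey * ey := by rw [nilExp_two_mul hI hy, hey]
  have hezz : nilExp k (N + 1 + 1) (-z) = ((ez * ez)⁻¹ : Qˣ) := by
    refine Units.eq_inv_of_mul_eq_one_right ?_
    have h := nilExp_mul_nilExp_neg (k := k) hI (I.neg_mem hz)
    rw [neg_neg, nilExp_two_mul hI hz, ← hez] at h
    rw [Units.val_mul, h]
  have hnZ : nilExp k (N + 1 + 1) (-Z) = ((b * ey)⁻¹ : Qˣ) * ((ez * ez)⁻¹ : Qˣ) * (b * ey : Qˣ) := by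
    rw [hZ, ← neg_mul, ← mul_neg, nilExp_conj, hezz, inv_inv]
  -- The group identity reads `exp X * exp y = exp (-Z) * exp d` with `d` central; take logarithms.
  have hch : nilCH k (N + 1 + 1) X y = -Z + d := by
    rw [nilCH, hexX, heyy, ← nilLog_nilExp k (N := N + 1) (a := -Z + d)
      (Ideal.pow_eq_zero_of_pow_eq_bot hI (I.add_mem (I.neg_mem hZI) hdI)),
      nilExp_add k (commute_of_mem_pow hI hQ hdm _).symm hI (I.neg_mem hZI) hdI, hnZ, ← hHH]
    simp only [Units.val_mul] at hgrp ⊢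
    rw [hgrp]
  set m : k := (c - 1) / 2 with hm
  have hcm : c / 2 = m + 1 / 2 := by rw [hm]; ring
  have hGT := hf.eval_eq hI hXI hy
  simp only [hch, neg_add, neg_neg] at hGT
  -- Having no linear terms, `f` does not notice the shift by `d`; only the factor `exp (m • z)`
  -- does.
  rw [NCSeries.eval_add_left_of_linear_eq_zero hf0 hI hZI hXI (neg_mem hdm)
    (I.neg_mem hdI), NCSeries.eval_add_right_of_linear_eq_zero hf1 hI hy hZI (neg_mem hdm)
    (I.neg_mem hdI), ← hm] at hGT
  have hD : nilExp k (N + 1 + 1) (m • Z) = nilExp k (N + 1 + 1) (m • (Z + -d)) * nilExp k (N + 1 + 1) (m • d) := by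
    rw [← nilExp_add k _ hI (hsm _ (I.add_mem hZI (I.neg_mem hdI))) (hsm _ hdI), ← smul_add,
      neg_add_cancel_right]
    exact ((commute_of_mem_pow hI hQ hdm _).symm.smul_left m).smul_right m
  have hcD : ∀ q : Q, Commute (nilExp k (N + 1 + 1) (m • d)) q := fun q =>
    (commute_nilExp k (N + 1 + 1) ((commute_of_mem_pow hI hQ hdm q).symm.smul_right m)).symm
  have hmain : f.eval (N + 1 + 1) Z X * nilExp k (N + 1 + 1) (m • Z) * f.eval (N + 1 + 1) y Z * nilExp k (N + 1 + 1) (m • y) *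
      f.eval (N + 1 + 1) X y * nilExp k (N + 1 + 1) (m • X) = nilExp k (N + 1 + 1) (m • d) := by
    have h := congrArg (· * nilExp k (N + 1 + 1) (m • d)) hGT
    simp only [one_mul] at h
    rw [hD]
    refine Eq.trans ?_ h
    simp only [mul_assoc, (hcD _).eq]
  have hsplit : ∀ {q : Q}, q ∈ I → nilExp k (N + 1 + 1) (((1 : k) / 2) • c • q) =
      nilExp k (N + 1 + 1) (m • q) * nilExp k (N + 1 + 1) (((1 : k) / 2) • q) ∧
      nilExp k (N + 1 + 1) (((1 : k) / 2) • c • q) =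
      nilExp k (N + 1 + 1) (((1 : k) / 2) • q) * nilExp k (N + 1 + 1) (m • q) := by
    intro q hq
    have h1 : Commute (m • q) (((1 : k) / 2) • q) := ((Commute.refl q).smul_left _).smul_right _
    rw [smul_smul, show (1 : k) / 2 * c = m + 1 / 2 by rw [← hcm]; ring]
    exact ⟨by rw [add_smul, nilExp_add k h1 hI (hsm _ hq) (hsm _ hq)],
      by rw [add_comm m, add_smul, nilExp_add k h1.symm hI (hsm _ hq) (hsm _ hq)]⟩
  obtain ⟨F1, hF1⟩ : ∃ F1, F1 = f.eval (N + 1 + 1) ((g : Q) * z * (g⁻¹ : Qˣ)) x := ⟨_, rfl⟩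
  obtain ⟨F2, hF2⟩ : ∃ F2, F2 = f.eval (N + 1 + 1) ((b : Q) * y * (b⁻¹ : Qˣ)) z := ⟨_, rfl⟩
  have hL : hexagonValue Φ (N + 1 + 1) (c • x) (c • y) = nilExp k (N + 1 + 1) (m • x) * ex * (F1 * g) *
      (ez * nilExp k (N + 1 + 1) (m • z)) * (F2 * b) * (ey * nilExp k (N + 1 + 1) (m • y)) * (f.eval (N + 1 + 1) X y * a) := by
    rw [hexagonValue, ← smul_add, ← smul_neg, ← hzdef, (hsplit hx).1, (hsplit hy).2, (hsplit hz).2,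
      ← hfix.eval_conj_mul hΦ hI hx hy ha, ← hfix.eval_conj_mul hΦ hI hy hz hb,
      ← hfix.eval_conj_mul hΦ hI hz hx hg, hex, hey, hez, hX, hF1, hF2]
  have cey : Commute (ey : Q) y := by
    rw [hey]
    exact (commute_nilExp k (N + 1 + 1) ((Commute.refl y).smul_right _)).symm
  have cez : Commute (ez : Q) z := by
    rw [hez]
    exact (commute_nilExp k (N + 1 + 1) ((Commute.refl z).smul_right _)).symm
  have sZ : SemiconjBy ((b * ey : Qˣ) : Q) Z z := by
    rw [SemiconjBy, hZ, inv_inv]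
    simp only [mul_assoc, Units.mul_inv_cancel_left]
  have s2 : SemiconjBy ((b * ey : Qˣ) : Q) (f.eval (N + 1 + 1) y Z) F2 := by
    rw [hF2]
    refine NCSeries.eval_semiconj _ _ ?_ sZ
    rw [Units.val_mul]
    exact (semiconj_conj b y).mul_left cey
  have sW : SemiconjBy ((g * ez * (b * ey) : Qˣ) : Q) (f.eval (N + 1 + 1) Z X) F1 := by
    rw [hF1]
    refine NCSeries.eval_semiconj _ _ ?_ ?_
    · rw [Units.val_mul, Units.val_mul g]
      exact ((semiconj_conj g z).mul_left cez).mul_left sZ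
    -- The hexagon itself rewrites the conjugating element as `ex⁻¹ * H * a⁻¹`, which carries `X`
    -- back to `x` because `ex` and the central `H` commute with `x`.
    · have hW : g * ez * (b * ey) = ex⁻¹ * H * a⁻¹ := by rw [← hH]; group
      have cex : Commute ((ex⁻¹ : Qˣ) : Q) x := by
        refine Commute.units_inv_left ?_
        rw [hex]
        exact (commute_nilExp k (N + 1 + 1) ((Commute.refl x).smul_right _)).symm
      have cHx : Commute (H : Q) x := by
        rw [hHe]; exact (Commute.one_left x).add_left (commute_of_mem_pow hI hQ he x)
      rw [hW, Units.val_mul, Units.val_mul]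
      refine (SemiconjBy.mul_left cex cHx).mul_left ?_
      rw [SemiconjBy, hX]
      simp only [mul_assoc, Units.inv_mul_cancel_left]
  have sX : nilExp k (N + 1 + 1) (m • X) * a = a * nilExp k (N + 1 + 1) (m • x) := by
    refine (nilExp_semiconj k (N + 1 + 1) ?_).eq.symm
    have h := semiconj_conj a x
    rw [← hX] at h
    rw [SemiconjBy, mul_smul_comm, smul_mul_assoc, h.eq]
  have sz : ((b * ey : Qˣ) : Q) * nilExp k (N + 1 + 1) (m • Z) = nilExp k (N + 1 + 1) (m • z) * (b * ey : Qˣ) := by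
    refine (nilExp_semiconj k (N + 1 + 1) ?_).eq
    rw [SemiconjBy, mul_smul_comm, smul_mul_assoc, sZ.eq]
  obtain ⟨emx, hemx⟩ := isUnit_nilExp (k := k) hI (hsm m hx)
  have hP : f.eval (N + 1 + 1) Z X * nilExp k (N + 1 + 1) (m • Z) * f.eval (N + 1 + 1) y Z * nilExp k (N + 1 + 1) (m • y) *
      f.eval (N + 1 + 1) X y * a = nilExp k (N + 1 + 1) (m • d) * a * (emx⁻¹ : Qˣ) := by
    rw [Units.eq_mul_inv_iff_mul_eq, hemx, mul_assoc _ (a : Q), ← sX, ← mul_assoc, hmain]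
  have hfin : hexagonValue Φ (N + 1 + 1) (c • x) (c • y) = nilExp k (N + 1 + 1) (m • d) * H := by
    calc hexagonValue Φ (N + 1 + 1) (c • x) (c • y)
        = emx * ex * F1 * g * ez * (nilExp k (N + 1 + 1) (m • z) * (F2 * (b * ey : Qˣ))) *
            nilExp k (N + 1 + 1) (m • y) * f.eval (N + 1 + 1) X y * a := by
          rw [hL, hemx]; simp only [mul_assoc, Units.val_mul]
      _ = emx * ex * (F1 * (g * ez * (b * ey) : Qˣ)) * nilExp k (N + 1 + 1) (m • Z) * f.eval (N + 1 + 1) y Z *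
            nilExp k (N + 1 + 1) (m • y) * f.eval (N + 1 + 1) X y * a := by
          rw [← s2.eq, ← mul_assoc (nilExp k (N + 1 + 1) (m • z)), ← sz]
          simp only [mul_assoc, Units.val_mul]
      _ = emx * ex * (g * ez * (b * ey) : Qˣ) * (f.eval (N + 1 + 1) Z X * nilExp k (N + 1 + 1) (m • Z) *
            f.eval (N + 1 + 1) y Z * nilExp k (N + 1 + 1) (m • y) * f.eval (N + 1 + 1) X y * a) := by
          rw [← sW.eq]; simp only [mul_assoc]
      _ = nilExp k (N + 1 + 1) (m • d) * (emx * (ex * g * ez * b * ey * a) * emx⁻¹ : Qˣ) := by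
          rw [hP, mul_assoc (nilExp k (N + 1 + 1) (m • d)), ← mul_assoc _ (nilExp k _ _),
            ← (hcD _).eq]
          simp only [mul_assoc, Units.val_mul]
      _ = nilExp k (N + 1 + 1) (m • d) * H := by
          rw [hH, (cH emx).symm.eq, mul_inv_cancel_right]
  rw [hfin, nilExp_of_mem_pow hI (Ideal.smul_mem_of_algebra _ _ hdm), hHe, add_mul, one_mul,
    (mul_eq_of_sub_one_mem hI _ (Ideal.smul_mem_of_algebra _ _ hdm)).2, hd]
  rwa [add_sub_cancel_left]

end HexagonScale

section HexagonTheorem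

variable {k : Type*} [Field k]

lemma hexagonValue_sub_one_mem {Q : Type*} [Ring Q] [Algebra k Q] {Φ : NCSeries k} {N : ℕ}
    (h : hexagonValue Φ N (varX k N) (varY k N) = 1) {I : Ideal Q} [I.IsTwoSided] {x y : Q}
    (hx : x ∈ I) (hy : y ∈ I) : hexagonValue Φ (N + 1) x y - 1 ∈ I ^ N := by
  refine sub_mem_of_mk_eq (k := k) ?_
  have hz : -(x + y) ∈ I := I.neg_mem (I.add_mem hx hy)
  have hsm : ∀ (r : k) {q : Q}, q ∈ I → r • q ∈ I := fun r q hq => I.smul_mem_of_algebra r hq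
  have := assocHexagon_of_eq (I := I.map (Ideal.Quotient.mk (I ^ N)))
    (Ideal.map_mk_pow_eq_bot le_rfl) h (Ideal.mem_map_of_mem _ hx) (Ideal.mem_map_of_mem _ hy)
  simp only [hexagonValue, map_mul, map_one, mk_nilExp (hsm _ hx), mk_nilExp (hsm _ hy),
    mk_nilExp (hsm _ hz), NCSeries.mk_eval Φ hz hx, NCSeries.mk_eval Φ hy hz,
    NCSeries.mk_eval Φ hx hy]
  simp only [map_smul, map_neg, map_add]
  exact this

variable [CharZero k]

/-- Without linear terms `Φ` is `1` here, and the three exponents sum to zero. Degree one needs this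
separate argument because `e + e'` is scaled by `c` there. -/
lemma hexagonValue_two {Q : Type*} [Ring Q] [Algebra k Q] {Φ : NCSeries k} (hΦ : Φ [] = 1)
    (h0 : Φ [0] = 0) (h1 : Φ [1] = 0) {I : Ideal Q} (hI : I ^ 2 = ⊥) {x y : Q} (hx : x ∈ I)
    (hy : y ∈ I) : hexagonValue Φ 2 x y = 1 := by
  have hsm : ∀ (r : k) {q : Q}, q ∈ I → r • q ∈ I := fun r q hq => I.smul_mem_of_algebra r hq
  have hz : -(x + y) ∈ I := I.neg_mem (I.add_mem hx hy)
  simp only [hexagonValue, NCSeries.eval_two, hΦ, h0, h1, one_smul, zero_smul, add_zero, mul_one]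
  rw [← nilExp_add k _ hI (hsm _ hx) (hsm _ hz), ← smul_add, ← nilExp_add k _ hI
    (hsm _ (I.add_mem hx hz)) (hsm _ hy), ← smul_add, show x + -(x + y) + y = 0 by abel, smul_zero,
    nilExp_zero_right k 1]
  all_goals
    have hmul : ∀ {p q : Q}, p ∈ I → q ∈ I → p * q = 0 := fun {p q} hp hq => by
      exact Ideal.mul_eq_zero_of_mem_pow (N := 1) hI (by rwa [Submodule.pow_one]) hq
    rw [Commute, SemiconjBy, hmul, hmul]
    all_goals
      refine hsm _ ?_
      first
        | exact hx
        | exact hy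
        | exact hz
        | exact I.add_mem hx hz

lemma FixedUpToRescaling.assocHexagon {c : k} (hc0 : c ≠ 0) (hc : ∀ n : ℕ, 0 < n → c ^ n ≠ 1)
    {f Φ : NCSeries k} (hf : GTHexagon c f) (hf0 : f [0] = 0) (hf1 : f [1] = 0) (hΦ : Φ [] = 1)
    (h0 : Φ [0] = 0) (h1 : Φ [1] = 0) (hanti : Antisymmetry Φ) (h : FixedUpToRescaling c f Φ) :
    AssocHexagon 1 Φ := by
  intro N
  change hexagonValue Φ N (varX k N) (varY k N) = 1
  induction N with
  | zero => exact (subsingleton_augTrunc_zero _).elim _ _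
  | succ N ih =>
    have hI : truncIdeal (freeAug k) (N + 1) ^ (N + 1) = ⊥ := truncIdeal_pow _ _
    have hx := varX_mem (k := k) (N + 1)
    have hy := varY_mem (k := k) (N + 1)
    rcases N with _ | _ | N
    · simp [hexagonValue, NCSeries.eval_one, nilExp, hΦ]
    · exact hexagonValue_two hΦ h0 h1 hI hx hy
    obtain ⟨G, hGx, hGy, hG⟩ := exists_free_scale c (N + 1 + 1)
    have he := hexagonValue_sub_one_mem ih hx hy
    have he' := hexagonValue_sub_one_mem ih hy hx
    have hQ := exists_sub_mem_truncIdeal (k := k) (ε := freeAug k) (N := N + 1 + 1 + 1)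
    have s := hexagonValue_smul hf hf0 hf1 hΦ hanti h hI hQ hx hy he he'
    have s' := hexagonValue_smul hf hf0 hf1 hΦ hanti h hI hQ hy hx he' he
    have g := hG _ he
    have g' := hG _ he'
    rw [map_sub, map_one, hexagonValue_map, hGx, hGy, s] at g
    rw [map_sub, map_one, hexagonValue_map, hGx, hGy, s'] at g'
    set e := hexagonValue Φ (N + 1 + 1 + 1) (varX k (N + 1 + 1 + 1))
      (varY k (N + 1 + 1 + 1)) - 1 with hedef
    set e' := hexagonValue Φ (N + 1 + 1 + 1) (varY k (N + 1 + 1 + 1))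
      (varX k (N + 1 + 1 + 1)) - 1 with hedef'
    rw [add_sub_right_comm, ← hedef] at g
    rw [add_sub_right_comm, ← hedef', add_comm e' e] at g'
    -- The degree is `N + 2`. The two recursions add up to `c ^ (N + 2) • (e + e') = c • (e + e')`;
    -- cancelling `c` leaves the positive exponent `N + 1`.
    have hsum : e + e' = 0 := by
      refine eq_zero_of_smul_eq (hc (N + 1) N.succ_pos) ?_
      have key : c • c ^ (N + 1) • (e + e') = c • (e + e') := by
        rw [smul_smul, ← pow_succ', smul_add, ← g, ← g']
        have h2 : ((c - 1) / 2) • (e + e') + ((c - 1) / 2) • (e + e') = c • (e + e') - (e + e') := by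
          rw [← add_smul, add_halves, sub_smul, one_smul]
        rw [add_add_add_comm, h2, add_sub_cancel]
      exact smul_right_injective _ hc0 key
    rw [hsum, smul_zero, add_zero] at g
    exact sub_eq_zero.1 (eq_zero_of_smul_eq (hc _ (Nat.succ_pos _)) g.symm)

end HexagonTheorem

/-! ### From infinitesimal braids to pure braids -/

section BraidCalculus

lemma Commute.conj_conj {G : Type*} [Group G] {g h : G} (H : Commute g h) (u : G) :
    Commute (u⁻¹ * g * u) (u⁻¹ * h * u) := by
  have := H.eq
  rw [Commute, SemiconjBy]
  calc u⁻¹ * g * u * (u⁻¹ * h * u) = u⁻¹ * (g * h) * u := by group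
    _ = u⁻¹ * h * u * (u⁻¹ * g * u) := by rw [this]; group

lemma Commute.inv_mul_mul {G : Type*} [Group G] {g u : G} (H : Commute g u) : u⁻¹ * g * u = g := by
  rw [mul_assoc, H.eq, inv_mul_cancel_left]

/-- Both orientations of the hexagon have the value `hw`, so they express `a * hx` and `hx * a⁻¹`
through the other factors; their product is the conjugated exponential. -/
lemma conj_eq_of_hexagon {G : Type*} [Group G] {a b c hx hy hz hw hxy : G}
    (H : hx * c * hz * b * hy * a = hw) (H' : hy * b⁻¹ * hz * c⁻¹ * hx * a⁻¹ = hw)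
    (ca : Commute hw a) (cb : Commute hw b) (cy : Commute hw hy) (h1 : hxy * hz = hw)
    (h2 : Commute hxy hz) :
    a * (hx * hx) * a⁻¹ = hy⁻¹ * b⁻¹ * (hxy * hxy) * b * hy⁻¹ := by
  have e1 : a * hx = hw * hy⁻¹ * b⁻¹ * hz⁻¹ * c⁻¹ := by
    have h' : a * (hx * c * hz * b * hy) = hw := by
      rw [← mul_left_inj a, mul_assoc, H, ca.eq]
    rw [← h']; group
  have e2 : hx * a⁻¹ = c * hz⁻¹ * b * hy⁻¹ * hw := by rw [← H']; group
  have e3 : hw * hz⁻¹ = hxy := by rw [← h1]; group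
  have e4 : hz⁻¹ * hw = hxy := by rw [← h1, h2.eq]; group
  calc a * (hx * hx) * a⁻¹ = (a * hx) * (hx * a⁻¹) := by group
    _ = (hw * (hy⁻¹ * b⁻¹)) * hz⁻¹ * hz⁻¹ * ((b * hy⁻¹) * hw) := by rw [e1, e2]; group
    _ = hy⁻¹ * b⁻¹ * (hw * hz⁻¹) * (hz⁻¹ * hw) * (b * hy⁻¹) := by
      rw [(cy.inv_right.mul_right cb.inv_right).eq, ← (cb.mul_right cy.inv_right).eq]; group
    _ = _ := by rw [e3, e4]; group

/-- Exponentials of halves of vectors and values of an associator, in an abstract group. -/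
structure AssociatorCalculus (V G : Type*) [AddCommGroup V] [Group G] where
  comm : V → V → Prop
  comm_refl : ∀ x, comm x x
  comm_symm : ∀ {x y}, comm x y → comm y x
  comm_add : ∀ {x y z}, comm x y → comm x z → comm x (y + z)
  comm_sub : ∀ {x y z}, comm x y → comm x z → comm x (y - z)
  half : V → G
  assoc : V → V → G
  half_add : ∀ {x y}, comm x y → half (x + y) = half x * half y
  half_assoc : ∀ {x y z}, comm x y → comm x z → Commute (half x) (assoc y z)
  assoc_swap : ∀ x y, assoc y x = (assoc x y)⁻¹
  hexagon : ∀ {x y z}, comm (x + y + z) x → comm (x + y + z) y →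
    half x * assoc z x * half z * assoc y z * half y * assoc x y = half (x + y + z)

namespace AssociatorCalculus

variable {V G : Type*} [AddCommGroup V] [Group G] (C : AssociatorCalculus V G) {x y z : V}

/-- `half x` stands for `e^{x/2}`, the exponential that occurs in the hexagon. -/
def exp (x : V) : G := C.half x * C.half x

variable {C}

lemma commute_half (h : C.comm x y) : Commute (C.half x) (C.half y) := by
  rw [Commute, SemiconjBy, ← C.half_add h, ← C.half_add (C.comm_symm h), add_comm]

lemma exp_half (h : C.comm x y) : Commute (C.exp x) (C.half y) :=
  (commute_half h).mul_left (commute_half h)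

lemma exp_exp (h : C.comm x y) : Commute (C.exp x) (C.exp y) :=
  (exp_half h).mul_right (exp_half h)

lemma exp_assoc (h : C.comm x y) (h' : C.comm x z) : Commute (C.exp x) (C.assoc y z) :=
  (C.half_assoc h h').mul_left (C.half_assoc h h')

lemma exp_add (h : C.comm x y) : C.exp (x + y) = C.exp x * C.exp y := by
  rw [exp, C.half_add h, exp, exp, mul_assoc, ← mul_assoc (C.half y), ← (commute_half h).eq]
  simp only [mul_assoc]

lemma conj_exp (hx : C.comm (x + y + z) x) (hy : C.comm (x + y + z) y) :
    C.assoc x y * C.exp x * (C.assoc x y)⁻¹ =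
      (C.half y)⁻¹ * C.assoc z y * C.exp (x + y) * (C.assoc z y)⁻¹ * (C.half y)⁻¹ := by
  have hz : C.comm (x + y + z) z := by
    have := C.comm_sub (C.comm_refl (x + y + z)) (C.comm_add hx hy)
    rwa [add_sub_cancel_left] at this
  have hxyz : C.comm (x + y) z := by
    have := C.comm_sub (C.comm_symm (C.comm_add hx hy)) (C.comm_refl (x + y))
    rwa [add_sub_cancel_left] at this
  have H := C.hexagon hx hy
  have H' := C.hexagon (x := y) (y := x) (z := z) (by rwa [add_comm y x]) (by rwa [add_comm y x])
  rw [add_comm y x, C.assoc_swap y z, C.assoc_swap z x, C.assoc_swap x y] at H'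
  rw [C.assoc_swap y z, inv_inv]
  exact conj_eq_of_hexagon H H' (C.half_assoc hx hy) (C.half_assoc hy hz) (commute_half hy)
    (C.half_add hxyz).symm (commute_half hxyz)

/-- A braid generator of non-adjacent strands arises as a quotient of a double twist by a twist. The
hexagon turns such a quotient into a conjugate of a single exponential, from which commutation
relations can be read. -/
lemma conj_exp_inv_mul (hx : C.comm (x + y + z) x) (hy : C.comm (x + y + z) y) :
    (C.assoc x y * C.exp x * (C.assoc x y)⁻¹)⁻¹ * C.exp (x + z) =
      C.half y * C.assoc z y * C.exp z * (C.assoc z y)⁻¹ * (C.half y)⁻¹ := by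
  have hz : C.comm (x + y + z) z := by
    have := C.comm_sub (C.comm_refl (x + y + z)) (C.comm_add hx hy)
    rwa [add_sub_cancel_left] at this
  have hxyz : C.comm (x + y) z := by
    have := C.comm_sub (C.comm_symm (C.comm_add hx hy)) (C.comm_refl (x + y))
    rwa [add_sub_cancel_left] at this
  have hxzy : C.comm (x + z) y := by
    have := C.comm_sub (C.comm_symm hy) (C.comm_refl y)
    rw [show x + y + z - y = x + z by abel] at this
    exact C.comm_symm this
  have e1 : C.exp (x + z) = C.exp (x + y + z) * (C.half y)⁻¹ * (C.half y)⁻¹ := by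
    rw [show x + y + z = x + z + y by abel, exp_add hxzy, exp.eq_1 C y]; group
  rw [conj_exp hx hy, e1]
  calc _ = C.half y * C.assoc z y * (C.exp (x + y))⁻¹ *
        (((C.assoc z y)⁻¹ * C.half y) * C.exp (x + y + z)) * (C.half y)⁻¹ * (C.half y)⁻¹ := by group
    _ = C.half y * C.assoc z y * (C.exp (x + y))⁻¹ *
        (C.exp (x + y + z) * ((C.assoc z y)⁻¹ * C.half y)) * (C.half y)⁻¹ * (C.half y)⁻¹ := by
      rw [((exp_assoc hz hy).inv_right.mul_right (exp_half hy)).eq]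
    _ = _ := by rw [exp_add hxyz]; group

end AssociatorCalculus

/-- Infinitesimal braids on four strands together with an associator that satisfies the pentagon
equation up to central elements, for three orders of the strands. -/
structure BraidCalculus (V G : Type*) [AddCommGroup V] [Group G] extends
    AssociatorCalculus V G where
  (t12 t13 t14 t23 t24 t34 : V)
  comm_12_34 : comm t12 t34
  comm_13_24 : comm t13 t24
  comm_14_23 : comm t14 t23
  comm_12_3 : comm t12 (t13 + t23)
  comm_12_4 : comm t12 (t14 + t24)
  comm_13_2 : comm t13 (t12 + t23)
  comm_13_4 : comm t13 (t14 + t34)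
  comm_23_1 : comm t23 (t12 + t13)
  comm_23_4 : comm t23 (t24 + t34)
  comm_14_2 : comm t14 (t12 + t24)
  comm_14_3 : comm t14 (t13 + t34)
  comm_24_1 : comm t24 (t12 + t14)
  comm_24_3 : comm t24 (t23 + t34)
  comm_34_1 : comm t34 (t13 + t14)
  comm_34_2 : comm t34 (t23 + t24)
  pentagon_1234 : ∀ g : G,
    (assoc t12 (t23 + t24) * assoc (t13 + t23) t34)⁻¹ * g *
      (assoc t12 (t23 + t24) * assoc (t13 + t23) t34) =
    (assoc t23 t34 * assoc (t12 + t13) (t24 + t34) * assoc t12 t23)⁻¹ * g *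
      (assoc t23 t34 * assoc (t12 + t13) (t24 + t34) * assoc t12 t23)
  pentagon_1324 : ∀ g : G,
    (assoc t13 (t23 + t34) * assoc (t12 + t23) t24)⁻¹ * g *
      (assoc t13 (t23 + t34) * assoc (t12 + t23) t24) =
    (assoc t23 t24 * assoc (t12 + t13) (t24 + t34) * assoc t13 t23)⁻¹ * g *
      (assoc t23 t24 * assoc (t12 + t13) (t24 + t34) * assoc t13 t23)
  pentagon_1243 : ∀ g : G,
    (assoc t12 (t23 + t24) * assoc (t14 + t24) t34)⁻¹ * g *
      (assoc t12 (t23 + t24) * assoc (t14 + t24) t34) =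
    (assoc t24 t34 * assoc (t12 + t14) (t23 + t34) * assoc t12 t24)⁻¹ * g *
      (assoc t24 t34 * assoc (t12 + t14) (t23 + t34) * assoc t12 t24)

/-! ### Drinfeld's representation of the pure braid group on four strands. -/

namespace BraidCalculus

open AssociatorCalculus

variable {V G : Type*} [AddCommGroup V] [Group G] (B : BraidCalculus V G)

/-- The base point is the parenthesization `((12)3)4`; associators move it to one where the strands
concerned are bracketed together. The remaining generators are quotients: `X₁₂ X₁₃` comes from `t₁₂
+ t₁₃`, `X₂₄ X₃₄` from `t₂₄ + t₃₄`, and `X₁₄ X₂₄ X₃₄` is the exponential of `t₁₄ + t₂₄ + t₃₄`. -/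
def X12 : G := B.exp B.t12

def X23 : G := (B.assoc B.t12 B.t23)⁻¹ * B.exp B.t23 * B.assoc B.t12 B.t23

def X34 : G := (B.assoc (B.t13 + B.t23) B.t34)⁻¹ * B.exp B.t34 * B.assoc (B.t13 + B.t23) B.t34

def X13 : G :=
  B.X12⁻¹ * ((B.assoc B.t12 B.t23)⁻¹ * B.exp (B.t12 + B.t13) * B.assoc B.t12 B.t23)

def X24X34 : G :=
  (B.assoc (B.t12 + B.t13) (B.t24 + B.t34) * B.assoc B.t12 B.t23)⁻¹ * B.exp (B.t24 + B.t34) *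
    (B.assoc (B.t12 + B.t13) (B.t24 + B.t34) * B.assoc B.t12 B.t23)

def X24 : G := B.X24X34 * B.X34⁻¹

def X14 : G := B.exp (B.t14 + B.t24 + B.t34) * B.X24X34⁻¹

lemma comm_12_13_23 : B.comm B.t12 (B.t12 + B.t13 + B.t23) := by
  rw [add_assoc]; exact B.comm_add (B.comm_refl _) B.comm_12_3

lemma comm_13_12_23 : B.comm B.t13 (B.t12 + B.t13 + B.t23) := by
  rw [add_right_comm]; exact B.comm_add B.comm_13_2 (B.comm_refl _)

lemma comm_23_12_13 : B.comm B.t23 (B.t12 + B.t13 + B.t23) :=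
  B.comm_add B.comm_23_1 (B.comm_refl _)

lemma comm_23_24_34 : B.comm B.t23 (B.t23 + B.t24 + B.t34) := by
  rw [add_assoc]; exact B.comm_add (B.comm_refl _) B.comm_23_4

lemma comm_34_23_24 : B.comm B.t34 (B.t23 + B.t24 + B.t34) :=
  B.comm_add B.comm_34_2 (B.comm_refl _)

lemma comm_12_14_24_34 : B.comm B.t12 (B.t14 + B.t24 + B.t34) :=
  B.comm_add B.comm_12_4 B.comm_12_34

lemma comm_13_14_24_34 : B.comm B.t13 (B.t14 + B.t24 + B.t34) := by
  rw [add_right_comm]; exact B.comm_add B.comm_13_4 B.comm_13_24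

lemma comm_23_14_24_34 : B.comm B.t23 (B.t14 + B.t24 + B.t34) := by
  rw [add_assoc]; exact B.comm_add (B.comm_symm B.comm_14_23) B.comm_23_4

/-- The sum `t₁₂ + t₁₃ + t₂₃` commutes with `t₁₂` and `t₂₃`, so its exponential is unchanged by
conjugation with the associator. -/
lemma X13_mul_X23 : B.X13 * B.X23 = B.exp (B.t13 + B.t23) := by
  have h1 : B.exp (B.t12 + B.t13) * B.exp B.t23 = B.exp B.t12 * B.exp (B.t13 + B.t23) := by
    rw [← exp_add B.comm_12_3, ← exp_add (B.comm_symm B.comm_23_1), add_assoc]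
  have h2 := (exp_assoc (B.comm_symm B.comm_12_13_23) (B.comm_symm B.comm_23_12_13)).inv_mul_mul
  rw [add_assoc, exp_add B.comm_12_3, ← h1] at h2
  calc B.X13 * B.X23 = (B.exp B.t12)⁻¹ * ((B.assoc B.t12 B.t23)⁻¹ *
        (B.exp (B.t12 + B.t13) * B.exp B.t23) * B.assoc B.t12 B.t23) := by
        rw [X13, X23, X12]; group
    _ = _ := by rw [h2, h1]; group

lemma X12_mul_X13_mul_X23 : B.X12 * B.X13 * B.X23 = B.exp (B.t12 + B.t13 + B.t23) := by
  rw [mul_assoc, X13_mul_X23, X12, ← exp_add B.comm_12_3, add_assoc]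

lemma commute_X12_X34 : Commute B.X12 B.X34 := by
  have h := exp_assoc B.comm_12_3 B.comm_12_34
  exact (h.inv_right.mul_right (exp_exp B.comm_12_34)).mul_right h

/-- The pentagon replaces the route through `(12)(34)` by the one through `(1(23))4` and `1((23)4)`,
which is the route used for `X₂₄ X₃₄`. Only conjugation by the pentagon occurs. -/
lemma X34_eq : B.X34 = (B.assoc (B.t12 + B.t13) (B.t24 + B.t34) * B.assoc B.t12 B.t23)⁻¹ *
    ((B.assoc B.t23 B.t34)⁻¹ * B.exp B.t34 * B.assoc B.t23 B.t34) *
    (B.assoc (B.t12 + B.t13) (B.t24 + B.t34) * B.assoc B.t12 B.t23) := by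
  have h := (exp_assoc (B.comm_symm B.comm_12_34) B.comm_34_2).inv_mul_mul
  have h' := B.pentagon_1234 (B.exp B.t34)
  calc B.X34 = (B.assoc (B.t13 + B.t23) B.t34)⁻¹ * ((B.assoc B.t12 (B.t23 + B.t24))⁻¹ *
        B.exp B.t34 * B.assoc B.t12 (B.t23 + B.t24)) * B.assoc (B.t13 + B.t23) B.t34 := by
        rw [h, X34]
    _ = _ := by rw [mul_inv_rev] at h'; simp only [mul_assoc, mul_inv_rev] at h' ⊢; exact h'

lemma X23_eq : B.X23 = (B.assoc (B.t12 + B.t13) (B.t24 + B.t34) * B.assoc B.t12 B.t23)⁻¹ *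
    B.exp B.t23 * (B.assoc (B.t12 + B.t13) (B.t24 + B.t34) * B.assoc B.t12 B.t23) := by
  have h := (exp_assoc B.comm_23_1 B.comm_23_4).inv_mul_mul
  calc B.X23 = (B.assoc B.t12 B.t23)⁻¹ * ((B.assoc (B.t12 + B.t13) (B.t24 + B.t34))⁻¹ *
        B.exp B.t23 * B.assoc (B.t12 + B.t13) (B.t24 + B.t34)) * B.assoc B.t12 B.t23 := by
        rw [h, X23]
    _ = _ := by group

lemma commute_X23_X24X34 : Commute B.X23 B.X24X34 := by
  rw [X23_eq, X24X34]
  exact (exp_exp B.comm_23_4).conj_conj _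

/-- On the route through `1((23)4)` the product is a conjugate of the exponential of `t₂₃ + t₂₄ +
t₃₄`, which commutes with the associator of strands 2, 3, 4; the pentagon then changes the route to
the one used for `X₃₄`. -/
lemma X23_mul_X24X34 : B.X23 * B.X24X34 =
    (B.assoc B.t12 (B.t23 + B.t24) * B.assoc (B.t13 + B.t23) B.t34)⁻¹ *
      B.exp (B.t23 + B.t24 + B.t34) *
      (B.assoc B.t12 (B.t23 + B.t24) * B.assoc (B.t13 + B.t23) B.t34) := by
  have h := (exp_assoc (B.comm_symm B.comm_23_24_34) (B.comm_symm B.comm_34_23_24)).inv_mul_mul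
  rw [B.pentagon_1234, X23_eq, X24X34]
  calc _ = (B.assoc (B.t12 + B.t13) (B.t24 + B.t34) * B.assoc B.t12 B.t23)⁻¹ *
      (B.exp B.t23 * B.exp (B.t24 + B.t34)) *
      (B.assoc (B.t12 + B.t13) (B.t24 + B.t34) * B.assoc B.t12 B.t23) := by group
    _ = (B.assoc (B.t12 + B.t13) (B.t24 + B.t34) * B.assoc B.t12 B.t23)⁻¹ *
      ((B.assoc B.t23 B.t34)⁻¹ * B.exp (B.t23 + B.t24 + B.t34) * B.assoc B.t23 B.t34) *
      (B.assoc (B.t12 + B.t13) (B.t24 + B.t34) * B.assoc B.t12 B.t23) := by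
      rw [h, ← exp_add B.comm_23_4, add_assoc]
    _ = _ := by group

lemma commute_exp_234_assoc : Commute (B.exp B.t34)
    ((B.assoc B.t12 (B.t23 + B.t24))⁻¹ * B.exp (B.t23 + B.t24 + B.t34) *
      B.assoc B.t12 (B.t23 + B.t24)) := by
  have h := exp_assoc (B.comm_symm B.comm_12_34) B.comm_34_2
  exact (h.inv_right.mul_right (exp_exp B.comm_34_23_24)).mul_right h

/-- `X₃₄` commutes with `X₂₃ X₂₄ X₃₄`. -/
lemma commute_X34_X23_mul_X24X34 : Commute B.X34 (B.X23 * B.X24X34) := by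
  have h := B.commute_exp_234_assoc.conj_conj (B.assoc (B.t13 + B.t23) B.t34)
  rw [X23_mul_X24X34, X34]
  convert h using 1
  group

lemma X23_mul_X24 : B.X23 * B.X24 =
    (B.assoc B.t12 (B.t23 + B.t24) * B.assoc (B.t13 + B.t23) B.t34)⁻¹ * B.exp (B.t23 + B.t24) *
      (B.assoc B.t12 (B.t23 + B.t24) * B.assoc (B.t13 + B.t23) B.t34) := by
  have h := (exp_assoc (B.comm_symm B.comm_12_34) B.comm_34_2).inv_mul_mul
  rw [X24, ← mul_assoc, X23_mul_X24X34, exp_add (B.comm_symm B.comm_34_2), X34]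
  nth_rewrite 2 [← h]
  group

/-- `X₁₃` is conjugate to `exp t₁₃`. -/
lemma X13_eq : B.X13 =
    ((B.assoc B.t12 B.t23)⁻¹ * B.half B.t23 * B.assoc B.t13 B.t23) * B.exp B.t13 *
      ((B.assoc B.t12 B.t23)⁻¹ * B.half B.t23 * B.assoc B.t13 B.t23)⁻¹ := by
  have h1 := B.comm_symm B.comm_12_13_23
  have h2 := B.comm_symm B.comm_23_12_13
  rw [add_right_comm] at h1 h2
  have h := conj_exp_inv_mul h1 h2
  rw [X13, X12]
  calc _ = (B.assoc B.t12 B.t23)⁻¹ *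
        ((B.assoc B.t12 B.t23 * B.exp B.t12 * (B.assoc B.t12 B.t23)⁻¹)⁻¹ * B.exp (B.t12 + B.t13)) *
        B.assoc B.t12 B.t23 := by group
    _ = _ := by rw [h]; group

/-- `X₃₄⁻¹ X₂₄ X₃₄` is conjugate to `exp t₂₄`. -/
lemma X34_inv_mul_X24X34 : B.X34⁻¹ * B.X24X34 =
    ((B.assoc B.t12 B.t23)⁻¹ * B.half B.t23 * B.assoc B.t13 B.t23) *
      ((B.assoc (B.t12 + B.t23) B.t24)⁻¹ * B.exp B.t24 * B.assoc (B.t12 + B.t23) B.t24) *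
      ((B.assoc B.t12 B.t23)⁻¹ * B.half B.t23 * B.assoc B.t13 B.t23)⁻¹ := by
  have h1 := B.comm_symm B.comm_34_23_24
  have h2 := B.comm_symm B.comm_23_24_34
  rw [show B.t23 + B.t24 + B.t34 = B.t34 + B.t23 + B.t24 by abel] at h1 h2
  have h := conj_exp_inv_mul h1 h2
  have hs := (exp_assoc (B.comm_symm B.comm_13_24) B.comm_24_3).inv_mul_mul
  have ha : Commute (B.half B.t23) (B.assoc (B.t12 + B.t13) (B.t24 + B.t34)) :=
    B.half_assoc B.comm_23_1 B.comm_23_4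
  have hp := B.pentagon_1324 (B.exp B.t24)
  -- The pentagon for the order 1, 3, 2, 4, in which 1, 3 and 2, 4 are adjacent pairs. It brings
  -- `t₂₄` to the conjugator already found for `X₁₃`, reducing their commutation to that of `t₁₃`
  -- and `t₂₄`.
  have hp' : (B.assoc (B.t12 + B.t23) B.t24)⁻¹ * B.exp B.t24 * B.assoc (B.t12 + B.t23) B.t24 =
      (B.assoc B.t23 B.t24 * B.assoc (B.t12 + B.t13) (B.t24 + B.t34) * B.assoc B.t13 B.t23)⁻¹ *
        B.exp B.t24 *
        (B.assoc B.t23 B.t24 * B.assoc (B.t12 + B.t13) (B.t24 + B.t34) * B.assoc B.t13 B.t23) := by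
    rw [← hp]
    nth_rewrite 1 [← hs]
    group
  rw [B.assoc_swap B.t23 B.t34, B.assoc_swap B.t23 B.t24, add_comm B.t34 B.t24] at h
  rw [hp', X34_eq, X24X34]
  calc _ = (B.assoc (B.t12 + B.t13) (B.t24 + B.t34) * B.assoc B.t12 B.t23)⁻¹ *
      (((B.assoc B.t23 B.t34)⁻¹ * B.exp B.t34 * (B.assoc B.t23 B.t34)⁻¹⁻¹)⁻¹ *
        B.exp (B.t24 + B.t34)) *
      (B.assoc (B.t12 + B.t13) (B.t24 + B.t34) * B.assoc B.t12 B.t23) := by group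
    _ = (B.assoc B.t12 B.t23)⁻¹ * ((B.assoc (B.t12 + B.t13) (B.t24 + B.t34))⁻¹ * B.half B.t23) *
      ((B.assoc B.t23 B.t24)⁻¹ * B.exp B.t24 * B.assoc B.t23 B.t24) *
      ((B.half B.t23)⁻¹ * B.assoc (B.t12 + B.t13) (B.t24 + B.t34)) * B.assoc B.t12 B.t23 := by
      rw [h]; group
    _ = _ := by rw [← ha.inv_right.eq, ha.inv_left.eq]; group

/-- `X₁₃` commutes with `X₃₄⁻¹ X₂₄ X₃₄`. -/
lemma commute_X13_X34_inv_mul_X24X34 : Commute B.X13 (B.X34⁻¹ * B.X24X34) := by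
  have h := exp_assoc B.comm_13_2 B.comm_13_24
  have h' := ((h.inv_right.mul_right (exp_exp B.comm_13_24)).mul_right h).conj_conj
    ((B.assoc B.t12 B.t23)⁻¹ * B.half B.t23 * B.assoc B.t13 B.t23)⁻¹
  rw [X34_inv_mul_X24X34, X13_eq]
  simpa only [inv_inv] using h'

/-- `X₂₄` is conjugate to `exp t₂₄`. -/
lemma X24_eq : B.X24 = (B.assoc B.t12 (B.t23 + B.t24) * B.assoc (B.t13 + B.t23) B.t34)⁻¹ *
    (B.half B.t34 * (B.assoc B.t24 B.t34 * B.exp B.t24 * (B.assoc B.t24 B.t34)⁻¹) *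
      (B.half B.t34)⁻¹) *
    (B.assoc B.t12 (B.t23 + B.t24) * B.assoc (B.t13 + B.t23) B.t34) := by
  have h1 := B.comm_symm B.comm_23_24_34
  have h2 := B.comm_symm B.comm_34_23_24
  have hp := exp_assoc (B.comm_symm B.comm_23_24_34) (B.comm_symm B.comm_34_23_24)
  have hs := (exp_assoc (B.comm_symm B.comm_12_34) B.comm_34_2).inv_mul_mul
  rw [add_right_comm] at h1 h2
  have h := conj_exp_inv_mul h1 h2
  have e : B.assoc B.t23 B.t34 * B.exp (B.t24 + B.t34) * (B.assoc B.t23 B.t34)⁻¹ *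
      (B.exp B.t34)⁻¹ = (B.assoc B.t23 B.t34 * B.exp B.t23 * (B.assoc B.t23 B.t34)⁻¹)⁻¹ *
        B.exp (B.t23 + B.t24) := by
    have e1 : B.exp (B.t24 + B.t34) = (B.exp B.t23)⁻¹ * B.exp (B.t23 + B.t24 + B.t34) := by
      rw [add_assoc, exp_add B.comm_23_4]; group
    have e2 : B.exp (B.t23 + B.t24) = B.exp (B.t23 + B.t24 + B.t34) * (B.exp B.t34)⁻¹ := by
      rw [exp_add (B.comm_symm B.comm_34_2)]; group
    calc _ = B.assoc B.t23 B.t34 * (B.exp B.t23)⁻¹ * (B.exp (B.t23 + B.t24 + B.t34) *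
          (B.assoc B.t23 B.t34)⁻¹) * (B.exp B.t34)⁻¹ := by rw [e1]; group
      _ = _ := by rw [hp.inv_right.eq, e2]; group
  calc B.X24 = (B.assoc B.t23 B.t34 * B.assoc (B.t12 + B.t13) (B.t24 + B.t34) *
        B.assoc B.t12 B.t23)⁻¹ * (B.assoc B.t23 B.t34 * B.exp (B.t24 + B.t34) *
        (B.assoc B.t23 B.t34)⁻¹ * (B.exp B.t34)⁻¹) * (B.assoc B.t23 B.t34 *
        B.assoc (B.t12 + B.t13) (B.t24 + B.t34) * B.assoc B.t12 B.t23) := by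
        rw [X24, X34_eq, X24X34]; group
    _ = _ := by rw [e, h, ← B.pentagon_1234]; simp only [mul_assoc]

/-- `X₂₄` commutes with `X₃₄ X₁₃ X₂₃`. -/
lemma commute_X24_X34_mul_exp : Commute B.X24 (B.X34 * B.exp (B.t13 + B.t23)) := by
  have hA12 : B.comm B.t12 (B.t13 + B.t23 + B.t34) := B.comm_add B.comm_12_3 B.comm_12_34
  have hA24 : B.comm B.t24 (B.t13 + B.t23 + B.t34) := by
    rw [add_assoc]; exact B.comm_add (B.comm_symm B.comm_13_24) B.comm_24_3
  have h1 : B.comm (B.t13 + B.t23 + B.t34 + (B.t14 + B.t24)) (B.t13 + B.t23) := by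
    refine B.comm_symm ?_
    rw [show B.t13 + B.t23 + B.t34 + (B.t14 + B.t24) =
      B.t13 + B.t23 + (B.t14 + B.t24 + B.t34) by abel]
    exact B.comm_add (B.comm_refl _) (B.comm_symm
      (B.comm_add (B.comm_symm B.comm_13_14_24_34) (B.comm_symm B.comm_23_14_24_34)))
  have h2 : B.comm (B.t13 + B.t23 + B.t34 + (B.t14 + B.t24)) B.t34 := by
    refine B.comm_symm ?_
    rw [show B.t13 + B.t23 + B.t34 + (B.t14 + B.t24) =
      B.t13 + B.t14 + (B.t23 + B.t24) + B.t34 by abel]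
    exact B.comm_add (B.comm_add B.comm_34_1 B.comm_34_2) (B.comm_refl _)
  -- The hexagon for the three blocks `t₁₃ + t₂₃`, `t₃₄`, `t₁₄ + t₂₄`, with strands 1 and 2 treated
  -- as one.
  have h := conj_exp h1 h2
  have hs' : Commute (B.half B.t34) (B.assoc B.t12 (B.t23 + B.t24)) :=
    B.half_assoc (B.comm_symm B.comm_12_34) B.comm_34_2
  have ha := exp_assoc B.comm_24_1 B.comm_24_3
  have hq := (exp_assoc (B.comm_symm hA12) (B.comm_symm hA24)).symm.mul_inv_cancel
  -- The pentagon for the order 1, 2, 4, 3, stated for conjugation in the opposite direction.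
  have hconj : ∀ g : G, (B.assoc B.t12 (B.t23 + B.t24) * B.assoc (B.t14 + B.t24) B.t34) * g *
      (B.assoc B.t12 (B.t23 + B.t24) * B.assoc (B.t14 + B.t24) B.t34)⁻¹ =
      (B.assoc B.t24 B.t34 * B.assoc (B.t12 + B.t14) (B.t23 + B.t34) * B.assoc B.t12 B.t24) * g *
      (B.assoc B.t24 B.t34 * B.assoc (B.t12 + B.t14) (B.t23 + B.t34) * B.assoc B.t12 B.t24)⁻¹ := by
    intro g
    have := B.pentagon_1243 ((B.assoc B.t24 B.t34 * B.assoc (B.t12 + B.t14) (B.t23 + B.t34) *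
      B.assoc B.t12 B.t24) * g *
      (B.assoc B.t24 B.t34 * B.assoc (B.t12 + B.t14) (B.t23 + B.t34) * B.assoc B.t12 B.t24)⁻¹)
    rw [mul_assoc _ _ (B.assoc B.t24 B.t34 * _ * _), inv_mul_cancel_right,
      inv_mul_cancel_left] at this
    nth_rewrite 1 [← this]
    group
  have e : B.X34 * B.exp (B.t13 + B.t23) =
      (B.assoc B.t12 (B.t23 + B.t24) * B.assoc (B.t13 + B.t23) B.t34)⁻¹ *
      (B.half B.t34 * (B.assoc B.t24 B.t34 * (B.assoc (B.t12 + B.t14) (B.t23 + B.t34) *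
        B.exp (B.t13 + B.t23 + B.t34) * (B.assoc (B.t12 + B.t14) (B.t23 + B.t34))⁻¹) *
        (B.assoc B.t24 B.t34)⁻¹) * (B.half B.t34)⁻¹) *
      (B.assoc B.t12 (B.t23 + B.t24) * B.assoc (B.t13 + B.t23) B.t34) := by
    calc B.X34 * B.exp (B.t13 + B.t23)
        = (B.assoc (B.t13 + B.t23) B.t34)⁻¹ * (B.exp B.t34 * (B.assoc (B.t13 + B.t23) B.t34 *
          B.exp (B.t13 + B.t23) * (B.assoc (B.t13 + B.t23) B.t34)⁻¹)) *
          B.assoc (B.t13 + B.t23) B.t34 := by rw [X34]; group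
      _ = (B.assoc (B.t13 + B.t23) B.t34)⁻¹ * (B.half B.t34 * (B.assoc (B.t14 + B.t24) B.t34 *
          B.exp (B.t13 + B.t23 + B.t34) * (B.assoc (B.t14 + B.t24) B.t34)⁻¹) *
          (B.half B.t34)⁻¹) * B.assoc (B.t13 + B.t23) B.t34 := by
        rw [h, exp.eq_1 _ B.t34]; group
      _ = (B.assoc (B.t13 + B.t23) B.t34)⁻¹ * (B.assoc B.t12 (B.t23 + B.t24))⁻¹ *
          ((B.assoc B.t12 (B.t23 + B.t24) * B.half B.t34) * (B.assoc (B.t14 + B.t24) B.t34 *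
          B.exp (B.t13 + B.t23 + B.t34) * (B.assoc (B.t14 + B.t24) B.t34)⁻¹) *
          ((B.half B.t34)⁻¹ * (B.assoc B.t12 (B.t23 + B.t24))⁻¹)) *
          B.assoc B.t12 (B.t23 + B.t24) * B.assoc (B.t13 + B.t23) B.t34 := by group
      _ = (B.assoc B.t12 (B.t23 + B.t24) * B.assoc (B.t13 + B.t23) B.t34)⁻¹ *
          (B.half B.t34 * ((B.assoc B.t12 (B.t23 + B.t24) * B.assoc (B.t14 + B.t24) B.t34) *
          B.exp (B.t13 + B.t23 + B.t34) * (B.assoc B.t12 (B.t23 + B.t24) *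
          B.assoc (B.t14 + B.t24) B.t34)⁻¹) * (B.half B.t34)⁻¹) *
          (B.assoc B.t12 (B.t23 + B.t24) * B.assoc (B.t13 + B.t23) B.t34) := by
        rw [← hs'.eq, hs'.inv_inv.eq]; group
      _ = _ := by
        rw [hconj]
        nth_rewrite 2 [← hq]
        group
  -- After removal of the common conjugators, the claim is that `t₂₄` commutes with `t₁₂ + t₁₄`,
  -- `t₂₃ + t₃₄` and `t₁₃ + t₂₃ + t₃₄`.
  have hE := ((ha.mul_right (exp_exp hA24)).mul_right ha.inv_right)
  have h3 := (hE.conj_conj ((B.assoc B.t24 B.t34)⁻¹ * (B.half B.t34)⁻¹)).conj_conj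
    (B.assoc B.t12 (B.t23 + B.t24) * B.assoc (B.t13 + B.t23) B.t34)
  rw [e, X24_eq]
  convert h3 using 1 <;> group

/-- The sum of all `t_{i,j}`. -/
def total : V := B.t12 + (B.t14 + B.t24 + B.t34) + (B.t13 + B.t23)

lemma comm_total_12 : B.comm B.total B.t12 :=
  B.comm_symm (B.comm_add (B.comm_add (B.comm_refl _) B.comm_12_14_24_34) B.comm_12_3)

lemma total_eq : B.total = B.t12 + B.t13 + B.t23 + (B.t14 + B.t24 + B.t34) := by
  rw [total]; abel

lemma comm_total_13 : B.comm B.total B.t13 := by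
  rw [total_eq]; exact B.comm_symm (B.comm_add B.comm_13_12_23 B.comm_13_14_24_34)

lemma comm_total_23 : B.comm B.total B.t23 := by
  rw [total_eq]; exact B.comm_symm (B.comm_add B.comm_23_12_13 B.comm_23_14_24_34)

lemma comm_total_24 : B.comm B.total B.t24 := by
  rw [show B.total = B.t12 + B.t14 + B.t24 + (B.t23 + B.t34) + B.t13 by rw [total]; abel]
  exact B.comm_symm (B.comm_add (B.comm_add (B.comm_add B.comm_24_1 (B.comm_refl _)) B.comm_24_3)
    (B.comm_symm B.comm_13_24))

lemma comm_total_34 : B.comm B.total B.t34 := by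
  rw [show B.total = B.t12 + (B.t13 + B.t14) + (B.t23 + B.t24) + B.t34 by rw [total]; abel]
  exact B.comm_symm (B.comm_add (B.comm_add (B.comm_add (B.comm_symm B.comm_12_34) B.comm_34_1)
    B.comm_34_2) (B.comm_refl _))

lemma exp_total : B.exp B.total =
    B.exp B.t12 * B.exp (B.t14 + B.t24 + B.t34) * B.exp (B.t13 + B.t23) := by
  rw [total, exp_add, exp_add B.comm_12_14_24_34]
  exact B.comm_symm (B.comm_add (B.comm_symm B.comm_12_3) (B.comm_symm (B.comm_add
    (B.comm_symm B.comm_13_14_24_34) (B.comm_symm B.comm_23_14_24_34))))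

variable {B} in
lemma commute_exp_X23 {v : V} (h1 : B.comm v B.t12) (h3 : B.comm v B.t23) :
    Commute (B.exp v) B.X23 :=
  ((exp_assoc h1 h3).inv_right.mul_right (exp_exp h3)).mul_right (exp_assoc h1 h3)

variable {B} in
lemma commute_exp_X13 {v : V} (h1 : B.comm v B.t12) (h2 : B.comm v B.t13) (h3 : B.comm v B.t23) :
    Commute (B.exp v) B.X13 :=
  (exp_exp h1).inv_right.mul_right (((exp_assoc h1 h3).inv_right.mul_right
    (exp_exp (B.comm_add h1 h2))).mul_right (exp_assoc h1 h3))

lemma commute_exp_total_X34 : Commute (B.exp B.total) B.X34 := by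
  have h := exp_assoc (B.comm_add B.comm_total_13 B.comm_total_23) B.comm_total_34
  exact (h.inv_right.mul_right (exp_exp B.comm_total_34)).mul_right h

lemma commute_exp_total_X24 : Commute (B.exp B.total) B.X24 := by
  have h := (exp_assoc (B.comm_add B.comm_total_12 B.comm_total_13)
    (B.comm_add B.comm_total_24 B.comm_total_34)).mul_right
      (exp_assoc B.comm_total_12 B.comm_total_23)
  exact ((h.inv_right.mul_right (exp_exp (B.comm_add B.comm_total_24 B.comm_total_34))).mul_right
    h).mul_right B.commute_exp_total_X34.inv_right

lemma X14_mul_X24 : B.X14 * B.X24 = B.exp (B.t14 + B.t24 + B.t34) * B.X34⁻¹ := by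
  rw [X14, X24]; group

lemma X24_mul_X34 : B.X24 * B.X34 = B.X24X34 := inv_mul_cancel_right _ _

lemma X12_mul_X13 : B.X12 * B.X13 =
    (B.assoc B.t12 B.t23)⁻¹ * B.exp (B.t12 + B.t13) * B.assoc B.t12 B.t23 :=
  mul_inv_cancel_left _ _

/-- The images of the standard generators of the pure braid group. -/
def X : Fin 4 → Fin 4 → G :=
  ![![1, B.X12, B.X13, B.X14], ![1, 1, B.X23, B.X24], ![1, 1, 1, B.X34], ![1, 1, 1, 1]]

lemma X_left {i j l : Fin 4} (hij : i < j) (hjl : j < l) :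
    Commute (B.X i j) (B.X i l * B.X j l) := by
  have h : ∀ i j l : Fin 4, i < j → j < l → (i = 0 ∧ j = 1 ∧ l = 2) ∨ (i = 0 ∧ j = 1 ∧ l = 3) ∨
    (i = 0 ∧ j = 2 ∧ l = 3) ∨ (i = 1 ∧ j = 2 ∧ l = 3) := by decide
  obtain ⟨rfl, rfl, rfl⟩ | ⟨rfl, rfl, rfl⟩ | ⟨rfl, rfl, rfl⟩ | ⟨rfl, rfl, rfl⟩ := h i j l hij hjl
  · change Commute B.X12 (B.X13 * B.X23)
    rw [X13_mul_X23]
    exact exp_exp B.comm_12_3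
  · change Commute B.X12 (B.X14 * B.X24)
    rw [X14_mul_X24]
    exact (exp_exp B.comm_12_14_24_34).mul_right B.commute_X12_X34.inv_right
  · change Commute B.X13 (B.X14 * B.X34)
    have e : B.X14 * B.X34 = B.exp (B.t14 + B.t24 + B.t34) * (B.X34⁻¹ * B.X24X34)⁻¹ := by
      rw [X14]; group
    rw [e]
    exact (commute_exp_X13 (B.comm_symm B.comm_12_14_24_34) (B.comm_symm B.comm_13_14_24_34)
      (B.comm_symm B.comm_23_14_24_34)).symm.mul_right
        B.commute_X13_X34_inv_mul_X24X34.inv_right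
  · change Commute B.X23 (B.X24 * B.X34)
    rw [X24_mul_X34]
    exact B.commute_X23_X24X34

lemma X_right {i j l : Fin 4} (hij : i < j) (hjl : j < l) :
    Commute (B.X j l) (B.X i j * B.X i l) := by
  have h : ∀ i j l : Fin 4, i < j → j < l → (i = 0 ∧ j = 1 ∧ l = 2) ∨ (i = 0 ∧ j = 1 ∧ l = 3) ∨
    (i = 0 ∧ j = 2 ∧ l = 3) ∨ (i = 1 ∧ j = 2 ∧ l = 3) := by decide
  obtain ⟨rfl, rfl, rfl⟩ | ⟨rfl, rfl, rfl⟩ | ⟨rfl, rfl, rfl⟩ | ⟨rfl, rfl, rfl⟩ := h i j l hij hjl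
  · change Commute B.X23 (B.X12 * B.X13)
    rw [← mul_inv_cancel_right (B.X12 * B.X13) B.X23, X12_mul_X13_mul_X23]
    exact (commute_exp_X23 (B.comm_symm B.comm_12_13_23)
      (B.comm_symm B.comm_23_12_13)).symm.mul_right (Commute.refl _).inv_right
  · change Commute B.X24 (B.X12 * B.X14)
    -- Dividing the exponential of the total, which commutes with `X₂₄`, by factors commuting with
    -- `X₂₄` isolates the required product.
    have e : B.X12 * B.X14 =
        B.exp B.total * (B.X34 * B.exp (B.t13 + B.t23))⁻¹ * B.X24⁻¹ := by
      rw [exp_total, X14, X12, ← X24_mul_X34]; group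
    rw [e]
    exact (B.commute_exp_total_X24.symm.mul_right B.commute_X24_X34_mul_exp.inv_right).mul_right
      (Commute.refl _).inv_right
  · change Commute B.X34 (B.X13 * B.X14)
    have e1 : B.exp B.total = B.exp (B.t12 + B.t13 + B.t23) * B.exp (B.t14 + B.t24 + B.t34) := by
      rw [total_eq, exp_add]
      exact B.comm_symm (B.comm_add (B.comm_add (B.comm_symm B.comm_12_14_24_34)
        (B.comm_symm B.comm_13_14_24_34)) (B.comm_symm B.comm_23_14_24_34))
    have e : B.X13 * B.X14 = B.X12⁻¹ * B.exp B.total * (B.X23 * B.X24X34)⁻¹ := by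
      have h4 := (commute_exp_X23 (B.comm_symm B.comm_12_14_24_34)
        (B.comm_symm B.comm_23_14_24_34))
      calc B.X13 * B.X14 = B.X12⁻¹ * (B.X12 * B.X13 * B.X23) *
            (B.X23⁻¹ * B.exp (B.t14 + B.t24 + B.t34)) * B.X24X34⁻¹ := by rw [X14]; group
        _ = B.X12⁻¹ * (B.X12 * B.X13 * B.X23) * B.exp (B.t14 + B.t24 + B.t34) *
            (B.X24X34 * B.X23)⁻¹ := by rw [← h4.inv_right.eq]; group
        _ = _ := by rw [X12_mul_X13_mul_X23, ← B.commute_X23_X24X34.eq, e1]; group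
    rw [e]
    exact (B.commute_X12_X34.symm.inv_right.mul_right B.commute_exp_total_X34.symm).mul_right
      B.commute_X34_X23_mul_X24X34.inv_right
  · change Commute B.X34 (B.X23 * B.X24)
    rw [X24, ← mul_assoc]
    exact B.commute_X34_X23_mul_X24X34.mul_right (Commute.refl _).inv_right

lemma lift_X_eq_one : ∀ r ∈ {r | PBRelator 4 r},
    FreeGroup.lift (fun p : PBIndex 4 => B.X p.1.1 p.1.2) r = 1 := by
  have hfree : ∀ {i j : Fin 4} (h : i < j),
      FreeGroup.lift (fun p : PBIndex 4 => B.X p.1.1 p.1.2) (PBIndex.free h) = B.X i j :=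
    fun h => FreeGroup.lift_apply_of
  have h4 : ∀ i j l m : Fin 4, i < j → j < l → l < m → i = 0 ∧ j = 1 ∧ l = 2 ∧ m = 3 := by decide
  rintro _ (⟨hij, hjl⟩ | ⟨hij, hjl⟩ | ⟨hij, hjl, hlm⟩ | ⟨hij, hjl, hlm⟩ | ⟨hij, hjl, hlm⟩) <;>
    simp only [map_commutatorElement, map_mul, map_inv, hfree, commutatorElement_eq_one_iff_commute]
  · exact B.X_left hij hjl
  · exact B.X_right hij hjl
  · obtain ⟨rfl, rfl, rfl, rfl⟩ := h4 _ _ _ _ hij hjl hlm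
    exact B.commute_X12_X34
  · obtain ⟨rfl, rfl, rfl, rfl⟩ := h4 _ _ _ _ hij hjl hlm
    exact (commute_exp_X23 (B.comm_symm B.comm_12_14_24_34)
      (B.comm_symm B.comm_23_14_24_34)).mul_left B.commute_X23_X24X34.symm.inv_left
  · obtain ⟨rfl, rfl, rfl, rfl⟩ := h4 _ _ _ _ hij hjl hlm
    change Commute B.X13 (B.X34⁻¹ * B.X24 * B.X34)
    rw [mul_assoc, X24_mul_X34]
    exact B.commute_X13_X34_inv_mul_X24X34

/-- The homomorphism from the pure braid group on four strands. -/
def pureBraidHom : PureBraidGroup 4 →* G :=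
  PresentedGroup.toGroup B.lift_X_eq_one

lemma pureBraidHom_X {i j : Fin 4} (h : i < j) :
    B.pureBraidHom (PureBraidGroup.X h) = B.X i j :=
  PresentedGroup.toGroup.of B.lift_X_eq_one

end BraidCalculus

end BraidCalculus

/-! ### Realizing the abstract calculus inside an algebra with a nilpotent ideal. -/

section NilpotentCalculus

variable {k : Type*} [Field k] {Q : Type*} [Ring Q] [Algebra k Q] {I : Ideal Q}
  [I.IsTwoSided] {N : ℕ} {Φ : NCSeries k}

/-- The quotient `u * v⁻¹` differs from `1` by a top-degree, hence central, element. -/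
lemma inv_mul_mul_eq_of_sub_mem (hI : I ^ (N + 1) = ⊥)
    (hQ : ∀ q : Q, ∃ r : k, q - algebraMap k Q r ∈ I) {u v : Qˣ} (h : (u : Q) - v ∈ I ^ N) (q : Q) :
    (u⁻¹ : Qˣ) * q * u = (v⁻¹ : Qˣ) * q * v := by
  have hw : Commute ((u * v⁻¹ : Qˣ) : Q) q := by
    have h1 := commute_of_mem_pow hI hQ (Ideal.mul_mem_right ((v⁻¹ : Qˣ) : Q) _ h) q
    rw [sub_mul, Units.mul_inv, ← Units.val_mul] at h1
    simpa using h1.add_left (Commute.one_left q)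
  have hu : u = u * v⁻¹ * v := by group
  have h2 : (((u * v⁻¹)⁻¹ : Qˣ) : Q) * q * (u * v⁻¹ : Qˣ) = q := by
    rw [mul_assoc, ← hw.eq, Units.inv_mul_cancel_left]
  have hu' : ((u⁻¹ : Qˣ) : Q) = (v⁻¹ : Qˣ) * ((u * v⁻¹)⁻¹ : Qˣ) := by
    rw [← Units.val_mul]; congr 1; group
  calc ((u⁻¹ : Qˣ) : Q) * q * u = (v⁻¹ : Qˣ) * (((u * v⁻¹)⁻¹ : Qˣ) * q * (u * v⁻¹ : Qˣ)) * v := by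
        conv_lhs => rw [hu', congrArg Units.val hu, Units.val_mul _ v]
        simp only [mul_assoc]
    _ = _ := by rw [h2]

lemma inv_mul_mul_eq_of_sub_mem' (hI : I ^ (N + 1) = ⊥)
    (hQ : ∀ q : Q, ∃ r : k, q - algebraMap k Q r ∈ I) {u v : Qˣ} (h : (u : Q) - v ∈ I ^ N) (g : Qˣ) :
    u⁻¹ * g * u = v⁻¹ * g * v :=
  Units.ext (inv_mul_mul_eq_of_sub_mem hI hQ h (g : Q))

variable [CharZero k]

lemma exists_associatorCalculus (hΦ : IsGroupLike Φ) (h0 : Φ [0] = 0) (hanti : Antisymmetry Φ)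
    (hhex : AssocHexagon 1 Φ) (hI : I ^ (N + 1) = ⊥) :
    ∃ C : AssociatorCalculus I Qˣ, (∀ x y, C.comm x y ↔ Commute (x : Q) y) ∧
      (∀ x y, (C.assoc x y : Q) = Φ.eval (N + 1) (x : Q) y) ∧
      ∀ x, (C.exp x : Q) = nilExp k (N + 1) (x : Q) := by
  have hsm : ∀ (r : k) (x : I), r • (x : Q) ∈ I := fun r x => I.smul_mem_of_algebra r x.2
  have hassoc : ∀ x y : I, ∃ u : Qˣ, (u : Q) = Φ.eval (N + 1) (x : Q) y := fun x y =>
    NCSeries.isUnit_eval hI hΦ.1 x.2 y.2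
  have hhalf : ∀ x : I, ∃ u : Qˣ, (u : Q) = nilExp k (N + 1) (((1 : k) / 2) • (x : Q)) := fun x =>
    isUnit_nilExp hI (hsm _ x)
  choose F hF using hassoc
  choose E hE using hhalf
  have hadd : ∀ {x y : I}, Commute (x : Q) y → E (x + y) = E x * E y := by
    intro x y h
    refine Units.ext ?_
    rw [Units.val_mul, hE, hE, hE, Submodule.coe_add, smul_add]
    exact nilExp_add k ((h.smul_left _).smul_right _) hI (hsm _ x) (hsm _ y)
  have hEF : ∀ {x y z : I}, Commute (x : Q) y → Commute (x : Q) z → Commute (E x) (F y z) := by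
    intro x y z hy hz
    refine Units.ext ?_
    rw [Units.val_mul, Units.val_mul, hE, hF]
    exact (commute_nilExp k (N + 1)
      (NCSeries.commute_eval (N + 1) Φ (hy.smul_left _) (hz.smul_left _)).symm).eq.symm
  have hEE : ∀ {x y : I}, Commute (x : Q) y → Commute (E x) (E y) := by
    intro x y h
    rw [Commute, SemiconjBy, ← hadd h, ← hadd h.symm, add_comm]
  refine ⟨⟨fun x y => Commute (x : Q) y, fun x => Commute.refl _, fun h => h.symm,
    fun h h' => h.add_right h', fun h h' => h.sub_right h', E, F, hadd, hEF, ?_, ?_⟩,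
    fun x y => Iff.rfl, hF, ?_⟩
  · intro x y
    refine eq_inv_of_mul_eq_one_left (Units.ext ?_)
    rw [Units.val_mul, hF, hF]
    exact hanti.eval_mul hI y.2 x.2
  · intro x y z hx hy
    set w := x + y + z with hw
    have hx' : Commute (w : Q) x := hx
    have hy' : Commute (w : Q) y := hy
    -- The hexagon is known for `x + y + z' = 0`. Here `z` is `z'` plus `w`, which commutes with
    -- everything involved: the associators ignore `w`, and the exponential contributes the factor
    -- `e^{w/2}`.
    obtain ⟨z', hz'⟩ : ∃ z', z' = -(x + y) := ⟨_, rfl⟩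
    have hzz' : z = z' + w := by rw [hz', hw]; abel
    have hzc : (z' : Q) = -(x + y : Q) := by rw [hz']; rfl
    have hzw : Commute (w : Q) z' := by rw [hzc]; exact (hx'.add_right hy').neg_right
    have e1 : F z x = F z' x := Units.ext <| by
      rw [hF, hF, hzz']
      exact hΦ.eval_add_left h0 hI z'.2 x.2 w.2 hzw hx'
    have e2 : F y z = F y z' := Units.ext <| by
      rw [hF, hF, hzz']
      exact hΦ.eval_add_right h0 hanti hI y.2 z'.2 w.2 hy' hzw
    have e3 : E z = E w * E z' := by rw [hzz', add_comm, hadd hzw]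
    have hH : E x * F z' x * E z' * F y z' * E y * F x y = 1 := Units.ext <| by
      simp only [Units.val_mul, hE, hF, hzc]
      exact hhex.eval_eq hI x.2 y.2
    rw [e1, e2, e3]
    calc _ = E w * (E x * F z' x * E z' * F y z' * E y * F x y) := by
          have h := ((hEE hx').mul_right (hEF hzw hx')).eq
          simp only [← mul_assoc] at h ⊢
          rw [h]
      _ = _ := by rw [hH, mul_one]
  · intro x
    rw [AssociatorCalculus.exp, Units.val_mul, hE, ← nilExp_two_mul hI x.2]

lemma exists_braidCalculus (hΦ : IsGroupLike Φ) (h0 : Φ [0] = 0) (hanti : Antisymmetry Φ)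
    (hhex : AssocHexagon 1 Φ) (hI : I ^ (N + 1) = ⊥)
    (hQ : ∀ q : Q, ∃ r : k, q - algebraMap k Q r ∈ I)
    (h : Φ.eval N (infT k N (0 : Fin 4) 1) (infT k N 1 2 + infT k N 1 3) *
        Φ.eval N (infT k N 0 2 + infT k N 1 2) (infT k N 2 3) =
      Φ.eval N (infT k N (1 : Fin 4) 2) (infT k N 2 3) *
        Φ.eval N (infT k N 0 1 + infT k N 0 2) (infT k N 1 3 + infT k N 2 3) *
        Φ.eval N (infT k N 0 1) (infT k N 1 2))
    {t : Fin 4 → Fin 4 → Q} (ht : InfBraidFamily t) (hm : ∀ i j, t i j ∈ I) :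
    ∃ B : BraidCalculus I Qˣ, (∀ x y, (B.assoc x y : Q) = Φ.eval (N + 1) (x : Q) y) ∧
      (∀ x, (B.exp x : Q) = nilExp k (N + 1) (x : Q)) ∧
      (∀ x y, B.comm x y ↔ Commute (x : Q) y) ∧
      (B.t12 : Q) = t 0 1 ∧ (B.t13 : Q) = t 0 2 ∧ (B.t23 : Q) = t 1 2 ∧ (B.t24 : Q) = t 1 3 ∧
      (B.t34 : Q) = t 2 3 := by
  obtain ⟨C, hC, hF, hE⟩ := exists_associatorCalculus hΦ h0 hanti hhex hI
  obtain ⟨T, hT⟩ : ∃ T : Fin 4 → Fin 4 → I, ∀ i j, (T i j : Q) = t i j :=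
    ⟨fun i j => ⟨t i j, hm i j⟩, fun i j => rfl⟩
  have hsymm : ∀ i j, T i j = T j i := fun i j => Subtype.ext (by rw [hT, hT, ht.symm])
  have htri : ∀ i j l, i ≠ j → i ≠ l → j ≠ l → C.comm (T i j) (T i l + T j l) :=
    fun i j l hij hil hjl => (hC _ _).2 (by
      rw [Submodule.coe_add, hT, hT, hT]; exact ht.triple i j l hij hil hjl)
  have hdis : ∀ i j l m, i ≠ j → i ≠ l → i ≠ m → j ≠ l → j ≠ m → l ≠ m →
      C.comm (T i j) (T l m) := fun i j l m h1 h2 h3 h4 h5 h6 =>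
    (hC _ _).2 (by rw [hT, hT]; exact ht.disjoint i j l m h1 h2 h3 h4 h5 h6)
  have hpent : ∀ (σ : Equiv.Perm (Fin 4)) (g : Qˣ),
      (C.assoc (T (σ 0) (σ 1)) (T (σ 1) (σ 2) + T (σ 1) (σ 3)) *
        C.assoc (T (σ 0) (σ 2) + T (σ 1) (σ 2)) (T (σ 2) (σ 3)))⁻¹ * g *
      (C.assoc (T (σ 0) (σ 1)) (T (σ 1) (σ 2) + T (σ 1) (σ 3)) *
        C.assoc (T (σ 0) (σ 2) + T (σ 1) (σ 2)) (T (σ 2) (σ 3))) =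
      (C.assoc (T (σ 1) (σ 2)) (T (σ 2) (σ 3)) * C.assoc (T (σ 0) (σ 1) + T (σ 0) (σ 2))
        (T (σ 1) (σ 3) + T (σ 2) (σ 3)) * C.assoc (T (σ 0) (σ 1)) (T (σ 1) (σ 2)))⁻¹ * g *
      (C.assoc (T (σ 1) (σ 2)) (T (σ 2) (σ 3)) * C.assoc (T (σ 0) (σ 1) + T (σ 0) (σ 2))
        (T (σ 1) (σ 3) + T (σ 2) (σ 3)) * C.assoc (T (σ 0) (σ 1)) (T (σ 1) (σ 2))) := by
    intro σ g
    -- The pentagon at level `N` leaves an error in `I ^ N`, and conjugation does not see it.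
    refine inv_mul_mul_eq_of_sub_mem' hI hQ ?_ g
    have := assocPentagon_sub_mem (k := k) h (ht.perm σ) fun i j => hm (σ i) (σ j)
    simp only [Units.val_mul, hF, Submodule.coe_add, hT]
    exact this
  have e01 := hsymm 1 0
  have e02 := hsymm 2 0
  have e03 := hsymm 3 0
  have e12 := hsymm 2 1
  have e13 := hsymm 3 1
  have e23 := hsymm 3 2
  refine ⟨{ C with
    t12 := T 0 1, t13 := T 0 2, t14 := T 0 3, t23 := T 1 2, t24 := T 1 3, t34 := T 2 3
    comm_12_34 := hdis 0 1 2 3 (by decide) (by decide) (by decide) (by decide) (by decide)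
      (by decide)
    comm_13_24 := hdis 0 2 1 3 (by decide) (by decide) (by decide) (by decide) (by decide)
      (by decide)
    comm_14_23 := hdis 0 3 1 2 (by decide) (by decide) (by decide) (by decide) (by decide)
      (by decide)
    comm_12_3 := htri 0 1 2 (by decide) (by decide) (by decide)
    comm_12_4 := htri 0 1 3 (by decide) (by decide) (by decide)
    comm_13_2 := e12 ▸ htri 0 2 1 (by decide) (by decide) (by decide)
    comm_13_4 := htri 0 2 3 (by decide) (by decide) (by decide)
    comm_23_1 := by
      have := htri 1 2 0 (by decide) (by decide) (by decide)
      rwa [e01, e02] at this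
    comm_23_4 := htri 1 2 3 (by decide) (by decide) (by decide)
    comm_14_2 := by
      have := htri 0 3 1 (by decide) (by decide) (by decide)
      rwa [e13] at this
    comm_14_3 := by
      have := htri 0 3 2 (by decide) (by decide) (by decide)
      rwa [e23] at this
    comm_24_1 := by
      have := htri 1 3 0 (by decide) (by decide) (by decide)
      rwa [e01, e03] at this
    comm_24_3 := by
      have := htri 1 3 2 (by decide) (by decide) (by decide)
      rwa [e23] at this
    comm_34_1 := by
      have := htri 2 3 0 (by decide) (by decide) (by decide)
      rwa [e02, e03] at this
    comm_34_2 := by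
      have := htri 2 3 1 (by decide) (by decide) (by decide)
      rwa [e12, e13] at this
    pentagon_1234 := hpent 1
    pentagon_1324 := fun g => by
      have : (C.assoc (T 0 2) (T 2 1 + T 2 3) * C.assoc (T 0 1 + T 2 1) (T 1 3))⁻¹ * g *
        (C.assoc (T 0 2) (T 2 1 + T 2 3) * C.assoc (T 0 1 + T 2 1) (T 1 3)) =
        (C.assoc (T 2 1) (T 1 3) * C.assoc (T 0 2 + T 0 1) (T 2 3 + T 1 3) *
          C.assoc (T 0 2) (T 2 1))⁻¹ * g *
        (C.assoc (T 2 1) (T 1 3) * C.assoc (T 0 2 + T 0 1) (T 2 3 + T 1 3) *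
          C.assoc (T 0 2) (T 2 1)) := hpent (Equiv.swap 1 2) g
      rwa [e12, add_comm (T 0 2) (T 0 1), add_comm (T 2 3) (T 1 3)] at this
    pentagon_1243 := fun g => by
      have : (C.assoc (T 0 1) (T 1 3 + T 1 2) * C.assoc (T 0 3 + T 1 3) (T 3 2))⁻¹ * g *
        (C.assoc (T 0 1) (T 1 3 + T 1 2) * C.assoc (T 0 3 + T 1 3) (T 3 2)) =
        (C.assoc (T 1 3) (T 3 2) * C.assoc (T 0 1 + T 0 3) (T 1 2 + T 3 2) *
          C.assoc (T 0 1) (T 1 3))⁻¹ * g *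
        (C.assoc (T 1 3) (T 3 2) * C.assoc (T 0 1 + T 0 3) (T 1 2 + T 3 2) *
          C.assoc (T 0 1) (T 1 3)) := hpent (Equiv.swap 2 3) g
      rwa [e23, add_comm (T 1 3) (T 1 2)] at this }, hF, hE, hC, hT _ _, hT _ _, hT _ _, hT _ _, hT _ _⟩

end NilpotentCalculus

/-! ### The pentagon for `Φ`. -/

section PentagonTheorem

variable {k : Type*} [Field k] {Q : Type*} [Ring Q] [Algebra k Q] {I : Ideal Q}
  [I.IsTwoSided] {N : ℕ}

lemma nilExp_inv_conj (N : ℕ) (u : Qˣ) (q : Q) :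
    nilExp k N ((u⁻¹ : Qˣ) * q * u) = (u⁻¹ : Qˣ) * nilExp k N q * u := by
  have := nilExp_conj (k := k) N u⁻¹ q
  rwa [inv_inv] at this

lemma inv_conj_mem (u : Qˣ) {q : Q} (hq : q ∈ I) : (u⁻¹ : Qˣ) * q * u ∈ I := by
  have := conj_mem I u⁻¹ hq
  rwa [inv_inv] at this

lemma semiconj_inv_conj (u : Qˣ) (q : Q) : SemiconjBy (u : Q) ((u⁻¹ : Qˣ) * q * u) q := by
  rw [SemiconjBy, ← mul_assoc, ← mul_assoc, Units.mul_inv, one_mul]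

lemma mul_mul_mul_eq_of_semiconj {M : Type*} [Monoid M] {p a q f₁ f₂ f₃ g₁ g₂ : M}
    (h₁ : a * q * f₁ = g₁ * (a * q)) (h₂ : q * f₂ = g₂ * q) :
    p * a * q * (f₁ * f₂ * f₃) = p * g₁ * (a * g₂) * (q * f₃) :=
  calc p * a * q * (f₁ * f₂ * f₃) = p * (a * q * f₁) * f₂ * f₃ := by simp only [mul_assoc]
    _ = p * g₁ * a * (q * f₂) * f₃ := by rw [h₁]; simp only [mul_assoc]
    _ = p * g₁ * (a * g₂) * (q * f₃) := by rw [h₂]; simp only [mul_assoc]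

variable [CharZero k]

lemma nilLog_inv_conj_nilExp (hI : I ^ (N + 1) = ⊥) (u : Qˣ) {q : Q} (hq : q ∈ I) :
    nilLog k (N + 1) ((u⁻¹ : Qˣ) * nilExp k (N + 1) q * u) = (u⁻¹ : Qˣ) * q * u := by
  rw [← nilExp_inv_conj, nilLog_nilExp k (Ideal.pow_eq_zero_of_pow_eq_bot hI (inv_conj_mem u hq))]

variable {c : k} {f Φ : NCSeries k}

/-- `F` is the common value of the two sides of the pentagon of `f` under the representation built
from `Φ`. The logarithms of the braid generators become conjugates of the `t i j` by values of `Φ`,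
so each value of `f` combines with one value of `Φ` into a rescaled value of `Φ`. -/
lemma exists_mul_eq_rescaled_pentagon (hf : IsGroupLike f) (hfP : GTPentagon f)
    (hfix : FixedUpToRescaling c f Φ) (hΦ : IsGroupLike Φ) (h0 : Φ [0] = 0)
    (hanti : Antisymmetry Φ) (hhex : AssocHexagon 1 Φ) (hI : I ^ (N + 1) = ⊥)
    (hQ : ∀ q : Q, ∃ r : k, q - algebraMap k Q r ∈ I)
    (h : Φ.eval N (infT k N (0 : Fin 4) 1) (infT k N 1 2 + infT k N 1 3) *
        Φ.eval N (infT k N 0 2 + infT k N 1 2) (infT k N 2 3) =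
      Φ.eval N (infT k N (1 : Fin 4) 2) (infT k N 2 3) *
        Φ.eval N (infT k N 0 1 + infT k N 0 2) (infT k N 1 3 + infT k N 2 3) *
        Φ.eval N (infT k N 0 1) (infT k N 1 2))
    {t : Fin 4 → Fin 4 → Q} (ht : InfBraidFamily t) (hm : ∀ i j, t i j ∈ I) :
    ∃ F : Q, F - 1 ∈ I ∧
      Φ.eval (N + 1) (t 0 1) (t 1 2 + t 1 3) * Φ.eval (N + 1) (t 0 2 + t 1 2) (t 2 3) * F =
        Φ.eval (N + 1) (c • t 0 1) (c • (t 1 2 + t 1 3)) *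
          Φ.eval (N + 1) (c • (t 0 2 + t 1 2)) (c • t 2 3) ∧
      Φ.eval (N + 1) (t 1 2) (t 2 3) * Φ.eval (N + 1) (t 0 1 + t 0 2) (t 1 3 + t 2 3) *
          Φ.eval (N + 1) (t 0 1) (t 1 2) * F =
        Φ.eval (N + 1) (c • t 1 2) (c • t 2 3) *
          Φ.eval (N + 1) (c • (t 0 1 + t 0 2)) (c • (t 1 3 + t 2 3)) *
          Φ.eval (N + 1) (c • t 0 1) (c • t 1 2) := by
  obtain ⟨B, hF, hE, hC, h12, h13, h23, h24, h34⟩ :=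
    exists_braidCalculus hΦ h0 hanti hhex hI hQ h ht hm
  have hpent := assocPentagon_sub_mem h ht hm
  rw [← h12, ← h13, ← h23, ← h24, ← h34] at hpent ⊢
  simp only [← Submodule.coe_add, ← hF] at hpent ⊢
  have hexpLog : ∀ (g u : Qˣ) (x : I), g = u⁻¹ * B.exp x * u →
      nilLog k (N + 1) (g : Q) = (u⁻¹ : Qˣ) * x * u ∧
        nilExp k (N + 1) (nilLog k (N + 1) (g : Q)) = g := by
    rintro _ u x rfl
    have := nilLog_inv_conj_nilExp (k := k) hI u x.2
    rw [Units.val_mul, Units.val_mul, hE, this, nilExp_inv_conj]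
    exact ⟨rfl, rfl⟩
  have hker : ∀ g ∈ (Units.map (Ideal.Quotient.mk I : Q →* Q ⧸ I)).ker, (g : Q) - 1 ∈ I := by
    intro g hg
    rw [MonoidHom.mem_ker] at hg
    exact Ideal.Quotient.eq.1 (congrArg Units.val hg)
  have hexp : ∀ x, Units.map (Ideal.Quotient.mk I : Q →* Q ⧸ I) (B.exp x) = 1 := by
    intro x
    refine Units.ext (Ideal.Quotient.eq.2 ?_)
    rw [hE]
    exact nilExp_sub_one_mem k x.2
  obtain ⟨G, hG⟩ := exists_pureBraid_lift (k := k) hI B.pureBraidHom (by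
    intro i j hij
    rw [B.pureBraidHom_X]
    refine hker _ ?_
    rw [MonoidHom.mem_ker]
    fin_cases i <;> fin_cases j <;>
      simp [BraidCalculus.X, BraidCalculus.X12, BraidCalculus.X13, BraidCalculus.X14,
        BraidCalculus.X23, BraidCalculus.X24, BraidCalculus.X34, BraidCalculus.X24X34, hexp])
  set q := B.assoc B.t12 B.t23 with hq
  set r := B.assoc (B.t13 + B.t23) B.t34 with hr
  set s := B.assoc B.t12 (B.t23 + B.t24) with hs
  set p := B.assoc B.t23 B.t34 with hp
  set a := B.assoc (B.t12 + B.t13) (B.t24 + B.t34) with ha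
  have hch : ∀ (g g' u u' w : Qˣ) (x x' y : I), g = u⁻¹ * B.exp x * u → g' = u'⁻¹ * B.exp x' * u' →
      g * g' = w⁻¹ * B.exp y * w →
      nilCH k (N + 1) (nilLog k (N + 1) (g : Q)) (nilLog k (N + 1) (g' : Q)) =
        (w⁻¹ : Qˣ) * y * w := by
    intro g g' u u' w x x' y h1 h2 h3
    rw [nilCH, (hexpLog g u x h1).2, (hexpLog g' u' x' h2).2, ← Units.val_mul]
    exact (hexpLog _ w y h3).1
  have x12 : B.X 0 1 = 1⁻¹ * B.exp B.t12 * 1 := by rw [inv_one, one_mul, mul_one]; rfl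
  have x23 : B.X 1 2 = q⁻¹ * B.exp B.t23 * q := rfl
  have x34 : B.X 2 3 = r⁻¹ * B.exp B.t34 * r := rfl
  obtain ⟨v, x13⟩ : ∃ v : Qˣ, B.X 0 2 = v⁻¹ * B.exp B.t13 * v := by
    refine ⟨(q⁻¹ * B.half B.t23 * B.assoc B.t13 B.t23)⁻¹, ?_⟩
    rw [inv_inv]; exact B.X13_eq
  obtain ⟨v', x24⟩ : ∃ v' : Qˣ, B.X 1 3 = v'⁻¹ * B.exp B.t24 * v' := by
    refine ⟨(B.assoc B.t24 B.t34)⁻¹ * (B.half B.t34)⁻¹ * (s * r), ?_⟩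
    refine B.X24_eq.trans ?_
    rw [hs, hr]; group
  have l12 : nilLog k (N + 1) (B.X 0 1 : Q) = B.t12 := by
    have := (hexpLog _ _ _ x12).1
    simpa using this
  have l23 := (hexpLog _ _ _ x23).1
  have l34 := (hexpLog _ _ _ x34).1
  have c2324 := hch _ _ _ _ (s * r) _ _ (B.t23 + B.t24) x23 x24 B.X23_mul_X24
  have c1323 := hch _ _ _ _ 1 _ _ (B.t13 + B.t23) x13 x23
    (by rw [inv_one, one_mul, mul_one]; exact B.X13_mul_X23)
  have c1213 := hch _ _ _ _ q _ _ (B.t12 + B.t13) x12 x13 B.X12_mul_X13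
  have c2434 := hch _ _ _ _ (a * q) _ _ (B.t24 + B.t34) x24 x34 B.X24_mul_X34
  have hG' := congrArg G (hfP (N + 1))
  simp only [map_mul, NCSeries.eval_map, nilCH_map, hG, B.pureBraidHom_X] at hG'
  rw [c2324, c1323, c1213, c2434, l12, l23, l34] at hG'
  simp only [inv_one, Units.val_one, one_mul, mul_one] at hG'
  have hcomm : ∀ x y z : I, B.comm x y → B.comm x z → Commute (B.assoc y z : Q) x := by
    intro x y z hy hz
    rw [hF]
    exact (NCSeries.commute_eval _ _ ((hC _ _).1 hy) ((hC _ _).1 hz)).symm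
  -- The right side of the pentagon needs `x₃₄` conjugated along its own route; the two conjugators
  -- differ only by a top-degree error and by `s`, which commutes with `t₃₄`.
  have hc : (r⁻¹ : Qˣ) * (B.t34 : Q) * r = ((a * q)⁻¹ : Qˣ) * ((p⁻¹ : Qˣ) * B.t34 * p) * (a * q : Qˣ) := by
    have h1 := inv_mul_mul_eq_of_sub_mem hI hQ
      (u := s * r) (v := p * a * q) (by simpa only [Units.val_mul] using hpent) (B.t34 : Q)
    have h2 : (s⁻¹ : Qˣ) * (B.t34 : Q) * s = B.t34 := by
      rw [mul_assoc, ← (hcomm _ _ _ (B.comm_symm B.comm_12_34) B.comm_34_2).eq,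
        Units.inv_mul_cancel_left]
    conv_lhs => rw [← h2]
    simp only [mul_inv_rev, Units.val_mul, mul_assoc] at h1 ⊢
    exact h1
  obtain ⟨F, hFdef⟩ : ∃ F, F = f.eval (N + 1) (B.t12 : Q)
      (((s * r)⁻¹ : Qˣ) * ((B.t23 + B.t24 : I) : Q) * (s * r : Qˣ)) *
      f.eval (N + 1) ((B.t13 + B.t23 : I) : Q) ((r⁻¹ : Qˣ) * B.t34 * r) := ⟨_, rfl⟩
  refine ⟨F, ?_, ?_, ?_⟩
  · have h1 := NCSeries.eval_sub_mem (N := N) f B.t12.2 (inv_conj_mem (s * r) (B.t23 + B.t24).2)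
    have h2 := NCSeries.eval_sub_mem (N := N) f (B.t13 + B.t23).2 (inv_conj_mem r B.t34.2)
    rw [hf.1, one_smul] at h1 h2
    rw [hFdef, ← sub_add_sub_cancel, ← sub_one_mul]
    exact I.add_mem (Ideal.mul_mem_right _ _ h1) h2
  · have h1 : (r : Q) * f.eval (N + 1) (B.t12 : Q)
        (((s * r)⁻¹ : Qˣ) * ((B.t23 + B.t24 : I) : Q) * (s * r : Qˣ)) =
        f.eval (N + 1) (B.t12 : Q) ((s⁻¹ : Qˣ) * ((B.t23 + B.t24 : I) : Q) * s) * r := by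
      refine NCSeries.eval_semiconj _ _ (hcomm _ _ _ B.comm_12_3 B.comm_12_34) ?_
      rw [SemiconjBy]
      simp only [mul_inv_rev, Units.val_mul, mul_assoc, Units.mul_inv_cancel_left]
    rw [hFdef, mul_assoc, ← mul_assoc (r : Q), h1, mul_assoc, ← mul_assoc (s : Q),
      hfix.mul_eval_conj hΦ.1 hI B.t12.2 (B.t23 + B.t24).2 (hF _ _),
      hfix.mul_eval_conj hΦ.1 hI (B.t13 + B.t23).2 B.t34.2 (hF _ _)]
  · have h1 : ((a * q : Qˣ) : Q) * f.eval (N + 1) ((q⁻¹ : Qˣ) * (B.t23 : Q) * q)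
        ((r⁻¹ : Qˣ) * B.t34 * r) =
        f.eval (N + 1) (B.t23 : Q) ((p⁻¹ : Qˣ) * B.t34 * p) * (a * q : Qˣ) := by
      refine NCSeries.eval_semiconj _ _ ?_ ?_
      · rw [Units.val_mul]
        exact SemiconjBy.mul_left (hcomm _ _ _ B.comm_23_1 B.comm_23_4) (semiconj_inv_conj _ _)
      · rw [hc]
        exact semiconj_inv_conj _ _
    have h2 : (q : Q) * f.eval (N + 1) ((q⁻¹ : Qˣ) * ((B.t12 + B.t13 : I) : Q) * q)
        (((a * q)⁻¹ : Qˣ) * ((B.t24 + B.t34 : I) : Q) * (a * q : Qˣ)) =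
        f.eval (N + 1) ((B.t12 + B.t13 : I) : Q) ((a⁻¹ : Qˣ) * ((B.t24 + B.t34 : I) : Q) * a) *
          q := by
      refine NCSeries.eval_semiconj _ _ (semiconj_inv_conj _ _) ?_
      rw [SemiconjBy]
      simp only [mul_inv_rev, Units.val_mul, mul_assoc, Units.mul_inv_cancel_left]
    rw [Units.val_mul] at h1
    have e1 := hfix.mul_eval_conj hΦ.1 hI B.t23.2 B.t34.2 (hF _ _)
    have e2 := hfix.mul_eval_conj hΦ.1 hI (B.t12 + B.t13).2 (B.t24 + B.t34).2 (hF _ _)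
    have e3 := hfix.mul_eval_conj hΦ.1 hI B.t12.2 B.t23.2 (hF _ _)
    rw [hFdef, hG', ← e1, ← e2, ← e3]
    exact mul_mul_mul_eq_of_semiconj h1 h2

lemma FixedUpToRescaling.assocPentagon (hc : ∀ n : ℕ, 0 < n → c ^ n ≠ 1) (hf : IsGroupLike f)
    (hfP : GTPentagon f) (hΦ : IsGroupLike Φ) (h0 : Φ [0] = 0) (hanti : Antisymmetry Φ)
    (hhex : AssocHexagon 1 Φ) (hfix : FixedUpToRescaling c f Φ) : AssocPentagon Φ := by
  intro N
  induction N with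
  | zero => exact (subsingleton_augTrunc_zero _).elim _ _
  | succ N ih =>
    rcases N with _ | N
    · simp [NCSeries.eval_one, hΦ.1]
    have hI := truncIdeal_pow (infBraidAug k 4) (N + 1 + 1)
    have hm := fun i j : Fin 4 => infT_mem (k := k) (N + 1 + 1) i j
    have hQ := exists_sub_mem_truncIdeal (k := k) (ε := infBraidAug k 4) (N := N + 1 + 1)
    have ht := infBraidFamily_infT (k := k) 4 (N + 1 + 1)
    obtain ⟨F, hF, h1, h2⟩ := exists_mul_eq_rescaled_pentagon hf hfP hfix hΦ h0 hanti hhex hI hQ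
      ih ht hm
    have he := assocPentagon_sub_mem ih ht hm
    obtain ⟨G, hGt, hG⟩ := exists_infBraid_scale 4 c (N + 1)
    have h3 := hG _ he
    -- The error times `F - 1` vanishes, so multiplication by `F` fixes the error, while the two
    -- identities say that it rescales it.
    have h4 := Ideal.mul_eq_zero_of_mem_pow hI he hF
    simp only [map_sub, map_mul, NCSeries.eval_map, map_add, hGt, ← smul_add, ← h1, ← h2] at h3
    rw [mul_sub, mul_one, sub_eq_zero] at h4
    rw [← sub_mul, h4] at h3
    exact sub_eq_zero.1 (eq_zero_of_smul_eq (hc _ N.succ_pos) h3.symm)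

end PentagonTheorem

theorem theorem3p2 {k : Type*} [Field k] [CharZero k] (c : kˣ) (f : NCSeries k)
    (hf : (c, f) ∈ GT k) (hc : ∀ n : ℕ, 0 < n → c ^ n ≠ 1) :
    ∃! Φ : NCSeries k, Φ ∈ Assoc (1 : k) ∧ FixedUpToRescaling (c : k) f Φ := by
  obtain ⟨hgl, hanti, hhex, hpent⟩ := hf
  have hc' : ∀ n : ℕ, 0 < n → (c : k) ^ n ≠ 1 := fun n hn h => hc n hn (Units.ext (by simpa using h))
  have hf0 := hpent.apply_zero hgl.1
  have hf1 := hanti.apply_one hgl.1 hf0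
  obtain ⟨Φ, hΦ, hfix⟩ := exists_fixedUpToRescaling hc' hgl.1
  have hΦgl := hfix.isGroupLike hc' hΦ hgl
  have hΦanti := hfix.antisymmetry hc' hΦ hanti
  obtain ⟨h0, h1⟩ := hfix.linear_eq_zero hc' hΦ hgl.1 hf0 hf1
  have hΦhex := hfix.assocHexagon c.ne_zero hc' hhex hf0 hf1 hΦ h0 h1 hΦanti
  have hΦpent := hfix.assocPentagon hc' hgl hpent hΦgl h0 hΦanti hΦhex
  exact ⟨Φ, ⟨⟨hΦgl, hΦanti, hΦhex, hΦpent⟩, hfix⟩, fun Ψ hΨ =>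
    FixedUpToRescaling.unique hc' hgl.1 hΨ.1.1.1 hΦ hΨ.2 hfix⟩
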